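/- Setting. A translation surface is a Hausdorff surface with an atlas whose transition maps are locally translations of $\mathbb{R}^2$; it carries the path metric of $dx^2+dy^2$, with metric completion $\overline{X}$ and frontier $\partial X=\overline{X}\setminus X$. A covering of translation surfaces is a covering map that is locally a translation in charts. Let $X$ be a connected translation surface that covers a connected translation surface $Y$ which is precompact (totally bounded) and has $\partial Y\neq\emptyset$. Let $p:\tilde X\to X$ be the universal covering with the lifted translation structure, and assume that $\partial X$, $\partial\tilde X$ and $\partial Y$ are discrete. Let $\mathrm{dev}:\tilde X\to\mathbb{R}^2$ be a developing map (a map that is locally a translation in charts), extended continuously to the completion of $\tilde X$. A planar subconic is a set $\{x\in\mathbb{R}^2 : q(x_1,x_2,1)<0\}$ with $q$ a real quadratic form on $\mathbb{R}^3$. A subconic of $\tilde X$ is a subset $\tilde U\subset\tilde X$ that is convex (any two of its points are joined by a geodesic segment in $\tilde U$) and whose image $\mathrm{dev}(\tilde U)$ is a planar subconic. Let $\partial\tilde U$ be its closure minus its interior in the completion of $\tilde X$. It is rigid if $\partial\tilde U\cap\partial\tilde X$ has at least five points and its image under $\mathrm{dev}$ has maximal span in $\mathbb{R}^2$, where $A\subset\mathbb{R}^d$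 has maximal span if for some $B\subset A$ the span of $\{b-b' : b,b'\in B\}$ has dimension at least $d$ or at least $\mathrm{Card}(A)-1$. A (rigid) subconic $U$ of $X$ is an orbit, under the covering transformations of $p$, of a (rigid) subconic $\tilde U$ of $\tilde X$; the members of the orbit are the lifts of $U$. We say that $U$ contains $V\subset X$ if the inclusion $V\to X$ factors through $U$, that is, if there are a lift $\tilde U$ and a continuous section $s:V\to\tilde X$ of $p$ over $V$ with $s(V)\subset\tilde U$. For $Z\subset\partial\tilde X$ let $\mathcal S_Z$ be the set of subconics $U$ of $\tilde X$ such that $\partial U\cap\partial\tilde X=Z$ and $Z$ meets every connected component of $\partial U$, and let $\overline{\mathcal S}_Z$ be the set of subconics $U$ of $\tilde X$ with $Z\subset\partial U\cap\partial\tilde X$. The cells of the cell complex $\mathcal S_3(\tilde X)$ are the nonempty sets $\mathcal S_Z$ with $\mathrm{Card}(Z)\ge 3$. Proposition. (1) For every nonempty open $V\subset X$, only finitely many rigid subconics of $X$ contain $V$. (2) In particular, for every nonempty open $V\subset\tilde X$, only finitely many rigid subconics $\tilde U$ of $\tilde X$ satisfy $V\subset\tilde U$. (3) The cell complex is closure-finite: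 for every cell $\mathcal S_Z$, only finitely many cells meet $\overline{\mathcal S}_Z$. -/

import Mathlib

open Set Filter Topology

namespace FlatSurface

/-! ## Translation surfaces -/

/-- The Euclidean plane. -/
abbrev Plane : Type := EuclideanSpace ℝ (Fin 2)

/-- Maps of the plane that are, on the given set, locally translations. -/
def translationPregroupoid : Pregroupoid Plane where
  property f s := ∀ x ∈ s, ∃ v : Plane, ∀ᶠ y in 𝓝 x, f y = y + v
  comp := by
    intro f g u v hf hg _ _ _ x hx
    obtain ⟨a, ha⟩ := hf x hx.1
    obtain ⟨b, hb⟩ := hg (f x) hx.2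
    have hc : Tendsto f (𝓝 x) (𝓝 (f x)) := by
      have h1 : Tendsto (fun y : Plane => y + a) (𝓝 x) (𝓝 (x + a)) :=
        (continuous_id.add continuous_const).tendsto x
      rw [ha.self_of_nhds]
      exact h1.congr' (ha.mono fun y hy => hy.symm)
    refine ⟨a + b, ?_⟩
    filter_upwards [ha, hc.eventually hb] with y h1 h2
    rw [Function.comp_apply, h2, h1, add_assoc]
  id_mem := fun _ _ => ⟨0, Eventually.of_forall fun y => by simp⟩
  locality := by
    intro f u _ h x hx
    obtain ⟨v, _, hxv, hv⟩ := h x hx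
    exact hv x ⟨hx, hxv⟩
  congr := by
    intro f g u hu hfg hf x hx
    obtain ⟨a, ha⟩ := hf x hx
    refine ⟨a, ?_⟩
    filter_upwards [ha, hu.mem_nhds hx] with y h1 h2
    rw [hfg y h2, h1]

/-- A translation surface is a charted space over the plane whose transition maps belong to this
groupoid, that is, are locally translations. -/
def translationGroupoid : StructureGroupoid Plane := translationPregroupoid.groupoid

section Surface

variable (X : Type*) [TopologicalSpace X] [ChartedSpace Plane X]

variable {X} in
/-- A parametrized curve `γ : [a, b] → X` together with a development `c : [a, b] → ℝ²` of it:
in every chart of the atlas, `c` differs from `γ` locally by a translation. -/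
structure IsDevelopedCurve (γ : ℝ → X) (c : ℝ → Plane) (a b : ℝ) : Prop where
  le : a ≤ b
  continuousOn : ContinuousOn γ (Icc a b)
  development : ∀ t ∈ Icc a b, ∀ e ∈ atlas Plane X, γ t ∈ e.source →
    ∃ v : Plane, ∀ᶠ u in 𝓝[Icc a b] t, c u = e (γ u) + v

variable {X} in
/-- The distance of the flat metric `dx² + dy²`: the infimum of the lengths of curves, where the
length of a curve is the total variation of a development. -/
noncomputable def flatEDist (x y : X) : ENNReal :=
  ⨅ (γ : ℝ → X) (c : ℝ → Plane) (a : ℝ) (b : ℝ)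
    (_ : IsDevelopedCurve γ c a b ∧ γ a = x ∧ γ b = y), eVariationOn c (Icc a b)

section Lemmas

variable {X}

theorem flatEDist_le {γ : ℝ → X} {c : ℝ → Plane} {a b : ℝ} {x y : X}
    (h : IsDevelopedCurve γ c a b) (hx : γ a = x) (hy : γ b = y) :
    flatEDist x y ≤ eVariationOn c (Icc a b) :=
  iInf_le_of_le γ <| iInf_le_of_le c <| iInf_le_of_le a <| iInf_le_of_le b <|
    iInf_le_of_le ⟨h, hx, hy⟩ le_rfl

theorem flatEDist_self (x : X) : flatEDist x x = 0 := by
  have h : IsDevelopedCurve (fun _ : ℝ => x) (fun _ => (0 : Plane)) 0 0 :=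
    ⟨le_rfl, continuousOn_const, fun t _ e _ _ =>
      ⟨-e x, Eventually.of_forall fun u => by simp⟩⟩
  refine le_antisymm ((flatEDist_le h rfl rfl).trans ?_) bot_le
  rw [eVariationOn.subsingleton _ (by simp)]

theorem flatEDist_comm_le (x y : X) : flatEDist y x ≤ flatEDist x y := by
  refine le_iInf fun γ => le_iInf fun c => le_iInf fun a => le_iInf fun b => le_iInf ?_
  rintro ⟨h, rfl, rfl⟩
  have himg : (fun t : ℝ => -t) '' Icc (-b) (-a) = Icc a b := by simp
  have hmaps : MapsTo (fun t : ℝ => -t) (Icc (-b) (-a)) (Icc a b) := by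
    rw [← himg]; exact mapsTo_image _ _
  have h' : IsDevelopedCurve (fun t => γ (-t)) (fun t => c (-t)) (-b) (-a) := by
    refine ⟨neg_le_neg h.le, h.continuousOn.comp continuous_neg.continuousOn hmaps, ?_⟩
    intro t ht e he hs
    obtain ⟨v, hv⟩ := h.development (-t) (hmaps ht) e he hs
    refine ⟨v, ?_⟩
    have : Tendsto (fun t : ℝ => -t) (𝓝[Icc (-b) (-a)] t) (𝓝[Icc a b] (-t)) :=
      (continuous_neg.continuousWithinAt).tendsto_nhdsWithin hmaps
    exact this.eventually hv
  refine (flatEDist_le h' (by simp) (by simp)).trans ?_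
  have := eVariationOn.comp_eq_of_antitoneOn c (t := Icc (-b) (-a)) (fun t : ℝ => -t)
    (fun s _ t _ hst => neg_le_neg hst)
  rw [himg] at this
  exact this.le

theorem IsDevelopedCurve.shift {γ : ℝ → X} {c : ℝ → Plane} {a b : ℝ}
    (h : IsDevelopedCurve γ c a b) (k : ℝ) (w : Plane) :
    IsDevelopedCurve (fun t => γ (t - k)) (fun t => c (t - k) + w) (a + k) (b + k) := by
  have hmaps : MapsTo (fun t : ℝ => t - k) (Icc (a + k) (b + k)) (Icc a b) :=
    fun t ht => ⟨by linarith [ht.1], by linarith [ht.2]⟩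
  refine ⟨by linarith [h.le], h.continuousOn.comp (by fun_prop) hmaps, ?_⟩
  intro t ht e he hs
  obtain ⟨v, hv⟩ := h.development (t - k) (hmaps ht) e he hs
  refine ⟨v + w, ?_⟩
  have : Tendsto (fun t : ℝ => t - k) (𝓝[Icc (a + k) (b + k)] t) (𝓝[Icc a b] (t - k)) :=
    (by fun_prop : ContinuousWithinAt (fun t : ℝ => t - k) _ t).tendsto_nhdsWithin hmaps
  filter_upwards [this.eventually hv] with u hu
  rw [hu, add_assoc]

theorem eVariationOn_shift (c : ℝ → Plane) (a b k : ℝ) (w : Plane) :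
    eVariationOn (fun t => c (t - k) + w) (Icc (a + k) (b + k)) = eVariationOn c (Icc a b) := by
  have himg : (fun t : ℝ => t - k) '' Icc (a + k) (b + k) = Icc a b := by simp
  have h1 : eVariationOn (fun t => c (t - k) + w) (Icc (a + k) (b + k)) =
      eVariationOn (c ∘ fun t => t - k) (Icc (a + k) (b + k)) := by
    simp only [eVariationOn, edist_add_right, Function.comp_apply]
  rw [h1, eVariationOn.comp_eq_of_monotoneOn c _ (fun s _ t _ hst => sub_le_sub_right hst k), himg]

/-- Concatenation of two developed curves that match at the common endpoint. -/
theorem IsDevelopedCurve.concat {γ γ' : ℝ → X} {c c' : ℝ → Plane} {a b d : ℝ}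
    (h : IsDevelopedCurve γ c a b) (h' : IsDevelopedCurve γ' c' b d)
    (hγ : γ b = γ' b) (hc : c b = c' b) :
    IsDevelopedCurve (fun t => if t ≤ b then γ t else γ' t)
      (fun t => if t ≤ b then c t else c' t) a d := by
  have hunion : Icc a d = Icc a b ∪ Icc b d := (Icc_union_Icc_eq_Icc h.le h'.le).symm
  have e1 : ∀ t ∈ Icc a b, (if t ≤ b then γ t else γ' t) = γ t := fun t ht => if_pos ht.2
  have e2 : ∀ t ∈ Icc b d, (if t ≤ b then γ t else γ' t) = γ' t := fun t ht => by
    split_ifs with hb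
    · rw [le_antisymm hb ht.1, hγ]
    · rfl
  have f1 : ∀ t ∈ Icc a b, (if t ≤ b then c t else c' t) = c t := fun t ht => if_pos ht.2
  have f2 : ∀ t ∈ Icc b d, (if t ≤ b then c t else c' t) = c' t := fun t ht => by
    split_ifs with hb
    · rw [le_antisymm hb ht.1, hc]
    · rfl
  refine ⟨h.le.trans h'.le, ?_, ?_⟩
  · rw [hunion]
    exact (h.continuousOn.congr e1).union_of_isClosed (h'.continuousOn.congr e2)
      isClosed_Icc isClosed_Icc
  · intro t ht e he hs
    have left : ∀ v : Plane, (∀ᶠ u in 𝓝[Icc a b] t, c u = e (γ u) + v) →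
        ∀ᶠ u in 𝓝[Icc a b] t, (if u ≤ b then c u else c' u) =
          e (if u ≤ b then γ u else γ' u) + v := fun v hv => by
      filter_upwards [hv, self_mem_nhdsWithin] with u hu hm
      rw [f1 u hm, e1 u hm, hu]
    have right : ∀ v : Plane, (∀ᶠ u in 𝓝[Icc b d] t, c' u = e (γ' u) + v) →
        ∀ᶠ u in 𝓝[Icc b d] t, (if u ≤ b then c u else c' u) =
          e (if u ≤ b then γ u else γ' u) + v := fun v hv => by
      filter_upwards [hv, self_mem_nhdsWithin] with u hu hm
      rw [f2 u hm, e2 u hm, hu]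
    have notl : t ∉ Icc a b → 𝓝[Icc a b] t = ⊥ := fun hn => by
      rw [← notMem_closure_iff_nhdsWithin_eq_bot, isClosed_Icc.closure_eq]; exact hn
    have notr : t ∉ Icc b d → 𝓝[Icc b d] t = ⊥ := fun hn => by
      rw [← notMem_closure_iff_nhdsWithin_eq_bot, isClosed_Icc.closure_eq]; exact hn
    simp only [hunion, nhdsWithin_union, eventually_sup]
    by_cases hl : t ∈ Icc a b
    · rw [e1 t hl] at hs
      obtain ⟨v, hv⟩ := h.development t hl e he hs
      refine ⟨v, left v hv, ?_⟩
      by_cases hr : t ∈ Icc b d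
      · have htb : t = b := le_antisymm hl.2 hr.1
        subst htb
        rw [hγ] at hs
        obtain ⟨v', hv'⟩ := h'.development t hr e he hs
        have k1 := hv.self_of_nhdsWithin hl
        have k2 := hv'.self_of_nhdsWithin hr
        have : v' = v := by
          rw [hc, hγ, k2] at k1
          exact add_left_cancel k1
        exact right v (this ▸ hv')
      · rw [notr hr]; exact eventually_bot
    · have hr : t ∈ Icc b d := by
        rw [hunion] at ht; exact ht.resolve_left hl
      rw [e2 t hr] at hs
      obtain ⟨v, hv⟩ := h'.development t hr e he hs
      refine ⟨v, ?_, right v hv⟩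
      rw [notl hl]; exact eventually_bot

theorem flatEDist_triangle (x y z : X) : flatEDist x z ≤ flatEDist x y + flatEDist y z := by
  simp only [flatEDist, ENNReal.iInf_add, ENNReal.add_iInf]
  refine le_iInf fun γ' => le_iInf fun c' => le_iInf fun a' => le_iInf fun b' => le_iInf ?_
  rintro ⟨h', hy', hz⟩
  refine le_iInf fun γ => le_iInf fun c => le_iInf fun a => le_iInf fun b => le_iInf ?_
  rintro ⟨h, hx, hy⟩
  have hs := h'.shift (b - a') (c b - c' a')
  rw [add_sub_cancel a' b] at hs
  have hb : b - (b - a') = a' := sub_sub_cancel b a'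
  have hcat := h.concat hs (by simp only [hb]; rw [hy, hy']) (by simp only [hb]; abel)
  have hbd : b ≤ b' + (b - a') := by linarith [h'.le]
  have key := flatEDist_le (x := x) (y := z) hcat
    (by simp only [if_pos h.le]; exact hx) (by
      split_ifs with hle
      · have hbb : b' = a' := by linarith [h'.le]
        subst hbb
        rw [add_sub_cancel, hy, ← hy', hz]
      · rw [add_sub_cancel_right]; exact hz)
  refine key.trans ?_
  have hsplit := eVariationOn.Icc_add_Icc
    (fun t => if t ≤ b then c t else c' (t - (b - a')) + (c b - c' a'))
    (s := univ) h.le hbd (mem_univ b)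
  simp only [univ_inter] at hsplit
  rw [← hsplit]
  refine add_le_add (le_of_eq ?_) (le_of_eq ?_)
  · exact eVariationOn.congr fun t ht => if_pos ht.2
  · have h2 := eVariationOn_shift c' a' b' (b - a') (c b - c' a')
    rw [add_sub_cancel a' b] at h2
    rw [← h2]
    refine eVariationOn.congr fun t ht => ?_
    rcases ht.1.eq_or_lt with rfl | hlt
    · simp
    · exact if_neg (not_le.mpr hlt)

end Lemmas

/-- The surface `X` regarded as a metric space with the flat distance. -/
def FlatMetric : Type _ := X

noncomputable instance : PseudoEMetricSpace (FlatMetric X) where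
  edist x y := flatEDist (X := X) x y
  edist_self x := flatEDist_self (X := X) x
  edist_comm x y := le_antisymm (flatEDist_comm_le (X := X) y x) (flatEDist_comm_le (X := X) x y)
  edist_triangle x y z := flatEDist_triangle (X := X) x y z

/-- The metric completion of a translation surface. -/
abbrev FlatCompletion : Type _ := UniformSpace.Completion (FlatMetric X)

variable {X} in
/-- The canonical map of `X` into its metric completion. -/
noncomputable def toCompletion (x : X) : FlatCompletion X :=
  UniformSpace.Completion.coe' (α := FlatMetric X) x

/-- The frontier `∂X` of a translation surface: its completion minus the surface itself. -/
def surfaceFrontier : Set (FlatCompletion X) := (range (toCompletion (X := X)))ᶜ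

/-- A translation surface is precompact if it is totally bounded for the flat metric. -/
def IsPrecompact : Prop := TotallyBounded (univ : Set (FlatMetric X))

end Surface

/-- Translation maps: continuous maps that are locally translations in the charts. -/
def IsTranslationMap {X Y : Type*} [TopologicalSpace X] [ChartedSpace Plane X]
    [TopologicalSpace Y] [ChartedSpace Plane Y] (f : X → Y) : Prop :=
  Continuous f ∧ ∀ e ∈ atlas Plane X, ∀ e' ∈ atlas Plane Y, ∀ x ∈ e.source, f x ∈ e'.source →
    ∃ v : Plane, ∀ᶠ z in 𝓝 x, e' (f z) = e z + v

/-! ## Planar subconics -/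

/-- The planar set `U_q` of all `x` with `q (x₁, x₂, 1) < 0`. -/
def planarSubconic (q : QuadraticForm ℝ (Fin 3 → ℝ)) : Set Plane :=
  {x | q ![x 0, x 1, 1] < 0}

/-- A set `A` in `ℝ^d` has maximal span if some `B ⊆ A` has a difference span of dimension at least
`d` or at least `Card A - 1`. -/
def HasMaximalSpan {d : ℕ} (A : Set (EuclideanSpace ℝ (Fin d))) : Prop :=
  ∃ B ⊆ A, (d : ℕ∞) ≤ (Module.finrank ℝ (Submodule.span ℝ {v | ∃ b ∈ B, ∃ b' ∈ B, v = b - b'}) : ℕ∞) ∨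
    A.encard - 1 ≤ (Module.finrank ℝ (Submodule.span ℝ {v | ∃ b ∈ B, ∃ b' ∈ B, v = b - b'}) : ℕ∞)

/-! ## Subconics of a simply connected translation surface -/

section SimplyConnected

variable {X : Type*} [TopologicalSpace X] [ChartedSpace Plane X]

/-- `x` and `x'` are joined by a geodesic segment inside `A`, that is, by a curve which in the
charts is affinely parametrized with constant velocity. -/
def JoinedByGeodesicIn (A : Set X) (x x' : X) : Prop :=
  ∃ (γ : ℝ → X) (w : Plane), ContinuousOn γ (Icc 0 1) ∧ γ 0 = x ∧ γ 1 = x' ∧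
    MapsTo γ (Icc 0 1) A ∧
    ∀ t ∈ Icc (0 : ℝ) 1, ∀ e ∈ atlas Plane X, γ t ∈ e.source →
      ∀ᶠ u in 𝓝[Icc 0 1] t, e (γ u) = e (γ t) + (u - t) • w

/-- A subset of a translation surface is convex if any two of its points are joined by a geodesic
segment inside it. -/
def IsGeodesicallyConvex (A : Set X) : Prop :=
  ∀ x ∈ A, ∀ x' ∈ A, JoinedByGeodesicIn A x x'

/-- The subconics of a simply connected translation surface with developing map `dev`: convex
subsets whose developed image is a planar subconic. -/
def IsLiftedSubconic (dev : X → Plane) (U : Set X) : Prop :=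
  IsGeodesicallyConvex U ∧ ∃ q : QuadraticForm ℝ (Fin 3 → ℝ), dev '' U = planarSubconic q

/-- The boundary `∂U` of a subset of `X`: closure minus interior in the completion. -/
def completedBoundary (U : Set X) : Set (FlatCompletion X) := frontier (toCompletion '' U)

/-- The set `∂U ∩ ∂X` of cone points on the boundary of `U`. -/
def conePointsOn (U : Set X) : Set (FlatCompletion X) := completedBoundary U ∩ surfaceFrontier X

/-- The continuous extension of the developing map to the completion. -/
noncomputable def devExtension (dev : X → Plane) : FlatCompletion X → Plane :=
  UniformSpace.Completion.extension (α := FlatMetric X) dev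

/-- Membership of a subconic of a simply connected surface in the `n`-stratum. -/
def IsLiftedInStratum (dev : X → Plane) (n : ℕ) (U : Set X) : Prop :=
  IsLiftedSubconic dev U ∧ (n : ℕ∞) ≤ (conePointsOn U).encard ∧
    HasMaximalSpan (devExtension dev '' conePointsOn U)

/-- Rigid subconics of a simply connected surface: the `5`-stratum. -/
def IsLiftedRigid (dev : X → Plane) (U : Set X) : Prop := IsLiftedInStratum dev 5 U

/-- The cell `𝒮_Z`: the subconics `U` with `∂U ∩ ∂X = Z` such that `Z` meets every connected
component of `∂U`. -/
def openCell (dev : X → Plane) (Z : Set (FlatCompletion X)) : Set (Set X) :=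
  {U | IsLiftedSubconic dev U ∧ conePointsOn U = Z ∧
    ∀ z ∈ completedBoundary U, (Z ∩ connectedComponentIn (completedBoundary U) z).Nonempty}

/-- The closed cell: the subconics `U` with `Z ⊆ ∂U ∩ ∂X`. -/
def closedCell (dev : X → Plane) (Z : Set (FlatCompletion X)) : Set (Set X) :=
  {U | IsLiftedSubconic dev U ∧ Z ⊆ conePointsOn U}

/-- The cells of the cell complex `𝒮_3(X)`: the nonempty `𝒮_Z` with `Z ⊆ ∂X`, `Card Z ≥ 3`. -/
def cells (dev : X → Plane) : Set (Set (Set X)) :=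
  {C | C.Nonempty ∧ ∃ Z ⊆ surfaceFrontier X, 3 ≤ Z.encard ∧ C = openCell dev Z}

end SimplyConnected

/-! ## Subconics of a general translation surface -/

section General

variable {X X' : Type*} [TopologicalSpace X] [TopologicalSpace X'] [ChartedSpace Plane X']

/-- The orbit of a subset of the universal cover under the covering transformations of `p`. -/
def deckOrbit (p : X' → X) (U : Set X') : Set (Set X') :=
  {W | ∃ g : X' ≃ₜ X', (∀ x, p (g x) = p x) ∧ W = g '' U}

/-- Rigid subconics of `X`: orbits, under the covering transformations of the universal covering
`p`, of rigid subconics of the universal cover. -/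
def IsRigidSubconic (p : X' → X) (dev : X' → Plane) (𝒰 : Set (Set X')) : Prop :=
  ∃ U, IsLiftedRigid dev U ∧ 𝒰 = deckOrbit p U

/-- A subconic of `X`, regarded as an immersion into `X`, contains `V ⊆ X` if the inclusion of `V`
factors through it, i.e. if some lift `U` of the subconic contains the image of a continuous
section of `p` over `V`. -/
def SubconicContains (p : X' → X) (𝒰 : Set (Set X')) (V : Set X) : Prop :=
  ∃ U ∈ 𝒰, ∃ s : V → X', Continuous s ∧ (∀ x : V, p (s x) = x) ∧ ∀ x : V, s x ∈ U

end General

end FlatSurface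

open FlatSurface

/-! The transformations of the universal cover over `Y` act on its completion by isometries that
develop to translations. Precompactness of `Y` makes this action cocompact, and the frontier
upstairs is nonempty because completeness descends along coverings. Everything except the final
descent to orbits takes place in this setting, recorded as `FlatModel`. Subconics become flat sets:
open sets that `dev` maps injectively onto a convex region.

Cocompactness and a nonempty frontier bound the radius of flat discs (`exists_radius`). This
excludes half-planes, parabolic regions and the whole plane, so a flat conic region is an ellipse or
a strip. Discreteness leaves only finitely many cone points within bounded developed distance that
can be seen from a fixed disc (`finite_visible`). Since five boundary points determine a bounded
conic (`conic_eq_of_five`), only finitely many rigid subconics of bounded developed size contain a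
given disc.

Suppose infinitely many rigid subconics contain the disc. Their sizes are then unbounded, and along
a subsequence the conics converge to a strip in the plane, which is realised by a flat strip in the
surface. Enlarge it to a maximal strip `S`. A pigeonhole argument with the cocompact action gives
`S` a period `T`, and maximality puts cone points on each border, repeated with that period. A flat
conic through `S` cannot contain these points, so its chord along each border has length at most
`T`. If it is also very long in the middle, concavity forces it to end just beyond the border
(`cap_bound`). Cone points that close to the border lie on the border (`exists_border_isolation`),
where the conic has at most two on either side. A long conic other than `S` thus has at most four
cone points, which contradicts rigidity (`exists_long_limit`, `finite_rigid`).

For closure finiteness, a cell with at least three cone points supplies a nondegenerate triangle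
with two sides inside a subconic `U₀`. Every subconic in the closed cell develops over this
triangle. A separation argument, which uses simple connectedness, shows that it also meets `U₀`
(`meets_of_three`), so all these subconics contain one common disc. In a long conic every cone point
is within `T` of one of two prescribed cone points, one on each border. Hence the possible sets of
cone points are finite in number, and such a set determines its cell. -/

namespace FlatSurface

/-! ### Flat sets and gluing along the developing map -/

section Flat

variable {X : Type*} [TopologicalSpace X] {dev : X → Plane} {U U' : Set X}

/-- An open set which the developing map sends injectively onto a convex set. -/
structure IsFlat (dev : X → Plane) (U : Set X) : Prop where
  isOpen : IsOpen U
  injOn : InjOn dev U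
  convex : Convex ℝ (dev '' U)

theorem IsFlat.isOpen_image (hU : IsFlat dev U) (hl : IsLocalHomeomorph dev) :
    IsOpen (dev '' U) := hl.isOpenMap U hU.isOpen

theorem continuousOn_invFunOn_of_isLocalHomeomorph [Nonempty X] (hl : IsLocalHomeomorph dev)
    (hU : IsOpen U) (hinj : InjOn dev U) : ContinuousOn (Function.invFunOn dev U) (dev '' U) := by
  rintro _ ⟨x, hx, rfl⟩
  have hx' : Function.invFunOn dev U (dev x) = x := hinj.leftInvOn_invFunOn hx
  rw [ContinuousWithinAt, hx', tendsto_def]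
  intro s hs
  have h1 : dev '' (s ∩ U) ∈ 𝓝 (dev x) :=
    hl.isOpenMap.image_mem_nhds (inter_mem hs (hU.mem_nhds hx))
  refine mem_nhdsWithin_of_mem_nhds (mem_of_superset h1 ?_)
  rintro _ ⟨y, hy, rfl⟩
  rw [mem_preimage, hinj.leftInvOn_invFunOn hy.2]
  exact hy.1

/-- The local inverse of `dev` on `U` gives a second lift of the developed curve. Lifts through a
local homeomorphism from a Hausdorff space are unique on connected sets. -/
theorem mapsTo_of_mapsTo_dev [Nonempty X] [T2Space X] (hl : IsLocalHomeomorph dev)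
    (hU : IsOpen U) (hinj : InjOn dev U)
    {A : Type*} [TopologicalSpace A] {s : Set A} (hs : IsPreconnected s) {γ : A → X}
    (hγ : ContinuousOn γ s) {a : A} (ha : a ∈ s) (haU : γ a ∈ U)
    (hm : ∀ t ∈ s, dev (γ t) ∈ dev '' U) : MapsTo γ s U := by
  have hc : ContinuousOn (fun t => Function.invFunOn dev U (dev (γ t))) s :=
    (continuousOn_invFunOn_of_isLocalHomeomorph hl hU hinj).comp
      (hl.continuous.comp_continuousOn hγ) hm
  have h := (T2Space.isSeparatedMap dev).eqOn_of_comp_eqOn hl.isLocallyInjective hs hγ hc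
    (fun t ht => (Function.invFunOn_eq (hm t ht)).symm) ha
    (hinj.leftInvOn_invFunOn haU).symm
  intro t ht
  rw [h ht]
  exact Function.invFunOn_mem (hm t ht)

/-- The straight segment between two points of a flat set. -/
theorem IsFlat.exists_segment [Nonempty X] (hU : IsFlat dev U) (hl : IsLocalHomeomorph dev)
    {x y : X} (hx : x ∈ U) (hy : y ∈ U) :
    ∃ γ : ℝ → X, ContinuousOn γ (Icc 0 1) ∧ γ 0 = x ∧ γ 1 = y ∧ MapsTo γ (Icc 0 1) U ∧
      ∀ t ∈ Icc (0 : ℝ) 1, dev (γ t) = AffineMap.lineMap (dev x) (dev y) t := by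
  have hm : ∀ t ∈ Icc (0 : ℝ) 1, AffineMap.lineMap (dev x) (dev y) t ∈ dev '' U := fun t ht =>
    hU.convex.segment_subset (mem_image_of_mem _ hx) (mem_image_of_mem _ hy)
      (segment_eq_image_lineMap ℝ (dev x) (dev y) ▸ mem_image_of_mem _ ht)
  refine ⟨fun t => Function.invFunOn dev U (AffineMap.lineMap (dev x) (dev y) t), ?_, ?_, ?_, ?_, ?_⟩
  · exact (continuousOn_invFunOn_of_isLocalHomeomorph hl hU.isOpen hU.injOn).comp
      (AffineMap.lineMap_continuous).continuousOn hm
  · simpa using hU.injOn.leftInvOn_invFunOn hx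
  · simpa using hU.injOn.leftInvOn_invFunOn hy
  · exact fun t ht => Function.invFunOn_mem (hm t ht)
  · exact fun t ht => Function.invFunOn_eq (hm t ht)

/-- The segment in `U` from a common point to `x` develops inside the convex set `dev '' U'`, so it
never leaves `U'`. Thus two flat sets that meet anywhere agree over the whole overlap of their
developments. -/
theorem IsFlat.mem_of_meets [Nonempty X] [T2Space X] (hl : IsLocalHomeomorph dev)
    (hU : IsFlat dev U) (hU' : IsFlat dev U') (h : (U ∩ U').Nonempty) {x : X} (hx : x ∈ U)
    (hx' : dev x ∈ dev '' U') : x ∈ U' := by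
  obtain ⟨z, hz, hz'⟩ := h
  obtain ⟨γ, hc, h0, h1, hm, hd⟩ := hU.exists_segment hl hz hx
  have := mapsTo_of_mapsTo_dev hl hU'.isOpen hU'.injOn isPreconnected_Icc hc
    (left_mem_Icc.2 zero_le_one) (h0 ▸ hz') (fun t ht => by
      rw [hd t ht]
      exact hU'.convex.segment_subset (mem_image_of_mem _ hz') hx'
        (segment_eq_image_lineMap ℝ (dev z) (dev x) ▸ mem_image_of_mem _ ht))
  exact h1 ▸ this (right_mem_Icc.2 zero_le_one)

theorem IsFlat.eq_of_meets [Nonempty X] [T2Space X] (hl : IsLocalHomeomorph dev)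
    (hU : IsFlat dev U) (hU' : IsFlat dev U') (h : (U ∩ U').Nonempty) {x x' : X} (hx : x ∈ U)
    (hx' : x' ∈ U') (he : dev x = dev x') : x = x' :=
  hU'.injOn (hU.mem_of_meets hl hU' h hx (he ▸ mem_image_of_mem _ hx')) hx' he

theorem IsFlat.inter_preimage (hU : IsFlat dev U) (hl : IsLocalHomeomorph dev) {C : Set Plane}
    (hC : IsOpen C) (hC' : Convex ℝ C) : IsFlat dev (U ∩ dev ⁻¹' C) := by
  refine ⟨hU.isOpen.inter (hC.preimage hl.continuous), hU.injOn.mono inter_subset_left, ?_⟩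
  rw [image_inter_preimage]
  exact hU.convex.inter hC'

/-- Injectivity is the only issue: points with equal development lie in pieces whose images overlap,
hence in pieces that meet, and meeting flat sets agree over their overlap. -/
theorem isFlat_iUnion [Nonempty X] [T2Space X] (hl : IsLocalHomeomorph dev) {κ : Type*}
    {W : κ → Set X} (hW : ∀ i, IsFlat dev (W i))
    (hm : ∀ i j, (dev '' W i ∩ dev '' W j).Nonempty → (W i ∩ W j).Nonempty)
    (hc : Convex ℝ (dev '' ⋃ i, W i)) : IsFlat dev (⋃ i, W i) := by
  refine ⟨isOpen_iUnion fun i => (hW i).isOpen, ?_, hc⟩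
  intro x hx y hy hxy
  obtain ⟨i, hi⟩ := mem_iUnion.1 hx
  obtain ⟨j, hj⟩ := mem_iUnion.1 hy
  exact (hW i).eq_of_meets hl (hW j)
    (hm i j ⟨dev x, mem_image_of_mem _ hi, hxy ▸ mem_image_of_mem _ hj⟩) hi hj hxy

theorem exists_flat_ball (hl : IsLocalHomeomorph dev) (x : X) :
    ∃ r > 0, ∃ B, IsFlat dev B ∧ x ∈ B ∧ dev '' B = Metric.ball (dev x) r := by
  obtain ⟨e, hx, rfl⟩ := hl x
  obtain ⟨r, hr, hsub⟩ := Metric.isOpen_iff.1 e.open_target (e x) (e.map_source hx)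
  have himg : e '' (e.source ∩ e ⁻¹' Metric.ball (e x) r) = Metric.ball (e x) r := by
    rw [image_inter_preimage, e.image_source_eq_target, inter_eq_right.2 hsub]
  refine ⟨r, hr, e.source ∩ e ⁻¹' Metric.ball (e x) r, ⟨?_, ?_, ?_⟩, ⟨hx, by simpa using hr⟩, himg⟩
  · exact e.isOpen_inter_preimage Metric.isOpen_ball
  · exact e.injOn.mono inter_subset_left
  · rw [himg]; exact convex_ball _ _

/-- A homeomorphism that the developing map turns into a translation. -/
def IsTranslationAut (dev : X → Plane) (g : X ≃ₜ X) : Prop := ∃ τ : Plane, ∀ x, dev (g x) = dev x + τ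

theorem dev_image_translate {g : X ≃ₜ X} {τ : Plane} (hg : ∀ x, dev (g x) = dev x + τ)
    (U : Set X) : dev '' (g '' U) = (fun p => p + τ) '' (dev '' U) := by
  simp only [image_image, hg]

theorem IsFlat.translate (hU : IsFlat dev U) {g : X ≃ₜ X} (hg : IsTranslationAut dev g) :
    IsFlat dev (g '' U) := by
  obtain ⟨τ, hτ⟩ := hg
  refine ⟨g.isOpenMap _ hU.isOpen, ?_, ?_⟩
  · rintro _ ⟨x, hx, rfl⟩ _ ⟨y, hy, rfl⟩ h
    rw [hτ, hτ] at h
    rw [hU.injOn hx hy (add_right_cancel h)]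
  · rw [dev_image_translate hτ]
    simpa using hU.convex.translate_preimage_left (-τ)

theorem IsTranslationAut.symm {g : X ≃ₜ X} (hg : IsTranslationAut dev g) :
    IsTranslationAut dev g.symm := by
  obtain ⟨τ, hτ⟩ := hg
  refine ⟨-τ, fun x => ?_⟩
  have := hτ (g.symm x)
  rw [g.apply_symm_apply] at this
  rw [this]; abel

theorem IsTranslationAut.trans {g h : X ≃ₜ X} (hg : IsTranslationAut dev g)
    (hh : IsTranslationAut dev h) : IsTranslationAut dev (g.trans h) := by
  obtain ⟨τ, hτ⟩ := hg
  obtain ⟨σ, hσ⟩ := hh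
  exact ⟨τ + σ, fun x => by rw [Homeomorph.trans_apply, hσ, hτ, add_assoc]⟩

end Flat

end FlatSurface

namespace FlatSurface

/-! ### Flat distance, developments of curves and translation maps -/

section Curves

variable {X Y : Type*} [TopologicalSpace X] [ChartedSpace Plane X]
  [TopologicalSpace Y] [ChartedSpace Plane Y]

theorem IsTranslationMap.comp {Z : Type*} [TopologicalSpace Z] [ChartedSpace Plane Z]
    {f : X → Y} {g : Y → Z} (hg : IsTranslationMap g) (hf : IsTranslationMap f) :
    IsTranslationMap (g ∘ f) := by
  refine ⟨hg.1.comp hf.1, fun e he e'' he'' x hx hx'' => ?_⟩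
  obtain ⟨v, hv⟩ := hf.2 e he (chartAt Plane (f x)) (chart_mem_atlas _ _) x hx
    (mem_chart_source _ _)
  obtain ⟨w, hw⟩ := hg.2 (chartAt Plane (f x)) (chart_mem_atlas _ _) e'' he'' (f x)
    (mem_chart_source _ _) hx''
  refine ⟨v + w, ?_⟩
  filter_upwards [hv, hf.1.continuousAt.eventually hw] with z h1 h2
  rw [Function.comp_apply, h2, h1, add_assoc]

theorem IsTranslationMap.eventually_eq {dev : X → Plane} (hdev : IsTranslationMap dev)
    {e : OpenPartialHomeomorph X Plane} (he : e ∈ atlas Plane X) {x : X} (hx : x ∈ e.source) :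
    ∃ v : Plane, ∀ᶠ z in 𝓝 x, dev z = e z + v :=
  hdev.2 e he (OpenPartialHomeomorph.refl Plane) (by simp) x hx (by simp)

theorem IsTranslationMap.isLocalHomeomorph {dev : X → Plane} (hdev : IsTranslationMap dev) :
    IsLocalHomeomorph dev := by
  refine IsLocalHomeomorph.mk dev fun x => ?_
  obtain ⟨v, hv⟩ := hdev.eventually_eq (chart_mem_atlas Plane x) (mem_chart_source _ _)
  obtain ⟨s, hs, hso, hxs⟩ := eventually_nhds_iff.1 hv
  refine ⟨((chartAt Plane x).restrOpen s hso).trans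
    (Homeomorph.addRight v).toOpenPartialHomeomorph, by simp [hxs], fun z hz => ?_⟩
  simp only [OpenPartialHomeomorph.trans_source, OpenPartialHomeomorph.restrOpen_source,
    mem_inter_iff] at hz
  rw [hs z hz.1.2]
  simp

theorem IsDevelopedCurve.map {γ : ℝ → X} {c : ℝ → Plane} {a b : ℝ} (h : IsDevelopedCurve γ c a b)
    {f : X → Y} (hf : IsTranslationMap f) : IsDevelopedCurve (f ∘ γ) c a b := by
  refine ⟨h.le, hf.1.comp_continuousOn h.continuousOn, fun t ht e' he' hs => ?_⟩
  obtain ⟨v, hv⟩ := h.development t ht (chartAt Plane (γ t)) (chart_mem_atlas _ _)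
    (mem_chart_source _ _)
  obtain ⟨w, hw⟩ := hf.2 (chartAt Plane (γ t)) (chart_mem_atlas _ _) e' he' (γ t)
    (mem_chart_source _ _) hs
  refine ⟨v - w, ?_⟩
  filter_upwards [hv, (h.continuousOn t ht).eventually hw] with u h1 h2
  rw [Function.comp_apply, h2, h1]; abel

theorem IsDevelopedCurve.of_map {γ : ℝ → X} {c : ℝ → Plane} {a b : ℝ}
    {f : X → Y} (hf : IsTranslationMap f) (hγ : ContinuousOn γ (Icc a b))
    (h : IsDevelopedCurve (f ∘ γ) c a b) : IsDevelopedCurve γ c a b := by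
  refine ⟨h.le, hγ, fun t ht e he hs => ?_⟩
  obtain ⟨v, hv⟩ := h.development t ht (chartAt Plane (f (γ t))) (chart_mem_atlas _ _)
    (mem_chart_source _ _)
  obtain ⟨w, hw⟩ := hf.2 e he (chartAt Plane (f (γ t))) (chart_mem_atlas _ _) (γ t) hs
    (mem_chart_source _ _)
  refine ⟨w + v, ?_⟩
  filter_upwards [hv, (hγ t ht).eventually hw] with u h1 h2
  rw [h1, Function.comp_apply, h2, add_assoc]

theorem isDevelopedCurve_dev {dev : X → Plane} (hdev : IsTranslationMap dev) {γ : ℝ → X}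
    {a b : ℝ} (hab : a ≤ b) (hγ : ContinuousOn γ (Icc a b)) :
    IsDevelopedCurve γ (dev ∘ γ) a b := by
  refine IsDevelopedCurve.of_map hdev hγ ⟨hab, hdev.1.comp_continuousOn hγ, ?_⟩
  intro t _ e he _
  rw [chartedSpaceSelf_atlas] at he
  subst he
  exact ⟨0, Eventually.of_forall fun u => by simp⟩

/-- Two developments of one curve differ by a locally constant function on an interval. Lengths may
therefore always be computed with `dev`. -/
theorem IsDevelopedCurve.exists_eq_add {dev : X → Plane} (hdev : IsTranslationMap dev)
    {γ : ℝ → X} {c : ℝ → Plane} {a b : ℝ} (h : IsDevelopedCurve γ c a b) :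
    ∃ k : Plane, ∀ t ∈ Icc a b, c t = dev (γ t) + k := by
  have h' := h.map hdev
  have hpre : PreconnectedSpace (Icc a b) := isPreconnected_iff_preconnectedSpace.1 isPreconnected_Icc
  have hl : IsLocallyConstant (fun t : Icc a b => c t - dev (γ t)) := by
    rw [IsLocallyConstant.iff_eventually_eq]
    rintro ⟨t, ht⟩
    obtain ⟨v, hv⟩ := h'.development t ht (OpenPartialHomeomorph.refl Plane) (by simp) (by simp)
    have h1 : c t - dev (γ t) = v := by
      rw [hv.self_of_nhdsWithin ht]; simp
    have h2 := (continuous_subtype_val.tendsto (⟨t, ht⟩ : Icc a b))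
    rw [nhds_subtype_eq_comap]
    refine mem_of_superset (preimage_mem_comap (mem_nhdsWithin_iff_eventually.1 hv)) ?_
    rintro ⟨u, hu⟩ hu'
    have h3 := hu' hu
    simp only [mem_ofPred_eq] at h3 ⊢
    rw [h1, h3]
    simp
  refine ⟨c a - dev (γ a), fun t ht => ?_⟩
  have := hl.apply_eq_of_preconnectedSpace ⟨t, ht⟩ ⟨a, left_mem_Icc.2 h.le⟩
  simp only at this
  rw [← this]; abel

theorem eVariationOn_add_const (c : ℝ → Plane) (s : Set ℝ) (k : Plane) :
    eVariationOn (fun t => c t + k) s = eVariationOn c s := by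
  simp only [eVariationOn, edist_add_right]

theorem flatEDist_le_eVariationOn {dev : X → Plane} (hdev : IsTranslationMap dev) {γ : ℝ → X}
    {a b : ℝ} (hab : a ≤ b) (hγ : ContinuousOn γ (Icc a b)) :
    flatEDist (γ a) (γ b) ≤ eVariationOn (dev ∘ γ) (Icc a b) :=
  flatEDist_le (isDevelopedCurve_dev hdev hab hγ) rfl rfl

theorem exists_developedCurve_of_lt {x y : X} {r : ENNReal} (h : flatEDist x y < r) :
    ∃ (γ : ℝ → X) (c : ℝ → Plane) (a b : ℝ), IsDevelopedCurve γ c a b ∧ γ a = x ∧ γ b = y ∧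
      eVariationOn c (Icc a b) < r := by
  simp only [flatEDist, iInf_lt_iff] at h
  obtain ⟨γ, c, a, b, ⟨h, hx, hy⟩, hr⟩ := h
  exact ⟨γ, c, a, b, h, hx, hy, hr⟩

theorem exists_curve_of_lt {dev : X → Plane} (hdev : IsTranslationMap dev) {x y : X} {r : ENNReal}
    (h : flatEDist x y < r) : ∃ (γ : ℝ → X) (a b : ℝ), a ≤ b ∧ ContinuousOn γ (Icc a b) ∧
      γ a = x ∧ γ b = y ∧ eVariationOn (dev ∘ γ) (Icc a b) < r := by
  obtain ⟨γ, c, a, b, h, hx, hy, hr⟩ := exists_developedCurve_of_lt h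
  obtain ⟨k, hk⟩ := h.exists_eq_add hdev
  refine ⟨γ, a, b, h.le, h.continuousOn, hx, hy, ?_⟩
  rwa [eVariationOn.congr (g := fun t => (dev ∘ γ) t + k) hk, eVariationOn_add_const] at hr

theorem edist_dev_le {dev : X → Plane} (hdev : IsTranslationMap dev) (x y : X) :
    edist (dev x) (dev y) ≤ flatEDist x y := by
  refine le_of_forall_gt fun r hr => ?_
  obtain ⟨γ, a, b, hab, hγ, rfl, rfl, hv⟩ := exists_curve_of_lt hdev hr
  exact (eVariationOn.edist_le (dev ∘ γ) (left_mem_Icc.2 hab) (right_mem_Icc.2 hab)).trans_lt hv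

theorem IsTranslationMap.flatEDist_le {f : X → Y} (hf : IsTranslationMap f) (x y : X) :
    flatEDist (f x) (f y) ≤ flatEDist x y := by
  refine le_of_forall_gt fun r hr => ?_
  obtain ⟨γ, c, a, b, h, rfl, rfl, hv⟩ := exists_developedCurve_of_lt hr
  exact (FlatSurface.flatEDist_le (h.map hf) rfl rfl).trans_lt hv

theorem IsTranslationAut.isTranslationMap {dev : X → Plane} (hdev : IsTranslationMap dev)
    {g : X ≃ₜ X} (hg : IsTranslationAut dev g) : IsTranslationMap g := by
  obtain ⟨τ, hτ⟩ := hg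
  refine ⟨g.continuous, fun e he e' he' x hx hx' => ?_⟩
  obtain ⟨v, hv⟩ := hdev.eventually_eq he hx
  obtain ⟨w, hw⟩ := hdev.eventually_eq he' hx'
  refine ⟨v + τ - w, ?_⟩
  filter_upwards [hv, g.continuous.continuousAt.eventually hw] with z h1 h2
  rw [hτ, h1] at h2
  rw [← add_sub_cancel_right (e' (g z)) w, ← h2]; abel

theorem IsTranslationAut.flatEDist_eq {dev : X → Plane} (hdev : IsTranslationMap dev)
    {g : X ≃ₜ X} (hg : IsTranslationAut dev g) (x y : X) :
    flatEDist (g x) (g y) = flatEDist x y := by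
  refine le_antisymm ((hg.isTranslationMap hdev).flatEDist_le x y) ?_
  have := (hg.symm.isTranslationMap hdev).flatEDist_le (g x) (g y)
  rwa [g.symm_apply_apply, g.symm_apply_apply] at this

theorem eVariationOn_lineMap_le (p q : Plane) :
    eVariationOn (fun t : ℝ => AffineMap.lineMap p q t) (Icc 0 1) ≤ edist p q := by
  have h1 : LipschitzWith (nndist p q) (fun t : ℝ => AffineMap.lineMap p q t) :=
    LipschitzWith.of_dist_le_mul fun s t => by
      rw [dist_lineMap_lineMap, mul_comm]; rfl
  have h2 := (h1.lipschitzOnWith (s := univ)).comp_eVariationOn_le (g := (id : ℝ → ℝ))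
    (s := Icc (0 : ℝ) 1) (mapsTo_univ _ _)
  have h3 : eVariationOn (id : ℝ → ℝ) (Icc 0 1) ≤ 1 := by
    have := (monotoneOn_id (s := Icc (0 : ℝ) 1)).eVariationOn_eq
      (left_mem_Icc.2 zero_le_one) (right_mem_Icc.2 zero_le_one)
    rw [inter_self] at this
    rw [this]
    simp
  calc _ ≤ _ := h2
    _ ≤ (nndist p q : ENNReal) * 1 := by gcongr
    _ = edist p q := by rw [mul_one, edist_nndist]

/-- The straight segment stays in `U`. Together with `edist_dev_le` this makes `dev` an isometry on
flat sets. -/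
theorem IsFlat.flatEDist_le [Nonempty X] {dev : X → Plane} (hdev : IsTranslationMap dev)
    {U : Set X} (hU : IsFlat dev U) {x y : X} (hx : x ∈ U) (hy : y ∈ U) :
    flatEDist x y ≤ edist (dev x) (dev y) := by
  obtain ⟨γ, hc, h0, h1, -, hd⟩ := hU.exists_segment hdev.isLocalHomeomorph hx hy
  have := flatEDist_le_eVariationOn hdev zero_le_one hc
  rw [h0, h1] at this
  refine this.trans ?_
  rw [eVariationOn.congr (f := dev ∘ γ) (g := fun t => AffineMap.lineMap (dev x) (dev y) t)
    fun t ht => hd t ht]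
  exact eVariationOn_lineMap_le _ _

/-- Along a curve of length less than `r`, each initial piece is also shorter than `r`, so the curve
stays in the ball. -/
theorem joinedIn_of_flatEDist_lt {dev : X → Plane} (hdev : IsTranslationMap dev) {x y : X}
    {r : ENNReal} (h : flatEDist x y < r) : JoinedIn {z | flatEDist x z < r} x y := by
  obtain ⟨γ, a, b, hab, hγ, rfl, rfl, hv⟩ := exists_curve_of_lt hdev h
  have hm : MapsTo (fun t : ℝ => a + t * (b - a)) (Icc 0 1) (Icc a b) := fun t ht =>
    ⟨by nlinarith [ht.1], by nlinarith [ht.2]⟩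
  refine JoinedIn.ofLine (f := fun t => γ (a + t * (b - a))) ?_ (by simp) (by simp) ?_
  · exact hγ.comp (by fun_prop) hm
  · rintro _ ⟨t, ht, rfl⟩
    have h1 := hm ht
    refine ((flatEDist_le_eVariationOn hdev h1.1 (hγ.mono (Icc_subset_Icc_right h1.2))).trans
      (eVariationOn.mono _ (Icc_subset_Icc_right h1.2))).trans_lt hv

/-- Flat balls have finite diameter, so the set of points at finite distance from `x` is open and
closed. -/
theorem flatEDist_ne_top [PathConnectedSpace X] {dev : X → Plane} (hdev : IsTranslationMap dev)
    (x y : X) : flatEDist x y ≠ ⊤ := by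
  have hne : Nonempty X := ⟨x⟩
  have hloc : ∀ z : X, ∀ᶠ w in 𝓝 z, flatEDist z w ≠ ⊤ := fun z => by
    obtain ⟨r, hr, B, hB, hz, -⟩ := exists_flat_ball hdev.isLocalHomeomorph z
    filter_upwards [hB.isOpen.mem_nhds hz] with w hw
    exact ((hB.flatEDist_le hdev hz hw).trans_lt (edist_lt_top _ _)).ne
  have hcl : IsClopen {w | flatEDist x w ≠ ⊤} := by
    constructor
    · rw [← isOpen_compl_iff, isOpen_iff_eventually]
      intro z hz
      filter_upwards [hloc z] with w hw hw'
      refine hz ?_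
      refine ((flatEDist_triangle x w z).trans_lt (ENNReal.add_lt_top.2 ⟨hw'.lt_top, ?_⟩)).ne
      exact (flatEDist_comm_le z w).trans_lt hw.lt_top
    · rw [isOpen_iff_eventually]
      intro z hz
      filter_upwards [hloc z] with w hw
      exact ((flatEDist_triangle x z w).trans_lt
        (ENNReal.add_lt_top.2 ⟨lt_top_iff_ne_top.2 hz, hw.lt_top⟩)).ne
  have := hcl.eq_univ ⟨x, by simp [flatEDist_self]⟩
  exact (this ▸ mem_univ y : y ∈ {w | flatEDist x w ≠ ⊤})

end Curves

end FlatSurface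

namespace FlatSurface

/-! ### Flat sets in the completion, visible cone points and bounded discs -/

section Model

variable {X : Type*} [TopologicalSpace X] {M : Type*} [MetricSpace M]
  {dev : X → Plane} {ι : X → M} {devM : M → Plane} {U U' : Set X}

theorem exists_flat_ball_subset {dev : X → Plane} (hl : IsLocalHomeomorph dev) {x : X} {U : Set X}
    (hU : U ∈ 𝓝 x) :
    ∃ r > 0, ∃ B ⊆ U, IsFlat dev B ∧ x ∈ B ∧ dev '' B = Metric.ball (dev x) r := by
  obtain ⟨r, hr, B, hB, hx, himg⟩ := exists_flat_ball hl x
  obtain ⟨s, hs, hsub⟩ := Metric.mem_nhds_iff.1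
    (hl.isOpenMap.image_mem_nhds (inter_mem hU (hB.isOpen.mem_nhds hx)))
  have hss : Metric.ball (dev x) s ⊆ dev '' B := hsub.trans (image_mono inter_subset_right)
  refine ⟨s, hs, B ∩ dev ⁻¹' Metric.ball (dev x) s, ?_,
    hB.inter_preimage hl Metric.isOpen_ball (convex_ball _ _), ⟨hx, by simpa using hs⟩, ?_⟩
  · rintro y ⟨hy, hy'⟩
    obtain ⟨z, ⟨hz, hzB⟩, he⟩ := hsub hy'
    rwa [← hB.injOn hzB hy he]
  · rw [image_inter_preimage, inter_eq_right.2 hss]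

/-- A surface with developing map `dev`, embedded by `ι` in its completion `M` for the path metric,
such that the frontier is nonempty and discrete and the group of translation automorphisms acts
with totally bounded quotient. -/
structure FlatModel (dev : X → Plane) (ι : X → M) (devM : M → Plane) : Prop where
  loc : IsLocalHomeomorph dev
  dense : DenseRange ι
  lip : LipschitzWith 1 devM
  dev_eq : ∀ x, devM (ι x) = dev x
  dist_le : ∀ U, IsFlat dev U → ∀ x ∈ U, ∀ y ∈ U, dist (ι x) (ι y) ≤ dist (dev x) (dev y)
  joined : ∀ x y r, dist (ι x) (ι y) < r → JoinedIn {z | dist (ι x) (ι z) < r} x y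
  ext : ∀ g, IsTranslationAut dev g → ∃ G : M ≃ᵢ M, ∀ x, G (ι x) = ι (g x)
  discrete : DiscreteTopology ↥(range ι)ᶜ
  nonempty : (range ι)ᶜ.Nonempty
  cocompact : ∀ ε > 0, ∃ F : Set X, F.Finite ∧
    ∀ x, ∃ f ∈ F, ∃ g, IsTranslationAut dev g ∧ dist (ι x) (ι (g f)) < ε

/-- The cone points on the boundary of `U`. -/
def coneOn (ι : X → M) (U : Set X) : Set M := closure (ι '' U) ∩ (range ι)ᶜ

namespace FlatModel

theorem lip_dist (h : FlatModel dev ι devM) (m m' : M) :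
    dist (devM m) (devM m') ≤ dist m m' := by
  simpa using h.lip.dist_le_mul m m'

theorem continuous_devM (h : FlatModel dev ι devM) : Continuous devM := h.lip.continuous

theorem dist_eq (h : FlatModel dev ι devM) (hU : IsFlat dev U) {x y : X} (hx : x ∈ U)
    (hy : y ∈ U) : dist (ι x) (ι y) = dist (dev x) (dev y) := by
  refine le_antisymm (h.dist_le U hU x hx y hy) ?_
  rw [← h.dev_eq, ← h.dev_eq]
  exact h.lip_dist _ _

variable [T2Space X]

/-- A path that stays within distance `r` of `x` develops into the ball of radius `r`, because
`devM` is 1-Lipschitz. It therefore cannot leave `U`. -/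
theorem mem_of_dist_lt (h : FlatModel dev ι devM) (hU : IsFlat dev U) {x y : X} (hx : x ∈ U)
    {r : ℝ} (hr : Metric.ball (dev x) r ⊆ dev '' U) (hxy : dist (ι x) (ι y) < r) : y ∈ U := by
  have : Nonempty X := ⟨x⟩
  obtain ⟨γ, hγ⟩ := h.joined x y r hxy
  have := mapsTo_of_mapsTo_dev h.loc hU.isOpen hU.injOn (s := univ) isPreconnected_univ
    γ.continuous.continuousOn (mem_univ 0) (by rwa [γ.source]) (fun t _ => hr (by
      rw [Metric.mem_ball, dist_comm, ← h.dev_eq, ← h.dev_eq]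
      exact (h.lip_dist _ _).trans_lt (hγ t)))
  simpa using this (mem_univ 1)

theorem continuous (h : FlatModel dev ι devM) : Continuous ι := by
  rw [continuous_iff_continuousAt]
  intro x
  obtain ⟨r, hr, B, hB, hx, -⟩ := exists_flat_ball h.loc x
  rw [ContinuousAt, tendsto_iff_dist_tendsto_zero]
  have h1 : Tendsto (fun y => dist (dev y) (dev x)) (𝓝 x) (𝓝 0) := by
    rw [← tendsto_iff_dist_tendsto_zero]
    exact h.loc.continuous.tendsto x
  refine h1.congr' ?_
  filter_upwards [hB.isOpen.mem_nhds hx] with y hy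
  exact (h.dist_eq hB hy hx).symm

theorem injective (h : FlatModel dev ι devM) : Function.Injective ι := by
  intro x y hxy
  obtain ⟨r, hr, B, hB, hx, himg⟩ := exists_flat_ball h.loc x
  have hy : y ∈ B := h.mem_of_dist_lt hB hx himg.ge (by rw [hxy, dist_self]; exact hr)
  refine hB.injOn hx hy ?_
  rw [← h.dev_eq, hxy, h.dev_eq]

theorem dist_eq_of_closure (h : FlatModel dev ι devM) (hU : IsFlat dev U) {m m' : M}
    (hm : m ∈ closure (ι '' U)) (hm' : m' ∈ closure (ι '' U)) :
    dist m m' = dist (devM m) (devM m') := by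
  have hcl : IsClosed {q : M × M | dist q.1 q.2 = dist (devM q.1) (devM q.2)} :=
    isClosed_eq (by fun_prop) (Continuous.dist (h.continuous_devM.comp continuous_fst)
      (h.continuous_devM.comp continuous_snd))
  have hsub : (ι '' U) ×ˢ (ι '' U) ⊆ {q : M × M | dist q.1 q.2 = dist (devM q.1) (devM q.2)} := by
    rintro ⟨_, _⟩ ⟨⟨x, hx, rfl⟩, ⟨y, hy, rfl⟩⟩
    change dist (ι x) (ι y) = dist (devM (ι x)) (devM (ι y))
    rw [h.dev_eq, h.dev_eq, h.dist_eq hU hx hy]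
  have := closure_minimal hsub hcl
  rw [closure_prod_eq] at this
  exact this (mk_mem_prod hm hm')

theorem eq_of_closure (h : FlatModel dev ι devM) (hU : IsFlat dev U) {m m' : M}
    (hm : m ∈ closure (ι '' U)) (hm' : m' ∈ closure (ι '' U)) (he : devM m = devM m') : m = m' := by
  rw [← dist_eq_zero, h.dist_eq_of_closure hU hm hm', he, dist_self]

theorem devM_mem_closure (h : FlatModel dev ι devM) {m : M} (hm : m ∈ closure (ι '' U)) :
    devM m ∈ closure (dev '' U) := by
  refine map_mem_closure h.continuous_devM hm ?_
  rintro _ ⟨x, hx, rfl⟩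
  rw [h.dev_eq]
  exact mem_image_of_mem _ hx

theorem mem_image_of_closure (h : FlatModel dev ι devM) (hU : IsFlat dev U) {m : M}
    (hm : m ∈ closure (ι '' U)) (hd : devM m ∈ dev '' U) : m ∈ ι '' U := by
  obtain ⟨x, hx, he⟩ := hd
  have : ι x = m := h.eq_of_closure hU (subset_closure (mem_image_of_mem _ hx)) hm (by rw [h.dev_eq, he])
  exact ⟨x, hx, this⟩

/-- `dev` is isometric on `U`, so a sequence converging to `p` in the plane lifts to a Cauchy
sequence in `M`. -/
theorem exists_mem_closure [CompleteSpace M] (h : FlatModel dev ι devM) (hU : IsFlat dev U)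
    {p : Plane} (hp : p ∈ closure (dev '' U)) : ∃ m ∈ closure (ι '' U), devM m = p := by
  obtain ⟨q, hq, hlim⟩ := mem_closure_iff_seq_limit.1 hp
  choose x hx he using hq
  have hc : CauchySeq (fun n => ι (x n)) := by
    rw [Metric.cauchySeq_iff]
    intro ε hε
    obtain ⟨N, hN⟩ := Metric.cauchySeq_iff.1 hlim.cauchySeq ε hε
    refine ⟨N, fun m hm n hn => ?_⟩
    rw [h.dist_eq hU (hx m) (hx n), he, he]
    exact hN m hm n hn
  obtain ⟨m, hm⟩ := cauchySeq_tendsto_of_complete hc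
  refine ⟨m, mem_closure_of_tendsto hm (Eventually.of_forall fun n => mem_image_of_mem _ (hx n)), ?_⟩
  refine tendsto_nhds_unique ((h.continuous_devM.tendsto m).comp hm) ?_
  simpa only [Function.comp_def, h.dev_eq, he] using hlim

/-- An embedded flat disc fills the ball of the same radius in the completion, so no frontier point
is nearer than `r` to its centre. Both the openness of `ι` and the bound on disc radii rest on this.
-/
theorem mem_closure_of_dist_lt (h : FlatModel dev ι devM) (hU : IsFlat dev U) {x : X}
    (hx : x ∈ U) {r : ℝ} (hr : Metric.ball (dev x) r ⊆ dev '' U) {m : M} (hm : dist (ι x) m < r) :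
    m ∈ ι '' U := by
  have hcl : m ∈ closure (ι '' U) := by
    rw [mem_closure_iff_nhds]
    intro s hs
    obtain ⟨_, hy, y, rfl⟩ := mem_closure_iff_nhds.1 (h.dense m) _
      (inter_mem hs (Metric.ball_mem_nhds m (sub_pos.2 hm)))
    refine ⟨ι y, hy.1, mem_image_of_mem _ (h.mem_of_dist_lt hU hx hr ?_)⟩
    have h1 : dist (ι y) m < r - dist (ι x) m := hy.2
    have h2 := dist_triangle (ι x) m (ι y)
    rw [dist_comm m] at h2
    linarith
  refine h.mem_image_of_closure hU hcl (hr ?_)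
  rw [Metric.mem_ball, dist_comm, ← h.dev_eq]
  exact (h.lip_dist _ _).trans_lt hm

theorem isOpenMap (h : FlatModel dev ι devM) : IsOpenMap ι := by
  intro U hU
  rw [Metric.isOpen_iff]
  rintro _ ⟨x, hx, rfl⟩
  obtain ⟨r, hr, B, hBU, hB, hxB, himg⟩ := exists_flat_ball_subset h.loc (hU.mem_nhds hx)
  refine ⟨r, hr, fun m hm => image_mono hBU (h.mem_closure_of_dist_lt hB hxB himg.ge ?_)⟩
  rwa [dist_comm]

theorem isClosed_frontier (h : FlatModel dev ι devM) : IsClosed (range ι)ᶜ :=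
  h.isOpenMap.isOpen_range.isClosed_compl

theorem frontier_inter (h : FlatModel dev ι devM) (hU : IsOpen U) :
    frontier (ι '' U) ∩ (range ι)ᶜ = coneOn ι U := by
  rw [coneOn, (h.isOpenMap U hU).frontier_eq]
  ext m
  refine ⟨fun hm => ⟨hm.1.1, hm.2⟩, fun hm => ⟨⟨hm.1, fun hm' => hm.2 (image_subset_range _ _ hm')⟩, hm.2⟩⟩

theorem devM_notMem (h : FlatModel dev ι devM) (hU : IsFlat dev U) {m : M}
    (hm : m ∈ coneOn ι U) : devM m ∉ dev '' U := fun hd =>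
  hm.2 (image_subset_range _ _ (h.mem_image_of_closure hU hm.1 hd))

theorem lineMap_mem_of_closure {D : Set Plane} (hD : IsOpen D) (hc : Convex ℝ D) {v p : Plane}
    (hv : v ∈ D) (hp : p ∈ closure D) {t : ℝ} (ht0 : 0 ≤ t) (ht : t < 1) :
    AffineMap.lineMap v p t ∈ D := by
  rcases ht0.eq_or_lt with rfl | ht0
  · simpa using hv
  · have := hc.openSegment_interior_closure_subset_interior (hD.interior_eq.symm ▸ hv) hp
    rw [hD.interior_eq] at this
    exact this (by rw [openSegment_eq_image_lineMap]; exact mem_image_of_mem _ ⟨ht0, ht⟩)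

/-- The half-open segment from `v` to `p` lies in both open convex sets and tends to `p`. -/
theorem closure_inter_of_convex {D D' : Set Plane} (hD : IsOpen D) (hc : Convex ℝ D)
    (hD' : IsOpen D') (hc' : Convex ℝ D') {v p : Plane} (hv : v ∈ D) (hv' : v ∈ D')
    (hp : p ∈ closure D) (hp' : p ∈ closure D') : p ∈ closure (D ∩ D') := by
  have h1 : Tendsto (fun t : ℝ => AffineMap.lineMap v p t) (𝓝[<] 1) (𝓝 p) := by
    have : Continuous (fun t : ℝ => AffineMap.lineMap v p t) := AffineMap.lineMap_continuous
    have h2 := this.tendsto 1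
    rw [AffineMap.lineMap_apply_one] at h2
    exact h2.mono_left nhdsWithin_le_nhds
  refine mem_closure_of_tendsto h1 ?_
  filter_upwards [Ioo_mem_nhdsLT (zero_lt_one' ℝ)] with t ht
  exact ⟨lineMap_mem_of_closure hD hc hv hp ht.1.le ht.2,
    lineMap_mem_of_closure hD' hc' hv' hp' ht.1.le ht.2⟩

/-- Boundary points of two flat sets that meet agree if their developments agree. -/
theorem mem_closure_of_meets [CompleteSpace M] (h : FlatModel dev ι devM) (hU : IsFlat dev U)
    (hU' : IsFlat dev U') (hm : (U ∩ U').Nonempty) {m : M} (hmU : m ∈ closure (ι '' U))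
    (hd : devM m ∈ closure (dev '' U')) : m ∈ closure (ι '' U') := by
  obtain ⟨v, hv, hv'⟩ := hm
  have : Nonempty X := ⟨v⟩
  have himg : dev '' (U ∩ dev ⁻¹' (dev '' U')) = dev '' U ∩ dev '' U' := image_inter_preimage _ _ _
  -- The part of `U` over the overlap is a flat subset of both sets. It has a boundary point over
  -- `devM m`, which must be `m` because `devM` is injective on the closure of `U`.
  have hW := hU.inter_preimage h.loc (hU'.isOpen_image h.loc) hU'.convex
  have hsub : U ∩ dev ⁻¹' (dev '' U') ⊆ U' := fun x hx =>
    hU.mem_of_meets h.loc hU' ⟨v, hv, hv'⟩ hx.1 hx.2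
  have hp := closure_inter_of_convex (hU.isOpen_image h.loc) hU.convex (hU'.isOpen_image h.loc)
    hU'.convex (mem_image_of_mem _ hv) (mem_image_of_mem _ hv') (h.devM_mem_closure hmU) hd
  rw [← himg] at hp
  obtain ⟨m', hm', he⟩ := h.exists_mem_closure hW hp
  have : m' = m := h.eq_of_closure hU (closure_mono (image_mono inter_subset_left) hm') hmU he
  exact this ▸ closure_mono (image_mono hsub) hm'

/-- Cone points of one flat set obstruct every flat set that meets it. -/
theorem devM_notMem_of_meets [CompleteSpace M] (h : FlatModel dev ι devM) (hU : IsFlat dev U)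
    (hU' : IsFlat dev U') (hm : (U ∩ U').Nonempty) {m : M} (hmU : m ∈ coneOn ι U) :
    devM m ∉ dev '' U' := fun hd =>
  h.devM_notMem hU' ⟨h.mem_closure_of_meets hU hU' hm hmU.1 (subset_closure hd), hmU.2⟩ hd

theorem isolated (h : FlatModel dev ι devM) {ζ : M} (hζ : ζ ∈ (range ι)ᶜ) :
    ∀ᶠ m in 𝓝 ζ, m ∈ (range ι)ᶜ → m = ζ := by
  have := h.discrete
  have h1 : ({⟨ζ, hζ⟩} : Set ↥(range ι)ᶜ) ∈ 𝓝 (⟨ζ, hζ⟩ : ↥(range ι)ᶜ) := by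
    rw [nhds_discrete]; exact mem_pure.2 rfl
  rw [nhds_subtype_eq_comap, mem_comap] at h1
  obtain ⟨s, hs, hs'⟩ := h1
  filter_upwards [hs] with m hm hm'
  exact congrArg Subtype.val (hs' (show (⟨m, hm'⟩ : ↥(range ι)ᶜ) ∈ _ from hm))

/-- The frontier is closed and discrete, so a convergent sequence in it is eventually constant. All
finiteness below comes from this. -/
theorem eventually_eq_of_tendsto (h : FlatModel dev ι devM) {ζ : ℕ → M} {m : M}
    (hζ : ∀ n, ζ n ∈ (range ι)ᶜ) (hm : Tendsto ζ atTop (𝓝 m)) :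
    m ∈ (range ι)ᶜ ∧ ∀ᶠ n in atTop, ζ n = m := by
  have hmem := h.isClosed_frontier.mem_of_tendsto hm (Eventually.of_forall hζ)
  refine ⟨hmem, ?_⟩
  filter_upwards [hm.eventually (h.isolated hmem)] with n hn
  exact hn (hζ n)

/-- Only finitely many cone points in a bounded region are visible from a given disc. -/
theorem finite_visible [CompleteSpace M] (h : FlatModel dev ι devM) {V : Set X} {v : X}
    (hvV : v ∈ V) {r : ℝ} (hr : 0 < r) (hV : dev '' V = Metric.ball (dev v) r) (L : ℝ) :
    {ζ : M | (∃ U, IsFlat dev U ∧ V ⊆ U ∧ ζ ∈ coneOn ι U) ∧ dist (devM ζ) (dev v) ≤ L}.Finite := by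
  have : Nonempty X := ⟨v⟩
  by_contra hinf
  have hinf : Set.Infinite _ := hinf
  set ζ := hinf.natEmbedding
  have hζ : ∀ n, (ζ n : M) ∈ _ := fun n => (ζ n).2
  choose hU hL using hζ
  choose U hU hVU hcone using hU
  -- Pass to a subsequence whose developments converge to `z`. The aim is that the cone points
  -- themselves form a Cauchy sequence.
  obtain ⟨z, -, φ, hφ, hz⟩ := (isCompact_closedBall (dev v) L).tendsto_subseq
    (x := fun n => devM (ζ n)) (fun n => hL n)
  have hzL : 0 ≤ dist (dev v) z := dist_nonneg
  have hkey : ∀ ε > 0, ∃ m : M, ∀ᶠ n in atTop, dist (ζ (φ n) : M) m < ε := by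
    intro ε hε
    -- Here `s` is the fraction of the segment from `dev v` to `z` left beyond `w`. It is small
    -- enough that `w` is within `ε / 2` of `z`.
    obtain ⟨s, hs0, hs1, hsε⟩ : ∃ s : ℝ, 0 < s ∧ s < 1 ∧ s * dist (dev v) z < ε / 2 := by
      refine ⟨min (1 / 2) (ε / (4 * (dist (dev v) z + 1))), by positivity, ?_, ?_⟩
      · exact (min_le_left _ _).trans_lt (by norm_num)
      · calc _ ≤ (ε / (4 * (dist (dev v) z + 1))) * (dist (dev v) z + 1) := by
              gcongr
              · exact min_le_right _ _
              · linarith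
          _ = ε / 4 := by field_simp
          _ < ε / 2 := by linarith
    set w : Plane := AffineMap.lineMap (dev v) z (1 - s) with hw
    have hwz : dist w z < ε / 2 := by
      rw [hw, dist_lineMap_right]
      simpa [abs_of_pos hs0] using hsε
    have hev : ∀ᶠ n in atTop, dist (devM (ζ (φ n))) z < min (ε / 2) (s * r) :=
      (tendsto_iff_dist_tendsto_zero.1 hz).eventually_lt_const (by positivity)
    have hmem : ∀ n, dist (devM (ζ (φ n))) z < min (ε / 2) (s * r) → w ∈ dev '' U (φ n) := by
      intro n hn
      have hn' : dist (devM (ζ (φ n))) z < s * r := hn.trans_le (min_le_right _ _)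
      set p := devM (ζ (φ n)) with hp
      -- This is the point from which a segment to `p` passes through `w` at parameter `1 - s`.
      -- Since `p` is within `s * r` of `z`, it lies in the disc of radius `r`, so convexity puts
      -- `w` in the image.
      have hv' : dev v + ((1 - s) / s) • (z - p) ∈ dev '' U (φ n) := by
        refine image_mono (hVU _) ?_
        rw [hV, Metric.mem_ball, dist_eq_norm, add_sub_cancel_left, norm_smul, ← dist_eq_norm,
          dist_comm z, Real.norm_eq_abs, abs_of_nonneg (by have := sub_pos.2 hs1; positivity),
          div_mul_eq_mul_div, div_lt_iff₀ hs0]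
        nlinarith [dist_nonneg (x := p) (y := z)]
      have := lineMap_mem_of_closure ((hU (φ n)).isOpen_image h.loc) (hU (φ n)).convex hv'
        (h.devM_mem_closure (hcone (φ n)).1) (t := 1 - s) (by linarith) (by linarith)
      convert this using 1
      rw [hw, AffineMap.lineMap_apply_module, AffineMap.lineMap_apply_module, ← hp, smul_add,
        smul_smul, sub_sub_cancel, mul_div_cancel₀ _ hs0.ne', smul_sub]
      abel
    obtain ⟨N, hN⟩ := hev.exists
    obtain ⟨y, hy, hyw⟩ := hmem N hN
    refine ⟨ι y, ?_⟩
    filter_upwards [hev] with n hn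
    -- All the sets share `v`, so the point over `w` is the same point of `X` in each of them.
    have hyn : y ∈ U (φ n) := (hU (φ N)).mem_of_meets h.loc (hU (φ n))
      ⟨v, hVU _ hvV, hVU _ hvV⟩ hy (hyw ▸ hmem n hn)
    rw [h.dist_eq_of_closure (hU (φ n)) (hcone (φ n)).1
      (subset_closure (mem_image_of_mem _ hyn)), h.dev_eq, hyw]
    calc _ ≤ dist (devM (ζ (φ n))) z + dist w z := dist_triangle_right _ _ _
      _ < ε := by linarith [min_le_left (ε / 2) (s * r)]
  have hc : CauchySeq (fun n => (ζ (φ n) : M)) := by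
    rw [Metric.cauchySeq_iff]
    intro ε hε
    obtain ⟨m, hm⟩ := hkey (ε / 2) (half_pos hε)
    obtain ⟨N, hN⟩ := eventually_atTop.1 hm
    refine ⟨N, fun a ha b hb => ?_⟩
    linarith [dist_triangle_right (ζ (φ a) : M) (ζ (φ b)) m, hN a ha, hN b hb]
  obtain ⟨m, hm⟩ := cauchySeq_tendsto_of_complete hc
  obtain ⟨-, hev⟩ := h.eventually_eq_of_tendsto (fun n => (hcone (φ n)).2) hm
  obtain ⟨N, hN⟩ := eventually_atTop.1 hev
  have h1 := (hN N le_rfl).trans (hN (N + 1) (Nat.le_succ N)).symm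
  have h2 := hφ.injective (ζ.injective (Subtype.ext h1))
  omega

theorem ext_mem_frontier (h : FlatModel dev ι devM) {g : X ≃ₜ X} {G : M ≃ᵢ M}
    (hG : ∀ x, G (ι x) = ι (g x)) {ζ : M} : G ζ ∈ (range ι)ᶜ ↔ ζ ∈ (range ι)ᶜ := by
  rw [mem_compl_iff, mem_compl_iff, not_iff_not]
  constructor
  · rintro ⟨y, hy⟩
    refine ⟨g.symm y, G.injective ?_⟩
    rw [hG, g.apply_symm_apply, hy]
  · rintro ⟨y, rfl⟩
    exact ⟨g y, (hG y).symm⟩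

/-- Flat discs have bounded radius. -/
theorem exists_radius (h : FlatModel dev ι devM) :
    ∃ R > 0, ∀ U, IsFlat dev U → ∀ c, ¬ Metric.closedBall c R ⊆ dev '' U := by
  obtain ⟨ζ, hζ⟩ := h.nonempty
  obtain ⟨F, hF, hcov⟩ := h.cocompact 1 one_pos
  obtain ⟨C, hC⟩ := (hF.image fun f => dist (ι f) ζ).bddAbove
  -- Every point is within 1 of a translate of a representative, and each representative is within
  -- `C` of `ζ`. A flat disc of radius `max C 0 + 1` would contain a translate of the frontier point
  -- `ζ`.
  refine ⟨max C 0 + 1, by positivity, fun U hU c hsub => ?_⟩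
  obtain ⟨x, hx, rfl⟩ := hsub (Metric.mem_closedBall_self (by positivity))
  obtain ⟨f, hf, g, hg, hlt⟩ := hcov x
  obtain ⟨G, hG⟩ := h.ext g hg
  have h1 : dist (ι x) (G ζ) < max C 0 + 1 := by
    have h2 : dist (ι (g f)) (G ζ) ≤ C := by
      rw [← hG, G.isometry.dist_eq]
      exact hC (mem_image_of_mem _ hf)
    linarith [dist_triangle (ι x) (ι (g f)) (G ζ), le_max_left C 0]
  exact (h.ext_mem_frontier hG).2 hζ (image_subset_range _ _
    (h.mem_closure_of_dist_lt hU hx (Metric.ball_subset_closedBall.trans hsub) h1))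

end FlatModel

end Model

end FlatSurface

namespace FlatSurface

/-! ### Coordinates in an orthonormal frame -/

section Frame

/-- An orthonormal frame of the plane. -/
structure IsFrame (u n : Plane) : Prop where
  uu : inner ℝ u u = 1
  nn : inner ℝ n n = 1
  un : inner ℝ u n = 0

namespace IsFrame

variable {u n : Plane}

theorem nu (h : IsFrame u n) : inner ℝ n u = 0 := by rw [real_inner_comm]; exact h.un

theorem neg (h : IsFrame u n) : IsFrame u (-n) :=
  ⟨h.uu, by simpa using h.nn, by simpa using h.un⟩

theorem expand (h : IsFrame u n) (p : Plane) :
    p = (inner ℝ u p : ℝ) • u + (inner ℝ n p : ℝ) • n := by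
  have h1 := h.uu
  have h2 := h.nn
  have h3 := h.un
  simp only [PiLp.inner_apply, Fin.sum_univ_two, RCLike.inner_apply, conj_trivial] at h1 h2 h3
  -- By Lagrange's identity the determinant is `±1`, and then `n` is `±` the quarter turn of `u`.
  have hd : (u 0 * n 1 - u 1 * n 0) ^ 2 = 1 := by
    have : (u 0 * n 1 - u 1 * n 0) ^ 2 = (u 0 * u 0 + u 1 * u 1) * (n 0 * n 0 + n 1 * n 1) -
      (n 0 * u 0 + n 1 * u 1) ^ 2 := by ring
    rw [this, h1, h2, h3]; norm_num
  set d := u 0 * n 1 - u 1 * n 0 with hdd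
  have e0 : n 0 = -d * u 1 := by
    linear_combination (-n 0) * h1 + u 0 * h3 - u 1 * hdd
  have e1 : n 1 = d * u 0 := by
    linear_combination (-n 1) * h1 + u 1 * h3 + u 0 * hdd
  ext i
  fin_cases i
  · simp only [PiLp.inner_apply, Fin.sum_univ_two, RCLike.inner_apply, conj_trivial,
      PiLp.add_apply, PiLp.smul_apply, smul_eq_mul, Fin.zero_eta, Fin.isValue]
    rw [e0, e1]
    linear_combination (-p 0) * h1 + (-p 0 * u 1 ^ 2 + p 1 * u 0 * u 1) * hd
  · simp only [PiLp.inner_apply, Fin.sum_univ_two, RCLike.inner_apply, conj_trivial,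
      PiLp.add_apply, PiLp.smul_apply, smul_eq_mul, Fin.mk_one, Fin.isValue]
    rw [e0, e1]
    linear_combination (-p 1) * h1 + (p 0 * u 1 * u 0 - p 1 * u 0 ^ 2) * hd

theorem norm_sq (h : IsFrame u n) (x y : ℝ) : ‖x • u + y • n‖ ^ 2 = x ^ 2 + y ^ 2 := by
  rw [← real_inner_self_eq_norm_sq]
  simp only [inner_add_left, inner_add_right, inner_smul_left, inner_smul_right, h.uu, h.nn, h.un,
    h.nu, conj_trivial]
  ring

theorem inner_u (h : IsFrame u n) (x y : ℝ) : inner ℝ u (x • u + y • n) = x := by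
  rw [inner_add_right, inner_smul_right, inner_smul_right, h.uu, h.un]; ring

theorem inner_n (h : IsFrame u n) (x y : ℝ) : inner ℝ n (x • u + y • n) = y := by
  rw [inner_add_right, inner_smul_right, inner_smul_right, h.nn, h.nu]; ring

theorem norm_u (h : IsFrame u n) : ‖u‖ = 1 := by
  have := h.uu
  rw [real_inner_self_eq_norm_sq] at this
  nlinarith [norm_nonneg u]

theorem norm_n (h : IsFrame u n) : ‖n‖ = 1 := by
  have := h.nn
  rw [real_inner_self_eq_norm_sq] at this
  nlinarith [norm_nonneg n]

theorem abs_inner_n_le (h : IsFrame u n) (p q : Plane) :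
    |inner ℝ n p - inner ℝ n q| ≤ dist p q := by
  rw [← inner_sub_right, dist_eq_norm]
  simpa [h.norm_n] using abs_real_inner_le_norm n (p - q)

theorem abs_inner_u_le (h : IsFrame u n) (p q : Plane) :
    |inner ℝ u p - inner ℝ u q| ≤ dist p q := by
  rw [← inner_sub_right, dist_eq_norm]
  simpa [h.norm_u] using abs_real_inner_le_norm u (p - q)

theorem dist_le (h : IsFrame u n) (p q : Plane) :
    dist p q ≤ |inner ℝ u p - inner ℝ u q| + |inner ℝ n p - inner ℝ n q| := by
  rw [dist_eq_norm, h.expand (p - q), inner_sub_right, inner_sub_right]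
  refine (norm_add_le _ _).trans ?_
  rw [norm_smul, norm_smul, h.norm_u, h.norm_n, mul_one, mul_one, Real.norm_eq_abs,
    Real.norm_eq_abs]

theorem ext_iff (h : IsFrame u n) {p q : Plane} :
    p = q ↔ inner ℝ u p = (inner ℝ u q : ℝ) ∧ inner ℝ n p = (inner ℝ n q : ℝ) :=
  ⟨fun e => e ▸ ⟨rfl, rfl⟩, fun e => by rw [h.expand p, h.expand q, e.1, e.2]⟩

theorem exists_of_norm {u : Plane} (hu : ‖u‖ = 1) : ∃ n, IsFrame u n := by
  have h1 : u 0 * u 0 + u 1 * u 1 = 1 := by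
    have := real_inner_self_eq_norm_sq u
    rw [hu, PiLp.inner_apply, Fin.sum_univ_two] at this
    simp only [RCLike.inner_apply, conj_trivial] at this
    linarith
  refine ⟨!₂[-u 1, u 0], ⟨?_, ?_, ?_⟩⟩ <;> rw [PiLp.inner_apply, Fin.sum_univ_two] <;>
    simp only [RCLike.inner_apply, conj_trivial, Matrix.cons_val_zero,
      Matrix.cons_val_one] <;> linarith

end IsFrame

end Frame

/-! ### Maximal strips and their periods -/

section Strip

variable {X : Type*} [TopologicalSpace X] [T2Space X] {M : Type*} [MetricSpace M]
  {dev : X → Plane} {ι : X → M} {devM : M → Plane} {u n : Plane} {v : X}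

/-- A flat set whose development is invariant under translation along `u`. -/
def IsStrip (dev : X → Plane) (u : Plane) (S : Set X) : Prop :=
  IsFlat dev S ∧ ∀ p ∈ dev '' S, ∀ t : ℝ, p + t • u ∈ dev '' S

/-- Invariance along `u` makes membership depend only on the height `inner ℝ n`, and convexity fills
the heights in between. -/
theorem mem_of_height_mem_uIcc (hf : IsFrame u n) {D : Set Plane} (hD : Convex ℝ D)
    (hi : ∀ p ∈ D, ∀ t : ℝ, p + t • u ∈ D) {p q w : Plane} (hp : p ∈ D) (hq : q ∈ D)
    (hw : (inner ℝ n w : ℝ) ∈ uIcc (inner ℝ n p : ℝ) (inner ℝ n q)) : w ∈ D := by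
  rw [← segment_eq_uIcc, segment_eq_image_lineMap] at hw
  obtain ⟨s, hs, he⟩ := hw
  have h1 : AffineMap.lineMap p q s ∈ D :=
    hD.segment_subset hp hq (segment_eq_image_lineMap ℝ p q ▸ mem_image_of_mem _ hs)
  have h2 : w = AffineMap.lineMap p q s + (inner ℝ u (w - AffineMap.lineMap p q s) : ℝ) • u := by
    have h3 : inner ℝ n (w - AffineMap.lineMap p q s) = (0 : ℝ) := by
      rw [inner_sub_right, ← he, AffineMap.lineMap_apply_module, AffineMap.lineMap_apply_module,
        inner_add_right, inner_smul_right, inner_smul_right]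
      simp
    have h4 := hf.expand (w - AffineMap.lineMap p q s)
    rw [h3, zero_smul, add_zero] at h4
    rw [← h4]; abel
  rw [h2]
  exact hi _ h1 _

/-- In terms of heights this is a union of intervals through the common height of `z`. -/
theorem convex_iUnion_of_invariant (hf : IsFrame u n) {κ : Type*} {D : κ → Set Plane}
    (hD : ∀ i, Convex ℝ (D i)) (hi : ∀ i, ∀ p ∈ D i, ∀ t : ℝ, p + t • u ∈ D i) {z : Plane}
    (hz : ∀ i, z ∈ D i) : Convex ℝ (⋃ i, D i) := by
  rw [convex_iff_segment_subset]
  intro p hp q hq w hw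
  obtain ⟨i, hpi⟩ := mem_iUnion.1 hp
  obtain ⟨j, hqj⟩ := mem_iUnion.1 hq
  rw [segment_eq_image_lineMap] at hw
  obtain ⟨s, hs, rfl⟩ := hw
  have h1 : (inner ℝ n (AffineMap.lineMap p q s) : ℝ) ∈ uIcc (inner ℝ n p : ℝ) (inner ℝ n q) := by
    rw [← segment_eq_uIcc, segment_eq_image_lineMap]
    refine ⟨s, hs, ?_⟩
    rw [AffineMap.lineMap_apply_module, AffineMap.lineMap_apply_module, inner_add_right,
      inner_smul_right, inner_smul_right]
    simp
  rcases uIcc_subset_uIcc_union_uIcc (b := (inner ℝ n z : ℝ)) h1 with h2 | h2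
  · exact mem_iUnion.2 ⟨i, mem_of_height_mem_uIcc hf (hD i) (hi i) hpi (hz i) h2⟩
  · exact mem_iUnion.2 ⟨j, mem_of_height_mem_uIcc hf (hD j) (hi j) (hz j) hqj h2⟩

theorem isStrip_iUnion (hl : IsLocalHomeomorph dev) (hf : IsFrame u n) {κ : Type*} [Nonempty κ]
    {W : κ → Set X} (hW : ∀ i, IsStrip dev u (W i)) (hv : ∀ i, v ∈ W i) :
    IsStrip dev u (⋃ i, W i) := by
  have : Nonempty X := ⟨v⟩
  refine ⟨isFlat_iUnion hl (fun i => (hW i).1) (fun i j _ => ⟨v, hv i, hv j⟩) ?_, ?_⟩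
  · rw [image_iUnion]
    exact convex_iUnion_of_invariant hf (fun i => (hW i).1.convex) (fun i => (hW i).2)
      (fun i => mem_image_of_mem _ (hv i))
  · rw [image_iUnion]
    intro p hp t
    obtain ⟨i, hi⟩ := mem_iUnion.1 hp
    exact mem_iUnion.2 ⟨i, (hW i).2 p hi t⟩

theorem IsStrip.translate {S : Set X} (hS : IsStrip dev u S) {g : X ≃ₜ X}
    (hg : IsTranslationAut dev g) : IsStrip dev u (g '' S) := by
  refine ⟨hS.1.translate hg, ?_⟩
  obtain ⟨τ, hτ⟩ := hg
  rw [dev_image_translate hτ]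
  rintro _ ⟨p, hp, rfl⟩ t
  exact ⟨p + t • u, hS.2 p hp t, by simp only []; abel⟩

/-- A strip that is maximal among those containing `v`. -/
structure IsMaxStrip (dev : X → Plane) (u : Plane) (v : X) (S : Set X) : Prop where
  strip : IsStrip dev u S
  mem : v ∈ S
  max : ∀ S', IsStrip dev u S' → v ∈ S' → S' ⊆ S

theorem exists_isMaxStrip (hl : IsLocalHomeomorph dev) (hf : IsFrame u n) {S₀ : Set X}
    (hS₀ : IsStrip dev u S₀) (hv : v ∈ S₀) : ∃ S, IsMaxStrip dev u v S := by
  have : Nonempty {S : Set X // IsStrip dev u S ∧ v ∈ S} := ⟨⟨S₀, hS₀, hv⟩⟩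
  refine ⟨⋃ i : {S : Set X // IsStrip dev u S ∧ v ∈ S}, i.1,
    isStrip_iUnion hl hf (fun i => i.2.1) (fun i => i.2.2), ?_, ?_⟩
  · exact mem_iUnion.2 ⟨⟨S₀, hS₀, hv⟩, hv⟩
  · intro S' hS' hv'
    exact subset_iUnion_of_subset ⟨S', hS', hv'⟩ subset_rfl

/-- The union of two strips that meet is a strip, so maximality among the strips through `v` already
covers every strip that meets `S`. -/
theorem IsMaxStrip.max_of_meets (hl : IsLocalHomeomorph dev) (hf : IsFrame u n) {S S' : Set X}
    (hS : IsMaxStrip dev u v S) (hS' : IsStrip dev u S') (hm : (S ∩ S').Nonempty) : S' ⊆ S := by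
  obtain ⟨z, hz, hz'⟩ := hm
  have h1 : IsStrip dev u (⋃ b : Bool, cond b S S') :=
    isStrip_iUnion (v := z) hl hf (by rintro (_ | _); exacts [hS', hS.strip])
      (by rintro (_ | _); exacts [hz', hz])
  have h2 := hS.max _ h1 (mem_iUnion.2 ⟨true, hS.mem⟩)
  exact fun x hx => h2 (mem_iUnion.2 ⟨false, hx⟩)

namespace FlatModel

theorem dist_translate (h : FlatModel dev ι devM) {g : X ≃ₜ X} (hg : IsTranslationAut dev g)
    (x y : X) : dist (ι (g x)) (ι (g y)) = dist (ι x) (ι y) := by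
  obtain ⟨G, hG⟩ := h.ext g hg
  rw [← hG, ← hG, G.isometry.dist_eq]

theorem devM_ext (h : FlatModel dev ι devM) {g : X ≃ₜ X} {τ : Plane}
    (hg : ∀ x, dev (g x) = dev x + τ) {G : M ≃ᵢ M} (hG : ∀ x, G (ι x) = ι (g x)) (m : M) :
    devM (G m) = devM m + τ := by
  have : (fun m => devM (G m)) = fun m => devM m + τ := by
    refine h.dense.equalizer (h.continuous_devM.comp G.continuous)
      (h.continuous_devM.add continuous_const) ?_
    funext x
    simp only [Function.comp_apply, hG, h.dev_eq, hg]
  exact congrFun this m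

theorem ext_mem_closure {g : X ≃ₜ X} {G : M ≃ᵢ M} (hG : ∀ x, G (ι x) = ι (g x)) {S S' : Set X}
    (hS : g '' S = S') {m : M} : G m ∈ closure (ι '' S') ↔ m ∈ closure (ι '' S) := by
  have : ι '' S' = G '' (ι '' S) := by
    rw [← hS, image_image, image_image]
    simp only [hG]
  have hc : closure (G '' (ι '' S)) = G '' closure (ι '' S) :=
    (G.toHomeomorph.image_closure (ι '' S)).symm
  rw [this, hc]
  exact G.injective.mem_set_image

theorem ext_mem_coneOn (h : FlatModel dev ι devM) {g : X ≃ₜ X} {G : M ≃ᵢ M}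
    (hG : ∀ x, G (ι x) = ι (g x)) {S S' : Set X}
    (hS : g '' S = S') {m : M} : G m ∈ coneOn ι S' ↔ m ∈ coneOn ι S :=
  and_congr (ext_mem_closure hG hS) (h.ext_mem_frontier hG)

/-- The heights of a strip form an open interval. It is bounded because a strip of height more than
`2 * R` contains a closed disc of radius `R`. -/
theorem exists_heights (h : FlatModel dev ι devM) (hf : IsFrame u n) {S : Set X}
    (hS : IsStrip dev u S) (hv : v ∈ S) :
    ∃ a b : ℝ, a < inner ℝ n (dev v) ∧ inner ℝ n (dev v) < b ∧
      dev '' S = {p | a < inner ℝ n p ∧ inner ℝ n p < b} := by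
  obtain ⟨R, hR, hRmax⟩ := h.exists_radius
  set J : Set ℝ := (fun p : Plane => (inner ℝ n p : ℝ)) '' (dev '' S) with hJ
  have hmem : ∀ p, p ∈ dev '' S ↔ (inner ℝ n p : ℝ) ∈ J := by
    refine fun p => ⟨fun hp => mem_image_of_mem _ hp, ?_⟩
    rintro ⟨q, hq, he⟩
    exact mem_of_height_mem_uIcc hf hS.1.convex hS.2 hq hq (by
      simp only at he
      rw [he]; exact left_mem_uIcc)
  have hJc : J.OrdConnected := by
    refine Convex.ordConnected ?_
    exact hS.1.convex.is_linear_image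
      (⟨fun x y => inner_add_right _ _ _, fun c x => by
        simp [inner_smul_right]⟩ : IsLinearMap ℝ fun p : Plane => (inner ℝ n p : ℝ))
  have hJo : IsOpen J := by
    have h1 : J = (fun t : ℝ => (0 : ℝ) • u + t • n) ⁻¹' (dev '' S) := by
      ext t
      rw [mem_preimage, hmem, hf.inner_n]
    rw [h1]
    exact (hS.1.isOpen_image h.loc).preimage (by fun_prop)
  have hJw : ∀ s ∈ J, ∀ t ∈ J, t ≤ s + 2 * R := by
    intro s hs t ht
    by_contra! hlt
    refine hRmax S hS.1 ((0 : ℝ) • u + (s + R) • n) fun p hp => ?_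
    rw [hmem]
    have h1 := (hf.abs_inner_n_le p _).trans hp
    rw [hf.inner_n, abs_le] at h1
    exact hJc.out hs ht ⟨by linarith, by linarith⟩
  have hvJ : (inner ℝ n (dev v) : ℝ) ∈ J := (hmem _).1 (mem_image_of_mem _ hv)
  have hbb : BddBelow J := ⟨inner ℝ n (dev v) - 2 * R, fun s hs => by linarith [hJw s hs _ hvJ]⟩
  have hba : BddAbove J := ⟨inner ℝ n (dev v) + 2 * R, fun s hs => by linarith [hJw _ hvJ s hs]⟩
  have hIoo : J = Ioo (sInf J) (sSup J) := by
    refine Subset.antisymm (fun s hs => ?_) ?_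
    · obtain ⟨ε, hε, hsub⟩ := Metric.isOpen_iff.1 hJo s hs
      have h1 : s - ε / 2 ∈ J := hsub (by
        rw [Metric.mem_ball, Real.dist_eq, sub_sub_cancel_left, abs_neg, abs_of_pos] <;> linarith)
      have h2 : s + ε / 2 ∈ J := hsub (by
        rw [Metric.mem_ball, Real.dist_eq, add_sub_cancel_left, abs_of_pos] <;> linarith)
      exact ⟨by linarith [csInf_le hbb h1], by linarith [le_csSup hba h2]⟩
    · exact IsConnected.Ioo_csInf_csSup_subset ⟨⟨_, hvJ⟩, hJc.isPreconnected⟩ hbb hba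
  refine ⟨sInf J, sSup J, (hIoo ▸ hvJ : _ ∈ Ioo _ _).1, (hIoo ▸ hvJ : _ ∈ Ioo _ _).2, ?_⟩
  ext p
  rw [hmem]
  exact Set.ext_iff.1 hIoo _

/-- A maximal strip is invariant under a nontrivial translation along itself. -/
theorem exists_period (h : FlatModel dev ι devM) (hf : IsFrame u n) {S : Set X}
    (hS : IsMaxStrip dev u v S) {a b : ℝ}
    (hD : dev '' S = {p | a < inner ℝ n p ∧ inner ℝ n p < b}) :
    ∃ T ≠ (0 : ℝ), ∃ g : X ≃ₜ X, (∀ x, dev (g x) = dev x + T • u) ∧ g '' S = S := by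
  have hvD : dev v ∈ dev '' S := mem_image_of_mem _ hS.mem
  have hvD' := hvD
  rw [hD] at hvD'
  -- The ball of radius `2 * ε` about `dev v` has to fit into the strip, and `2 * ε ≤ 1 / 2` has to
  -- be less than the spacing of the points chosen below.
  obtain ⟨ε, hε, hε4, hεa, hεb⟩ : ∃ ε > 0, ε ≤ 1 / 4 ∧ a + 2 * ε ≤ inner ℝ n (dev v) ∧
      inner ℝ n (dev v) + 2 * ε ≤ b := by
    have h1 := hvD'.1
    have h2 := hvD'.2
    refine ⟨min (1 / 4) (min ((inner ℝ n (dev v) - a) / 2) ((b - inner ℝ n (dev v)) / 2)),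
      ?_, min_le_left _ _, ?_, ?_⟩
    · refine lt_min (by norm_num) (lt_min (by linarith) (by linarith))
    · linarith [(min_le_right (1 / 4) (min ((inner ℝ n (dev v) - a) / 2)
        ((b - inner ℝ n (dev v)) / 2))).trans (min_le_left _ _)]
    · linarith [(min_le_right (1 / 4) (min ((inner ℝ n (dev v) - a) / 2)
        ((b - inner ℝ n (dev v)) / 2))).trans (min_le_right _ _)]
  obtain ⟨F, hF, hcov⟩ := h.cocompact ε hε
  -- The points `w k` lie along the strip at unit spacing. Two of them are close to translates of
  -- the same representative, and the quotient of the two translations nearly takes one to the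
  -- other.
  choose w hwS hw using fun k : ℕ => hS.strip.2 _ hvD (k : ℝ)
  choose f hfF g hg hlt using fun k => hcov (w k)
  have := hF.to_subtype
  obtain ⟨k, l, hkl, hfe⟩ := Finite.exists_ne_map_eq_of_infinite (fun k : ℕ => (⟨f k, hfF k⟩ : F))
  have hfe : f k = f l := congrArg Subtype.val hfe
  set g₀ := (g k).symm.trans (g l) with hg₀
  have hg₀a : IsTranslationAut dev g₀ := (hg k).symm.trans (hg l)
  have hclose : dist (ι (w l)) (ι (g₀ (w k))) < 2 * ε := by
    have h1 : dist (ι (g₀ (w k))) (ι (g l (f l))) < ε := by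
      have h2 := h.dist_translate hg₀a (w k) (g k (f k))
      have h3 : g₀ (g k (f k)) = g l (f l) := by simp [hg₀, hfe]
      rw [h3] at h2
      rw [h2]
      exact hlt k
    linarith [dist_triangle_right (ι (w l)) (ι (g₀ (w k))) (ι (g l (f l))), hlt l]
  have hwn : ∀ j, (inner ℝ n (dev (w j)) : ℝ) = inner ℝ n (dev v) := fun j => by
    rw [hw, inner_add_right, inner_smul_right, hf.nu, mul_zero, add_zero]
  have hmemS : g₀ (w k) ∈ S := by
    refine h.mem_of_dist_lt hS.strip.1 (hwS l) (r := 2 * ε) ?_ hclose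
    rw [hD]
    intro p hp
    have h1 := (hf.abs_inner_n_le p _).trans_lt hp
    rw [hwn, abs_lt] at h1
    exact ⟨by linarith, by linarith⟩
  have hsub : g₀ '' S ⊆ S := hS.max_of_meets h.loc hf (hS.strip.translate hg₀a)
    ⟨_, hmemS, mem_image_of_mem _ (hwS k)⟩
  obtain ⟨τ, hτ⟩ := hg₀a
  have hab : a < b := hvD'.1.trans hvD'.2
  -- The translation maps the bounded interval of heights into itself, and iterating a nonzero
  -- vertical shift would leave it.
  have hto : (inner ℝ n τ : ℝ) = 0 := by
    have key : ∀ y, a < y → y < b → a < y + inner ℝ n τ ∧ y + inner ℝ n τ < b := by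
      intro y hy1 hy2
      have h1 : (0 : ℝ) • u + y • n ∈ dev '' S := by
        rw [hD]; exact ⟨by rwa [hf.inner_n], by rwa [hf.inner_n]⟩
      obtain ⟨x, hx, he⟩ := h1
      have h2 : dev (g₀ x) ∈ dev '' S := mem_image_of_mem _ (hsub (mem_image_of_mem _ hx))
      rw [hτ, he, hD] at h2
      have h3 := h2.1
      have h4 := h2.2
      rw [inner_add_right, hf.inner_n] at h3 h4
      exact ⟨h3, h4⟩
    by_contra hne
    rcases lt_or_gt_of_ne hne with hlt | hgt
    · have h5 : ∀ m : ℕ, a < (a + b) / 2 + m * inner ℝ n τ := by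
        intro m
        induction m with
        | zero => simp; linarith
        | succ m ih =>
          have := (key _ ih (by nlinarith [(Nat.cast_nonneg m : (0 : ℝ) ≤ m)])).1
          push_cast
          linarith
      obtain ⟨m, hm⟩ := exists_nat_gt (((b - a) / 2) / (-inner ℝ n τ))
      rw [div_lt_iff₀ (by linarith)] at hm
      linarith [h5 m]
    · have h5 : ∀ m : ℕ, (a + b) / 2 + m * inner ℝ n τ < b := by
        intro m
        induction m with
        | zero => simp; linarith
        | succ m ih =>
          have := (key _ (by nlinarith [(Nat.cast_nonneg m : (0 : ℝ) ≤ m)]) ih).2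
          push_cast
          linarith
      obtain ⟨m, hm⟩ := exists_nat_gt (((b - a) / 2) / (inner ℝ n τ))
      rw [div_lt_iff₀ hgt] at hm
      linarith [h5 m]
  have hτu : τ = (inner ℝ u τ : ℝ) • u := by
    have := hf.expand τ
    rwa [hto, zero_smul, add_zero] at this
  refine ⟨inner ℝ u τ, ?_, g₀, fun x => by rw [hτ, ← hτu], ?_⟩
  -- Without displacement, `w k` and `w l` would be less than `2 * ε ≤ 1 / 2` apart, whereas they
  -- are at least 1 apart.
  · intro h0
    rw [h0, zero_smul] at hτu
    have h1 := (h.lip_dist _ _).trans_lt hclose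
    rw [h.dev_eq, h.dev_eq, hτ, hτu, add_zero, hw, hw] at h1
    have h2 := (hf.abs_inner_u_le _ _).trans_lt h1
    simp only [inner_add_right, inner_smul_right, hf.uu, mul_one, add_sub_add_left_eq_sub] at h2
    have h3 : (1 : ℝ) ≤ |(l : ℝ) - k| := by
      have : (1 : ℤ) ≤ |(l : ℤ) - k| := Int.one_le_abs (by omega)
      exact_mod_cast this
    linarith
  · refine Subset.antisymm hsub fun x hx => ?_
    have h1 : dev x ∈ dev '' (g₀ '' S) := by
      have h2 := hS.strip.2 _ (mem_image_of_mem dev hx) (-(inner ℝ u τ : ℝ))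
      rw [dev_image_translate hτ]
      refine ⟨_, h2, ?_⟩
      simp only []
      rw [neg_smul, ← hτu]; abel
    obtain ⟨y, hy, he⟩ := h1
    rwa [← hS.strip.1.injOn (hsub hy) hx he]

end FlatModel

end Strip

end FlatSurface

namespace FlatSurface

/-! ### Cone points on and near the border of a periodic strip -/

section Border

variable {X : Type*} [TopologicalSpace X] [T2Space X] {M : Type*} [MetricSpace M]
  {dev : X → Plane} {ι : X → M} {devM : M → Plane} {u n : Plane} {v : X} {S : Set X} {a b T : ℝ}

theorem exists_iterate_translate {g : X ≃ₜ X} {τ : Plane} (hg : ∀ x, dev (g x) = dev x + τ)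
    (hS : g '' S = S) (k : ℕ) :
    ∃ g' : X ≃ₜ X, (∀ x, dev (g' x) = dev x + (k : ℝ) • τ) ∧ g' '' S = S := by
  induction k with
  | zero => exact ⟨Homeomorph.refl X, by simp, by simp⟩
  | succ k ih =>
    obtain ⟨g', h1, h2⟩ := ih
    refine ⟨g'.trans g, fun x => ?_, ?_⟩
    · rw [Homeomorph.trans_apply, hg, h1, Nat.cast_succ, add_smul, one_smul, add_assoc]
    · have : (g'.trans g : X → X) = g ∘ g' := rfl
      rw [this, image_comp, h2, hS]

theorem exists_zpow_translate {g : X ≃ₜ X} {τ : Plane} (hg : ∀ x, dev (g x) = dev x + τ)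
    (hS : g '' S = S) (k : ℤ) :
    ∃ g' : X ≃ₜ X, (∀ x, dev (g' x) = dev x + (k : ℝ) • τ) ∧ g' '' S = S := by
  obtain ⟨m, rfl | rfl⟩ := k.eq_nat_or_neg
  · obtain ⟨g', h1, h2⟩ := exists_iterate_translate hg hS m
    exact ⟨g', by simpa using h1, h2⟩
  · obtain ⟨g', h1, h2⟩ := exists_iterate_translate hg hS m
    refine ⟨g'.symm, fun x => ?_, ?_⟩
    · have := h1 (g'.symm x)
      rw [g'.apply_symm_apply] at this
      rw [this]
      push_cast
      rw [neg_smul]; abel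
    · conv_lhs => rw [← h2]
      rw [← image_comp]
      simp

/-- A maximal strip with its heights and a period. -/
structure IsPeriodicStrip (dev : X → Plane) (u n : Plane) (v : X) (S : Set X) (a b T : ℝ) :
    Prop where
  frame : IsFrame u n
  maxStrip : IsMaxStrip dev u v S
  lt : a < b
  image_eq : dev '' S = {p | a < inner ℝ n p ∧ inner ℝ n p < b}
  pos : 0 < T
  period : ∀ k : ℤ, ∃ g : X ≃ₜ X, (∀ x, dev (g x) = dev x + (k * T) • u) ∧ g '' S = S

theorem IsPeriodicStrip.neg (hS : IsPeriodicStrip dev u n v S a b T) :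
    IsPeriodicStrip dev u (-n) v S (-b) (-a) T := by
  refine ⟨hS.frame.neg, hS.maxStrip, neg_lt_neg hS.lt, ?_, hS.pos, hS.period⟩
  rw [hS.image_eq]
  ext p
  simp only [mem_ofPred_eq, inner_neg_left, neg_lt_neg_iff]
  exact and_comm

theorem IsPeriodicStrip.closure_eq (hS : IsPeriodicStrip dev u n v S a b T) {p : Plane} :
    p ∈ closure (dev '' S) ↔ a ≤ inner ℝ n p ∧ inner ℝ n p ≤ b := by
  rw [hS.image_eq]
  constructor
  · intro hp
    have hcl : IsClosed ((fun p : Plane => (inner ℝ n p : ℝ)) ⁻¹' Icc a b) :=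
      isClosed_Icc.preimage (by fun_prop)
    have hsub : {p : Plane | a < inner ℝ n p ∧ inner ℝ n p < b} ⊆
        (fun p : Plane => (inner ℝ n p : ℝ)) ⁻¹' Icc a b := fun q hq => ⟨hq.1.le, hq.2.le⟩
    exact closure_minimal hsub hcl hp
  · intro hp
    have hcont : Continuous fun y : ℝ => (inner ℝ u p : ℝ) • u + y • n := by fun_prop
    have h1 : (inner ℝ n p : ℝ) ∈ closure (Ioo a b) := by
      rw [closure_Ioo hS.lt.ne]; exact hp
    have h2 := map_mem_closure (t := {p | a < inner ℝ n p ∧ inner ℝ n p < b}) hcont h1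
      (fun y hy => by
        change a < inner ℝ n _ ∧ inner ℝ n _ < b
        rw [hS.frame.inner_n]; exact hy)
    rwa [← hS.frame.expand p] at h2

theorem IsPeriodicStrip.exists_reduce (hS : IsPeriodicStrip dev u n v S a b T) (s : ℝ) :
    ∃ k : ℤ, s + k * T ∈ Icc 0 T := by
  refine ⟨-⌊s / T⌋, ?_, ?_⟩
  · have := Int.sub_floor_div_mul_nonneg s hS.pos
    push_cast; linarith
  · have := Int.sub_floor_div_mul_lt s hS.pos
    push_cast; linarith

namespace FlatModel

theorem exists_isPeriodicStrip (h : FlatModel dev ι devM) (hf : IsFrame u n) {S₀ : Set X}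
    (hS₀ : IsStrip dev u S₀) (hv : v ∈ S₀) :
    ∃ S a b T, IsPeriodicStrip dev u n v S a b T := by
  obtain ⟨S, hS⟩ := exists_isMaxStrip h.loc hf hS₀ hv
  obtain ⟨a, b, ha, hb, hD⟩ := h.exists_heights hf hS.strip hS.mem
  obtain ⟨T, hT, g, hg, hgS⟩ := h.exists_period hf hS hD
  refine ⟨S, a, b, |T|, hf, hS, ha.trans hb, hD, abs_pos.2 hT, fun k => ?_⟩
  rcases abs_choice T with hT' | hT'
  · obtain ⟨g', h1, h2⟩ := exists_zpow_translate hg hgS k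
    exact ⟨g', fun x => by rw [h1, hT', smul_smul], h2⟩
  · obtain ⟨g', h1, h2⟩ := exists_zpow_translate hg hgS (-k)
    exact ⟨g', fun x => by rw [h1, hT', smul_smul]; push_cast; ring_nf, h2⟩

/-- There is an embedded flat disc of radius `r` about `x`. -/
def HasFlatBall (dev : X → Plane) (x : X) (r : ℝ) : Prop :=
  ∃ B, IsFlat dev B ∧ x ∈ B ∧ dev '' B = Metric.ball (dev x) r

theorem _root_.FlatSurface.IsFlat.hasFlatBall {B : Set X} (hB : IsFlat dev B)
    (hl : IsLocalHomeomorph dev) {x : X} (hx : x ∈ B) {r : ℝ} (hr : 0 < r)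
    (hsub : Metric.ball (dev x) r ⊆ dev '' B) : HasFlatBall dev x r := by
  refine ⟨B ∩ dev ⁻¹' Metric.ball (dev x) r,
    hB.inter_preimage hl Metric.isOpen_ball (convex_ball _ _), ⟨hx, by simpa using hr⟩, ?_⟩
  rw [image_inter_preimage, inter_eq_right.2 hsub]

variable [CompleteSpace M]

/-- The upper border of a maximal strip contains a cone point. -/
theorem exists_coneOn_border (h : FlatModel dev ι devM)
    (hS : IsPeriodicStrip dev u n v S a b T) :
    ∃ ζ ∈ coneOn ι S, inner ℝ n (devM ζ) = b := by
  by_contra! hno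
  have : Nonempty X := ⟨v⟩
  have hf := hS.frame
  have hab := hS.lt
  have hflat := hS.maxStrip.strip.1
  -- If there is no cone point at height `b`, the whole upper border lies in the surface. Flat balls
  -- of uniform radius around its points will then thicken the strip.
  have hborder : ∀ s : ℝ, ∃ x : X, ι x ∈ closure (ι '' S) ∧ dev x = s • u + b • n := by
    intro s
    obtain ⟨m, hm, he⟩ := h.exists_mem_closure hflat (p := s • u + b • n)
      (hS.closure_eq.2 (by rw [hf.inner_n]; exact ⟨hab.le, le_rfl⟩))
    have : m ∈ range ι := by
      by_contra hm'
      exact hno m ⟨hm, hm'⟩ (by rw [he, hf.inner_n])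
    obtain ⟨x, rfl⟩ := this
    exact ⟨x, hm, by rw [← h.dev_eq, he]⟩
  choose x hxS hx using hborder
  have hdist : ∀ s t, dist (ι (x s)) (ι (x t)) = |s - t| := by
    intro s t
    rw [h.dist_eq_of_closure hflat (hxS s) (hxS t), h.dev_eq, h.dev_eq, hx, hx, dist_add_right,
      dist_eq_norm, ← sub_smul, norm_smul, hf.norm_u, mul_one, Real.norm_eq_abs]
  -- Compactness of one period: where border points accumulate, a flat ball about the limit contains
  -- balls of half its radius about the nearby points.
  have hball : ∃ r > 0, ∀ s ∈ Icc 0 T, HasFlatBall dev (x s) r := by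
    by_contra! hbad
    choose s hs hbad using fun k : ℕ => hbad (1 / ((k : ℝ) + 1)) (by positivity)
    obtain ⟨s₀, -, φ, hφ, hlim⟩ := isCompact_Icc.tendsto_subseq hs
    obtain ⟨r, hr, B, hB, hxB, himg⟩ := exists_flat_ball h.loc (x s₀)
    have h1 : ∀ᶠ k in atTop, dist (s (φ k)) s₀ < r / 2 :=
      (tendsto_iff_dist_tendsto_zero.1 hlim).eventually_lt_const (by positivity)
    have h2 : ∀ᶠ k in atTop, (1 : ℝ) / ((φ k : ℝ) + 1) < r / 2 :=
      ((tendsto_one_div_add_atTop_nhds_zero_nat).comp hφ.tendsto_atTop).eventually_lt_const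
        (by positivity)
    obtain ⟨k, hk1, hk2⟩ := (h1.and h2).exists
    have hk1' : dist (ι (x s₀)) (ι (x (s (φ k)))) < r / 2 := by
      rw [hdist, abs_sub_comm]; exact hk1
    have hmem : x (s (φ k)) ∈ B := h.mem_of_dist_lt hB hxB himg.ge (by linarith)
    refine hbad (φ k) (hB.hasFlatBall h.loc hmem (by positivity) ?_)
    rw [himg]
    refine Metric.ball_subset_ball' ?_
    have h3 : dist (dev (x (s (φ k)))) (dev (x s₀)) < r / 2 := by
      rw [← h.dev_eq, ← h.dev_eq, dist_comm]
      exact (h.lip_dist _ _).trans_lt hk1'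
    linarith
  obtain ⟨r, hr, hball⟩ := hball
  have hball' : ∀ s, HasFlatBall dev (x s) r := by
    intro s
    obtain ⟨k, hk⟩ := hS.exists_reduce s
    obtain ⟨g, hg, hgS⟩ := hS.period k
    -- The period moves the border point to one in `[0, T]`, and the flat ball found there is moved
    -- back.
    have hgt : IsTranslationAut dev g := ⟨_, hg⟩
    obtain ⟨G, hG⟩ := h.ext g hgt
    have h1 : ι (g (x s)) = ι (x (s + k * T)) := by
      refine h.eq_of_closure hflat ?_ (hxS _) ?_
      · rw [← hG]; exact (ext_mem_closure hG hgS).2 (hxS s)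
      · rw [h.dev_eq, h.dev_eq, hg, hx, hx, add_smul]; abel
    obtain ⟨B, hB, hxB, himg⟩ := hball _ hk
    rw [← h.injective h1] at hxB himg
    refine ⟨g.symm '' B, hB.translate hgt.symm, ⟨_, hxB, g.symm_apply_apply _⟩, ?_⟩
    obtain ⟨τ, hτ⟩ := hgt.symm
    have hc := hτ (g (x s))
    rw [g.symm_apply_apply] at hc
    rw [dev_image_translate hτ, himg, hc]
    simp [Metric.ball, image_add_right, preimage_ofPred_eq]
    ext p
    simp [dist_eq_norm, sub_eq_add_neg, add_assoc, add_comm]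
  obtain ⟨r₀, hr₀, hr₀r, hr₀b⟩ : ∃ r₀ > 0, r₀ ≤ r ∧ r₀ ≤ b - a :=
    ⟨min r (b - a), lt_min hr (by linarith), min_le_left _ _, min_le_right _ _⟩
  have hball₀ : ∀ s, HasFlatBall dev (x s) r₀ := by
    intro s
    obtain ⟨B, hB, hxB, himg⟩ := hball' s
    exact hB.hasFlatBall h.loc hxB hr₀ (by rw [himg]; exact Metric.ball_subset_ball hr₀r)
  choose B hB hxB himg using hball₀
  have hmeet : ∀ s, (S ∩ B s).Nonempty := by
    intro s
    obtain ⟨_, ⟨y, hy, rfl⟩, y', hy', he⟩ := mem_closure_iff.1 (hxS s) _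
      (h.isOpenMap _ (hB s).isOpen) (mem_image_of_mem _ (hxB s))
    exact ⟨y', hy', h.injective he ▸ hy⟩
  -- The pieces to be glued: `none` indexes the strip, and `some s` the ball about the border point
  -- `x s`.
  set W : Option ℝ → Set X := fun o => o.elim S B with hW
  have himgW : dev '' (⋃ o, W o) = {p | a < inner ℝ n p ∧ inner ℝ n p < b + r₀} := by
    rw [image_iUnion]
    ext p
    simp only [mem_iUnion, Option.exists, hW, Option.elim, himg, hS.image_eq, mem_ofPred_eq,
      Metric.mem_ball, hx]
    constructor
    · rintro (hp | ⟨s, hs⟩)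
      · exact ⟨hp.1, by linarith [hp.2]⟩
      · have h1 := (hf.abs_inner_n_le _ _).trans_lt hs
        rw [hf.inner_n, abs_lt] at h1
        exact ⟨by linarith, by linarith⟩
    · rintro ⟨h1, h2⟩
      by_cases hp : inner ℝ n p < b
      · exact Or.inl ⟨h1, hp⟩
      · refine Or.inr ⟨inner ℝ u p, ?_⟩
        refine (hf.dist_le _ _).trans_lt ?_
        rw [hf.inner_u, hf.inner_n, sub_self, abs_zero, zero_add, abs_lt]
        exact ⟨by linarith, by linarith⟩
  have hflatW : IsFlat dev (⋃ o, W o) := by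
    refine isFlat_iUnion h.loc ?_ ?_ ?_
    · rintro (_ | s)
      · exact hflat
      · exact hB s
    · rintro (_ | s) (_ | t) hne
      · exact ⟨v, hS.maxStrip.mem, hS.maxStrip.mem⟩
      · exact hmeet t
      · rw [inter_comm]; exact hmeet s
      · change (B s ∩ B t).Nonempty
        obtain ⟨p, hps, hpt⟩ := hne
        change p ∈ dev '' B s at hps
        change p ∈ dev '' B t at hpt
        rw [himg, hx] at hps hpt
        have hst : |s - t| < 2 * r₀ := by
          have h1 := dist_triangle_left (s • u + b • n) (t • u + b • n) p
          rw [dist_add_right, dist_eq_norm, ← sub_smul, norm_smul, hf.norm_u, mul_one,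
            Real.norm_eq_abs] at h1
          rw [Metric.mem_ball] at hps hpt
          linarith
        -- Overlapping balls have centres at the same height `b`, so they also overlap just below
        -- the midpoint of the centres. That point is in `S`, so both balls contain the same point
        -- of the surface over it.
        obtain ⟨δ, hδ, hδ1, hδ2⟩ : ∃ δ > 0, δ < b - a ∧ |s - t| / 2 + δ < r₀ :=
          ⟨min ((b - a) / 2) ((r₀ - |s - t| / 2) / 2), lt_min (by linarith) (by linarith),
            (min_le_left _ _).trans_lt (by linarith), by
              linarith [min_le_right ((b - a) / 2) ((r₀ - |s - t| / 2) / 2)]⟩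
        set q : Plane := ((s + t) / 2) • u + (b - δ) • n with hq
        have hqs : q ∈ dev '' B s := by
          rw [himg, hx]
          refine (hf.dist_le _ _).trans_lt ?_
          rw [hq, hf.inner_u, hf.inner_u, hf.inner_n, hf.inner_n]
          have e1 : (s + t) / 2 - s = -((s - t) / 2) := by ring
          have e2 : b - δ - b = -δ := by ring
          rw [e1, e2, abs_neg, abs_neg, abs_div, abs_of_pos hδ, abs_two]
          exact hδ2
        have hqt : q ∈ dev '' B t := by
          rw [himg, hx]
          refine (hf.dist_le _ _).trans_lt ?_
          rw [hq, hf.inner_u, hf.inner_u, hf.inner_n, hf.inner_n]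
          have e1 : (s + t) / 2 - t = (s - t) / 2 := by ring
          have e2 : b - δ - b = -δ := by ring
          rw [e1, e2, abs_neg, abs_div, abs_of_pos hδ, abs_two]
          exact hδ2
        have hqS : q ∈ dev '' S := by
          rw [hS.image_eq]
          refine ⟨?_, ?_⟩ <;> rw [hq, hf.inner_n] <;> linarith
        obtain ⟨z, hz, hzq⟩ := hqS
        exact ⟨z, hflat.mem_of_meets h.loc (hB s) (hmeet s) hz (hzq ▸ hqs),
          hflat.mem_of_meets h.loc (hB t) (hmeet t) hz (hzq ▸ hqt)⟩
    · rw [himgW]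
      have hlin : IsLinearMap ℝ fun p : Plane => (inner ℝ n p : ℝ) :=
        ⟨fun x y => inner_add_right _ _ _, fun c x => by simp [inner_smul_right]⟩
      exact (convex_halfSpace_gt hlin a).inter (convex_halfSpace_lt hlin (b + r₀))
  have hstrip : IsStrip dev u (⋃ o, W o) := by
    refine ⟨hflatW, ?_⟩
    rw [himgW]
    intro p hp t
    simpa [inner_add_right, inner_smul_right, hf.nu] using hp
  have hsub := hS.maxStrip.max _ hstrip (mem_iUnion.2 ⟨none, hS.maxStrip.mem⟩)
  -- The enlarged strip reaches above `b`, against the maximality of `S`.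
  have h1 : (0 : ℝ) • u + (b + r₀ / 2) • n ∈ dev '' ⋃ o, W o := by
    rw [himgW]
    exact ⟨by rw [hf.inner_n]; linarith, by rw [hf.inner_n]; linarith⟩
  have h2 := image_mono hsub h1
  rw [hS.image_eq] at h2
  have h3 := h2.2
  rw [hf.inner_n] at h3
  linarith

/-- The period translates of a single border cone point. -/
theorem exists_periodic_coneOn (h : FlatModel dev ι devM)
    (hS : IsPeriodicStrip dev u n v S a b T) :
    ∃ s : ℝ, ∀ k : ℤ, ∃ ζ ∈ coneOn ι S, devM ζ = (s + k * T) • u + b • n := by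
  obtain ⟨ζ, hζ, hb⟩ := h.exists_coneOn_border hS
  refine ⟨inner ℝ u (devM ζ), fun k => ?_⟩
  obtain ⟨g, hg, hgS⟩ := hS.period k
  obtain ⟨G, hG⟩ := h.ext g ⟨_, hg⟩
  refine ⟨G ζ, (h.ext_mem_coneOn hG hgS).2 hζ, ?_⟩
  rw [h.devM_ext hg hG]
  conv_lhs => rw [hS.frame.expand (devM ζ), hb]
  rw [add_smul]; abel

/-- Cone points close to the upper border of a maximal strip lie on that border. -/
theorem exists_border_isolation (h : FlatModel dev ι devM)
    (hS : IsPeriodicStrip dev u n v S a b T) :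
    ∃ κ > 0, ∀ ζ ∈ (range ι)ᶜ, ∀ w ∈ closure (ι '' S), inner ℝ n (devM w) = b →
      dist ζ w < κ → ζ ∈ closure (ι '' S) := by
  by_contra! hbad
  have hf := hS.frame
  have hflat := hS.maxStrip.strip.1
  choose ζ hζ w hwS hwb hdist hnot using fun k : ℕ => hbad (1 / ((k : ℝ) + 1)) (by positivity)
  -- Periods bring the offending border points into one compact stretch of the border. Their limit
  -- `m` is also the limit of the translated frontier points, which eventually equal `m` by
  -- discreteness and so lie in the closure of `S`.
  choose k hk using fun j => hS.exists_reduce (inner ℝ u (devM (w j)))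
  choose g hg hgS using fun j => hS.period (k j)
  choose G hG using fun j => h.ext (g j) ⟨_, hg j⟩
  have hGw : ∀ j, G j (w j) ∈ closure (ι '' S) := fun j =>
    (ext_mem_closure (hG j) (hgS j)).2 (hwS j)
  have hdevw : ∀ j, devM (G j (w j)) = (inner ℝ u (devM (w j)) + k j * T) • u + b • n := by
    intro j
    rw [h.devM_ext (hg j) (hG j)]
    conv_lhs => rw [hf.expand (devM (w j)), hwb]
    rw [add_smul]; abel
  obtain ⟨s₀, -, φ, hφ, hlim⟩ := isCompact_Icc.tendsto_subseq hk
  have hcauchy : CauchySeq fun j => G (φ j) (w (φ j)) := by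
    rw [Metric.cauchySeq_iff]
    intro ε hε
    obtain ⟨N, hN⟩ := Metric.cauchySeq_iff.1 hlim.cauchySeq ε hε
    refine ⟨N, fun i hi j hj => ?_⟩
    rw [h.dist_eq_of_closure hflat (hGw _) (hGw _), hdevw, hdevw, dist_add_right, dist_eq_norm,
      ← sub_smul, norm_smul, hf.norm_u, mul_one]
    exact hN i hi j hj
  obtain ⟨m, hm⟩ := cauchySeq_tendsto_of_complete hcauchy
  have hmS : m ∈ closure (ι '' S) :=
    isClosed_closure.mem_of_tendsto hm (Eventually.of_forall fun j => hGw _)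
  have hζm : Tendsto (fun j => G (φ j) (ζ (φ j))) atTop (𝓝 m) := by
    refine (tendsto_iff_of_dist ?_).2 hm
    refine squeeze_zero (fun _ => dist_nonneg) (fun j => ?_)
      ((tendsto_one_div_add_atTop_nhds_zero_nat (𝕜 := ℝ)).comp hφ.tendsto_atTop)
    rw [(G (φ j)).isometry.dist_eq]
    exact (hdist (φ j)).le
  obtain ⟨-, hev⟩ := h.eventually_eq_of_tendsto
    (fun j => (h.ext_mem_frontier (hG (φ j))).2 (hζ (φ j))) hζm
  obtain ⟨j, hj⟩ := hev.exists
  exact hnot (φ j) ((ext_mem_closure (hG _) (hgS _)).1 (hj ▸ hmS))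

end FlatModel

end Border

end FlatSurface

namespace FlatSurface

/-! ### Conic regions without large discs, and their limits -/

section Conic

/-- The quadratic polynomial with coefficient vector `k`. -/
def conic (k : Fin 6 → ℝ) (p : Plane) : ℝ :=
  k 0 * p 0 ^ 2 + k 1 * (p 0 * p 1) + k 2 * p 1 ^ 2 + k 3 * p 0 + k 4 * p 1 + k 5

/-- The homogeneous quadratic part. -/
def conicQuad (k : Fin 6 → ℝ) (w : Plane) : ℝ :=
  k 0 * w 0 ^ 2 + k 1 * (w 0 * w 1) + k 2 * w 1 ^ 2

/-- The polar form of the quadratic part. -/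
def conicPolar (k : Fin 6 → ℝ) (w z : Plane) : ℝ :=
  2 * k 0 * (w 0 * z 0) + k 1 * (w 0 * z 1 + w 1 * z 0) + 2 * k 2 * (w 1 * z 1)

/-- The derivative at `p`. -/
def conicDeriv (k : Fin 6 → ℝ) (p w : Plane) : ℝ :=
  (2 * k 0 * p 0 + k 1 * p 1 + k 3) * w 0 + (k 1 * p 0 + 2 * k 2 * p 1 + k 4) * w 1

theorem exists_conic (q : QuadraticForm ℝ (Fin 3 → ℝ)) :
    ∃ k, planarSubconic q = {p | conic k p < 0} := by
  set e0 : Fin 3 → ℝ := ![1, 0, 0]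
  set e1 : Fin 3 → ℝ := ![0, 1, 0]
  set e2 : Fin 3 → ℝ := ![0, 0, 1]
  refine ⟨![q e0, QuadraticMap.polar q e0 e1, q e1, QuadraticMap.polar q e0 e2,
    QuadraticMap.polar q e1 e2, q e2], ?_⟩
  ext p
  have h : (![p 0, p 1, 1] : Fin 3 → ℝ) = p 0 • e0 + (p 1 • e1 + e2) := by
    ext i; fin_cases i <;> simp [e0, e1, e2]
  have h2 : q ![p 0, p 1, 1] = conic ![q e0, QuadraticMap.polar q e0 e1, q e1,
      QuadraticMap.polar q e0 e2, QuadraticMap.polar q e1 e2, q e2] p := by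
    rw [h, QuadraticMap.map_add q, QuadraticMap.map_add q]
    simp only [QuadraticMap.map_smul, QuadraticMap.polar_add_right,
      QuadraticMap.polar_smul_left, QuadraticMap.polar_smul_right, smul_eq_mul]
    simp [conic]
    ring
  simp only [planarSubconic, mem_ofPred_eq, h2]

variable {k : Fin 6 → ℝ}

theorem continuous_conic : Continuous fun z : (Fin 6 → ℝ) × Plane => conic z.1 z.2 := by
  unfold conic; fun_prop

theorem continuous_conic_right (k : Fin 6 → ℝ) : Continuous (conic k) := by
  unfold conic; fun_prop

theorem conic_add_smul (k : Fin 6 → ℝ) (p w : Plane) (t : ℝ) :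
    conic k (p + t • w) = conic k p + t * conicDeriv k p w + t ^ 2 * conicQuad k w := by
  simp only [conic, conicDeriv, conicQuad, PiLp.add_apply, PiLp.smul_apply, smul_eq_mul]; ring

theorem conicDeriv_add (k : Fin 6 → ℝ) (p z w : Plane) :
    conicDeriv k (p + z) w = conicDeriv k p w + conicPolar k w z := by
  simp only [conicDeriv, conicPolar, PiLp.add_apply]; ring

theorem conicQuad_comb (k : Fin 6 → ℝ) (w z : Plane) (x y : ℝ) :
    conicQuad k (x • w + y • z) =
      conicQuad k w * x ^ 2 + conicPolar k w z * (x * y) + conicQuad k z * y ^ 2 := by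
  simp only [conicQuad, conicPolar, PiLp.add_apply, PiLp.smul_apply, smul_eq_mul]; ring

theorem conic_frame (k : Fin 6 → ℝ) (v w z : Plane) (x y : ℝ) :
    conic k (v + (x • w + y • z)) = conicQuad k w * x ^ 2 + conicPolar k w z * (x * y) +
      conicQuad k z * y ^ 2 + conicDeriv k v w * x + conicDeriv k v z * y + conic k v := by
  simp only [conic, conicDeriv, conicQuad, conicPolar, PiLp.add_apply, PiLp.smul_apply,
    smul_eq_mul]
  ring

theorem conicDeriv_smul (k : Fin 6 → ℝ) (p w : Plane) (t : ℝ) :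
    conicDeriv k p (t • w) = t * conicDeriv k p w := by
  simp only [conicDeriv, PiLp.smul_apply, smul_eq_mul]; ring

theorem conicQuad_neg (k : Fin 6 → ℝ) (w : Plane) : conicQuad k (-w) = conicQuad k w := by
  simp only [conicQuad, PiLp.neg_apply]; ring

theorem conicDeriv_neg (k : Fin 6 → ℝ) (p w : Plane) :
    conicDeriv k p (-w) = -conicDeriv k p w := by
  simp only [conicDeriv, PiLp.neg_apply]; ring

/-- The Cauchy–Schwarz inequality for a positive semidefinite form, in the normalisation where the
polar form is twice the bilinear form. -/
theorem conicPolar_sq_le (hk : ∀ w, 0 ≤ conicQuad k w) (w z : Plane) :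
    conicPolar k w z ^ 2 ≤ 4 * conicQuad k w * conicQuad k z := by
  have := discrim_le_zero (a := conicQuad k w) (b := conicPolar k w z) (c := conicQuad k z)
    (fun x => by
      have h1 := hk (x • w + (1 : ℝ) • z)
      rw [conicQuad_comb] at h1
      nlinarith)
  rw [discrim] at this
  linarith

theorem conicPolar_eq_zero (hk : ∀ w, 0 ≤ conicQuad k w) {w : Plane} (hw : conicQuad k w = 0)
    (z : Plane) : conicPolar k w z = 0 := by
  have := conicPolar_sq_le hk w z
  rw [hw, mul_zero, zero_mul] at this
  exact pow_eq_zero_iff two_ne_zero |>.1 (le_antisymm this (sq_nonneg _))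

/-- A null vector of a semidefinite form is in its radical, so the slope in direction `w` is the
same at every point. -/
theorem conic_add_smul_of_quad_eq_zero (hk : ∀ w, 0 ≤ conicQuad k w) {w : Plane}
    (hw : conicQuad k w = 0) (v p : Plane) (t : ℝ) :
    conic k (p + t • w) = conic k p + t * conicDeriv k v w := by
  rw [conic_add_smul, hw]
  have : conicDeriv k p w = conicDeriv k v w := by
    have h1 := conicDeriv_add k v (p - v) w
    rw [add_sub_cancel, conicPolar_eq_zero hk hw, add_zero] at h1
    exact h1
  rw [this]; ring

/-- A convex conic region without large discs is given by a positive semidefinite form. -/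
theorem conicQuad_nonneg {R : ℝ} (hc : Convex ℝ {p | conic k p < 0})
    (hR : ∀ c, ¬ Metric.closedBall c R ⊆ {p | conic k p < 0}) (w : Plane) : 0 ≤ conicQuad k w := by
  by_contra! hw
  refine hR 0 fun p _ => ?_
  -- In a direction where the form is negative, both `p + t • w` and `p - t • w` are in the region
  -- for large `t`. By convexity so is `p`, hence the region is the whole plane.
  obtain ⟨t, ht0, ht⟩ : ∃ t > 0, conic k p + t * |conicDeriv k p w| + t ^ 2 * conicQuad k w < 0 := by
    refine ⟨(|conic k p| + |conicDeriv k p w| + 1) / (-conicQuad k w) + 1, ?_, ?_⟩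
    · have : 0 < -conicQuad k w := by linarith
      positivity
    · set Q := -conicQuad k w with hQ
      have hQ0 : 0 < Q := by linarith
      have hQe : conicQuad k w = -Q := by rw [hQ, neg_neg]
      set A := |conic k p| + |conicDeriv k p w| + 1
      set t := A / Q + 1 with ht
      have hA : 1 ≤ A := by simp only [A]; linarith [abs_nonneg (conic k p), abs_nonneg (conicDeriv k p w)]
      have h1 : t * Q = A + Q := by rw [ht]; field_simp
      have ht1 : 1 ≤ t := by rw [ht]; have : 0 < A / Q := by positivity
                             linarith
      have h2 : t ^ 2 * conicQuad k w = -(t * (A + Q)) := by rw [hQe, ← h1]; ring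
      rw [h2]
      have h3 : conic k p ≤ t * |conic k p| := by
        nlinarith [le_abs_self (conic k p), abs_nonneg (conic k p)]
      have h4 : t * (A + Q) = t * |conic k p| + t * |conicDeriv k p w| + t + t * Q := by
        simp only [A]; ring
      nlinarith
  have h1 : p + t • w ∈ {p | conic k p < 0} := by
    change conic k (p + t • w) < 0
    rw [conic_add_smul]
    nlinarith [le_abs_self (conicDeriv k p w)]
  have h2 : p + (-t) • w ∈ {p | conic k p < 0} := by
    change conic k (p + (-t) • w) < 0
    rw [conic_add_smul]
    nlinarith [neg_abs_le (conicDeriv k p w)]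
  have := hc h1 h2 (a := 1 / 2) (b := 1 / 2) (by norm_num) (by norm_num) (by norm_num)
  convert this using 1
  module

/-- Parabolic regions and half-planes contain large discs. -/
theorem exists_closedBall_of_deriv_neg (hk : ∀ w, 0 ≤ conicQuad k w) {v w : Plane}
    (hw : conicQuad k w = 0) (hd : conicDeriv k v w < 0) (R : ℝ) :
    ∃ c, Metric.closedBall c R ⊆ {p | conic k p < 0} := by
  obtain ⟨C, hC⟩ := (isCompact_closedBall v R).bddAbove_image
    (continuous_conic_right k).continuousOn
  -- Moving the disc about `v` by `t • w` lowers the polynomial by `|C| + 1`, more than its maximum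
  -- on the disc.
  set t := (|C| + 1) / (-conicDeriv k v w) with ht
  have hpos : 0 < -conicDeriv k v w := by linarith
  refine ⟨v + t • w, fun p hp => ?_⟩
  have h1 : p - t • w ∈ Metric.closedBall v R := by
    rw [Metric.mem_closedBall, dist_eq_norm] at hp ⊢
    convert hp using 2
    abel
  have h2 : conic k (p - t • w) ≤ C := hC (mem_image_of_mem _ h1)
  have h3 := conic_add_smul_of_quad_eq_zero hk hw v (p - t • w) t
  rw [sub_add_cancel] at h3
  change conic k p < 0
  rw [h3]
  have h4 : t * conicDeriv k v w = -(|C| + 1) := by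
    rw [ht, div_neg, neg_mul, div_mul_cancel₀ _ hd.ne]
  linarith [le_abs_self C]

/-- A nonzero slope along a null direction `w` would give large discs in direction `w` or `-w`.
Hence the region is invariant along `w`, so degenerate regions are strips. -/
theorem conicDeriv_eq_zero (hk : ∀ w, 0 ≤ conicQuad k w) {R : ℝ}
    (hR : ∀ c, ¬ Metric.closedBall c R ⊆ {p | conic k p < 0}) {w : Plane}
    (hw : conicQuad k w = 0) (v : Plane) : conicDeriv k v w = 0 := by
  rcases lt_trichotomy (conicDeriv k v w) 0 with h | h | h
  · obtain ⟨c, hc⟩ := exists_closedBall_of_deriv_neg hk hw h R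
    exact absurd hc (hR c)
  · exact h
  · obtain ⟨c, hc⟩ := exists_closedBall_of_deriv_neg hk (w := -w) (by rwa [conicQuad_neg])
      (v := v) (by rw [conicDeriv_neg]; linarith) R
    exact absurd hc (hR c)

theorem conic_add_smul_eq (hk : ∀ w, 0 ≤ conicQuad k w) {R : ℝ}
    (hR : ∀ c, ¬ Metric.closedBall c R ⊆ {p | conic k p < 0}) {w : Plane}
    (hw : conicQuad k w = 0) (p : Plane) (t : ℝ) : conic k (p + t • w) = conic k p := by
  rw [conic_add_smul_of_quad_eq_zero hk hw p, conicDeriv_eq_zero hk hR hw, mul_zero, add_zero]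

theorem conic_smul (t : ℝ) (k : Fin 6 → ℝ) (p : Plane) : conic (t • k) p = t * conic k p := by
  simp only [conic, Pi.smul_apply, smul_eq_mul]; ring

theorem conic_sub (k k' : Fin 6 → ℝ) (p : Plane) : conic (k - k') p = conic k p - conic k' p := by
  simp only [conic, Pi.sub_apply]; ring

theorem eq_zero_of_conic_eq_zero (h : ∀ p, conic k p = 0) : k = 0 := by
  have h00 := h !₂[0, 0]
  have h10 := h !₂[1, 0]
  have h20 := h !₂[-1, 0]
  have h01 := h !₂[0, 1]
  have h02 := h !₂[0, -1]
  have h11 := h !₂[1, 1]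
  simp [conic] at h00 h10 h20 h01 h02 h11
  ext i
  fin_cases i <;> simp <;> linarith

theorem eventually_subset_conic {K : Set Plane} (hK : IsCompact K) {k : Fin 6 → ℝ}
    (h : K ⊆ {p | conic k p < 0}) {κ : ℕ → Fin 6 → ℝ} (hκ : Tendsto κ atTop (𝓝 k)) :
    ∀ᶠ j in atTop, K ⊆ {p | conic (κ j) p < 0} := by
  refine hκ.eventually (hK.eventually_forall_of_forall_eventually
    (P := fun k p => conic k p < 0) fun p hp => ?_)
  exact continuous_conic.continuousAt.eventually_lt_const (h hp)

/-- Limits of unbounded convex conic regions that contain a fixed disc and no large discs. -/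
theorem exists_strip_limit {κ : ℕ → Fin 6 → ℝ} {v : Plane} {r R : ℝ} (hr : 0 < r)
    (hc : ∀ j, Convex ℝ {p | conic (κ j) p < 0})
    (hR : ∀ j, ∀ c, ¬ Metric.closedBall c R ⊆ {p | conic (κ j) p < 0})
    (hV : ∀ j, Metric.ball v r ⊆ {p | conic (κ j) p < 0})
    (hunb : ∀ L, ∀ᶠ j in atTop, ¬ {p | conic (κ j) p < 0} ⊆ Metric.closedBall v L) :
    ∃ u n, IsFrame u n ∧ ∃ φ : ℕ → ℕ, StrictMono φ ∧ ∀ p, |inner ℝ n (p - v)| < r →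
      ∀ᶠ j in atTop, conic (κ (φ j)) p < 0 := by
  have hne : ∀ j, κ j ≠ 0 := by
    intro j h0
    have := hV j (Metric.mem_ball_self hr)
    rw [h0] at this
    simp [conic] at this
  -- Scaling to unit coefficient vectors does not change the regions and keeps the limit polynomial
  -- nonzero.
  set κ' : ℕ → Fin 6 → ℝ := fun j => ‖κ j‖⁻¹ • κ j with hκ'
  have hnorm : ∀ j, ‖κ' j‖ = 1 := fun j => by
    rw [hκ', norm_smul, norm_inv, norm_norm, inv_mul_cancel₀ (norm_ne_zero_iff.2 (hne j))]
  have hset : ∀ j p, conic (κ' j) p < 0 ↔ conic (κ j) p < 0 := fun j p => by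
    rw [hκ', conic_smul]
    have : 0 < ‖κ j‖⁻¹ := inv_pos.2 (norm_pos_iff.2 (hne j))
    constructor
    · intro h; by_contra! h'; linarith [mul_nonneg this.le h']
    · exact mul_neg_of_pos_of_neg this
  have hset' : ∀ j, {p | conic (κ' j) p < 0} = {p | conic (κ j) p < 0} := fun j =>
    Set.ext (hset j)
  have hpsd' : ∀ j w, 0 ≤ conicQuad (κ' j) w := fun j w =>
    conicQuad_nonneg (R := R) (by rw [hset']; exact hc j) (by rw [hset']; exact hR j) w
  obtain ⟨ψ, hψ, hψp⟩ : ∃ ψ : ℕ → ℕ, StrictMono ψ ∧ ∀ m : ℕ,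
      ¬ {p | conic (κ (ψ m)) p < 0} ⊆ Metric.closedBall v (m + 1) := by
    refine extraction_forall_of_eventually fun m => hunb (m + 1)
  choose p hp hpv using fun m => not_subset.1 (hψp m)
  set s : ℕ → ℝ := fun m => dist (p m) v with hs
  have hsm : ∀ m : ℕ, (m : ℝ) + 1 < s m := fun m => by
    have := hpv m
    rw [Metric.mem_closedBall, not_le] at this
    exact this
  have hspos : ∀ m, 0 < s m := fun m => by
    have := hsm m
    have h2 : (0 : ℝ) ≤ m := Nat.cast_nonneg m
    linarith
  -- Directions of points that run off to infinity. Their limit `u` will be the direction of the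
  -- strip.
  set ω : ℕ → Plane := fun m => (s m)⁻¹ • (p m - v) with hω
  have hωn : ∀ m, ‖ω m‖ = 1 := fun m => by
    simp only [hω]
    rw [norm_smul, ← dist_eq_norm, Real.norm_eq_abs, abs_inv, abs_of_pos (hspos m)]
    exact inv_mul_cancel₀ (hspos m).ne'
  have hpω : ∀ m, p m = v + s m • ω m := fun m => by
    simp only [hω]
    rw [smul_smul, mul_inv_cancel₀ (hspos m).ne', one_smul, add_sub_cancel]
  obtain ⟨⟨k, u⟩, hku, φ, hφ, hlim⟩ := ((isCompact_sphere (0 : Fin 6 → ℝ) 1).prod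
    (isCompact_sphere (0 : Plane) 1)).tendsto_subseq (x := fun m => (κ' (ψ m), ω m))
    (fun m => ⟨by simpa using hnorm (ψ m), by simpa using hωn m⟩)
  have hlimk : Tendsto (fun m => κ' (ψ (φ m))) atTop (𝓝 k) :=
    (continuous_fst.tendsto _).comp hlim
  have hlimu : Tendsto (fun m => ω (φ m)) atTop (𝓝 u) :=
    (continuous_snd.tendsto _).comp hlim
  have hk1 : ‖k‖ = 1 := by simpa using hku.1
  have hu1 : ‖u‖ = 1 := by simpa using hku.2
  have hcontQ : Continuous fun z : (Fin 6 → ℝ) × Plane => conicQuad z.1 z.2 := by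
    unfold conicQuad; fun_prop
  have hcontD : Continuous fun z : (Fin 6 → ℝ) × Plane => conicDeriv z.1 v z.2 := by
    unfold conicDeriv; fun_prop
  have hpsd : ∀ w, 0 ≤ conicQuad k w := fun w =>
    ge_of_tendsto ((hcontQ.tendsto (k, w)).comp (hlimk.prodMk_nhds tendsto_const_nhds))
      (Eventually.of_forall fun m => hpsd' _ w)
  have hRk : ∀ c, ¬ Metric.closedBall c R ⊆ {p | conic k p < 0} := by
    intro c hcs
    obtain ⟨m, hm⟩ := (eventually_subset_conic (isCompact_closedBall c R) hcs hlimk).exists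
    rw [hset'] at hm
    exact hR _ c hm
  have hle : ∀ p ∈ Metric.ball v r, conic k p ≤ 0 := fun p hp =>
    le_of_tendsto ((continuous_conic.tendsto (k, p)).comp (hlimk.prodMk_nhds tendsto_const_nhds))
      (Eventually.of_forall fun m => ((hset _ p).2 (hV _ hp)).le)
  -- Dividing the inequality at `v + s • ω` by `s ^ 2` leaves only the quadratic part in the limit.
  have hqu : conicQuad k u = 0 := by
    refine le_antisymm ?_ (hpsd u)
    have hsinv : Tendsto (fun m => (s (φ m))⁻¹) atTop (𝓝 0) := by
      refine tendsto_inv_atTop_zero.comp (tendsto_atTop_mono (fun m => (hsm (φ m)).le) ?_)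
      exact tendsto_atTop_add_const_right _ _ (tendsto_natCast_atTop_atTop.comp hφ.tendsto_atTop)
    have h1 := (continuous_conic.tendsto (k, v)).comp (hlimk.prodMk_nhds tendsto_const_nhds)
    have h2 := (hcontD.tendsto (k, u)).comp hlim
    have h3 := (hcontQ.tendsto (k, u)).comp hlim
    have h4 := ((h1.mul (hsinv.pow 2)).add (h2.mul hsinv)).add h3
    have h5 : conic k v * 0 ^ 2 + conicDeriv k v u * 0 + conicQuad k u ≤ 0 := by
      refine le_of_tendsto h4 (Eventually.of_forall fun m => ?_)
      have h6 := (hset _ _).2 (hp (φ m))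
      rw [hpω, conic_add_smul] at h6
      have h7 := hspos (φ m)
      simp only [Function.comp_apply]
      have h8 : conic (κ' (ψ (φ m))) v * (s (φ m))⁻¹ ^ 2 +
          conicDeriv (κ' (ψ (φ m))) v (ω (φ m)) * (s (φ m))⁻¹ +
          conicQuad (κ' (ψ (φ m))) (ω (φ m)) = (s (φ m))⁻¹ ^ 2 *
          (conic (κ' (ψ (φ m))) v + s (φ m) * conicDeriv (κ' (ψ (φ m))) v (ω (φ m)) +
          s (φ m) ^ 2 * conicQuad (κ' (ψ (φ m))) (ω (φ m))) := by
        field_simp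
      rw [h8]
      exact mul_nonpos_of_nonneg_of_nonpos (by positivity) h6.le
    linarith
  obtain ⟨n, hf⟩ := IsFrame.exists_of_norm hu1
  have hinv := fun p t => conic_add_smul_eq hpsd hRk hqu p t
  have hform : ∀ p, conic k p = conic k (v + (inner ℝ n (p - v) : ℝ) • n) := by
    intro p
    rw [← hinv (v + (inner ℝ n (p - v) : ℝ) • n) (inner ℝ u (p - v)), add_assoc, add_comm (_ • n),
      ← hf.expand, add_sub_cancel]
  -- Otherwise the limit polynomial is constant: negative is excluded by the bound on discs, zero by
  -- the unit norm.
  have hqn : 0 < conicQuad k n := by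
    refine lt_of_le_of_ne (hpsd n) fun h0 => ?_
    have hinv' := fun p t => conic_add_smul_eq hpsd hRk h0.symm p t
    have hconst : ∀ p, conic k p = conic k v := fun p => by rw [hform, hinv']
    have hv0 : conic k v = 0 := by
      refine le_antisymm (hle v (Metric.mem_ball_self hr)) ?_
      by_contra! hlt
      exact hRk v fun p _ => by
        change conic k p < 0
        rwa [hconst]
    have : k = 0 := eq_zero_of_conic_eq_zero fun p => (hconst p).trans hv0
    rw [this, norm_zero] at hk1
    exact zero_ne_one hk1
  refine ⟨u, n, hf, ψ ∘ φ, hψ.comp hφ, fun p hp => ?_⟩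
  have hneg : conic k p < 0 := by
    rw [hform]
    set y : ℝ := inner ℝ n (p - v)
    -- The limit inequality on the disc is only weak. Strict convexity across the strip, applied
    -- between the heights `y - δ` and `y + δ`, makes it strict at `y`.
    obtain ⟨δ, hδ, hδr⟩ : ∃ δ > 0, |y| + δ < r := ⟨(r - |y|) / 2, by linarith, by linarith⟩
    have key : ∀ z : ℝ, |z| < r → conic k (v + z • n) ≤ 0 := fun z hz =>
      hle _ (by simpa [norm_smul, hf.norm_n] using hz)
    have h1 := key (y + δ) ((abs_add_le y δ).trans_lt (by rwa [abs_of_pos hδ]))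
    have h2 := key (y - δ) ((abs_sub y δ).trans_lt (by rwa [abs_of_pos hδ]))
    rw [conic_add_smul] at h1 h2 ⊢
    nlinarith [mul_pos (pow_pos hδ 2) hqn]
  have := ((continuous_conic.tendsto (k, p)).comp
    (hlimk.prodMk_nhds tendsto_const_nhds)).eventually_lt_const hneg
  filter_upwards [this] with j hj
  exact (hset _ _).1 hj

end Conic

end FlatSurface

namespace FlatSurface

/-! ### Chord lengths and thin caps -/

section Chord

/-- The discriminant of `a x² + B x y + c y² + D x + E y + F` as a polynomial in `x`. -/
def chordDisc (a B c D E F y : ℝ) : ℝ := (B * y + D) ^ 2 - 4 * a * (c * y ^ 2 + E * y + F)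

variable {a B c D E F : ℝ}

theorem chordDisc_eq (x y : ℝ) : 4 * a * (a * x ^ 2 + B * (x * y) + c * y ^ 2 + D * x + E * y + F) =
    (2 * a * x + (B * y + D)) ^ 2 - chordDisc a B c D E F y := by
  simp only [chordDisc]; ring

/-- When `chordDisc` is nonnegative, the chord at height `y` has length `√chordDisc / a`. A chord
longer than `T` would have a point of the progression `s + k * T` strictly inside. -/
theorem chordDisc_le {T s y : ℝ} (ha : 0 < a) (hT : 0 < T)
    (h : ∀ k : ℤ, 0 ≤ a * (s + k * T) ^ 2 + B * ((s + k * T) * y) + c * y ^ 2 + D * (s + k * T)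
      + E * y + F) : chordDisc a B c D E F y ≤ a ^ 2 * T ^ 2 := by
  by_contra! hlt
  -- The midpoint of the chord is `-(B * y + D) / (2 * a)`. Rounding `z / T` down selects the member
  -- `x` of the progression within `T / 2` of it.
  set z := s + (B * y + D) / (2 * a) + T / 2 with hz
  have h1 := Int.sub_floor_div_mul_nonneg z hT
  have h2 := Int.sub_floor_div_mul_lt z hT
  have h3 := h (-⌊z / T⌋)
  push_cast at h3
  set x := s + -(⌊z / T⌋ : ℝ) * T with hx
  have h4 : 2 * a * x + (B * y + D) = 2 * a * (z - ⌊z / T⌋ * T - T / 2) := by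
    rw [hx, hz]; field_simp; ring
  have h5 := chordDisc_eq (a := a) (B := B) (c := c) (D := D) (E := E) (F := F) x y
  have h6 : (2 * a * x + (B * y + D)) ^ 2 ≤ a ^ 2 * T ^ 2 := by
    rw [h4]
    have : (z - ⌊z / T⌋ * T - T / 2) ^ 2 ≤ (T / 2) ^ 2 := by
      apply sq_le_sq' <;> linarith
    nlinarith [sq_nonneg a]
  nlinarith [mul_nonneg (by positivity : 0 ≤ 4 * a) h3]

/-- `chordDisc` is quadratic in the height with leading coefficient `B ^ 2 - 4 * a * c ≤ 0`, hence
concave. The nonnegative value at `h` is dropped from the concavity inequality. -/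
theorem chordDisc_concave {h h₀ : ℝ} (hB : B ^ 2 ≤ 4 * a * c) (hh₀ : 0 < h₀) (hh : h₀ < h)
    (hdh : 0 ≤ chordDisc a B c D E F h) :
    (h - h₀) * chordDisc a B c D E F 0 ≤ h * chordDisc a B c D E F h₀ := by
  have hh' : 0 < h := hh₀.trans hh
  have e : h * chordDisc a B c D E F h₀ - (h - h₀) * chordDisc a B c D E F 0 =
      (4 * a * c - B ^ 2) * (h * h₀ * (h - h₀)) + h₀ * chordDisc a B c D E F h := by
    simp only [chordDisc]; ring
  have h1 : 0 ≤ (4 * a * c - B ^ 2) * (h * h₀ * (h - h₀)) :=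
    mul_nonneg (by linarith) (by have := sub_pos.2 hh; positivity)
  have h2 : 0 ≤ h₀ * chordDisc a B c D E F h := mul_nonneg hh₀.le hdh
  linarith

theorem quad_nonneg_of_disc (ha : 0 < a) (hB : B ^ 2 ≤ 4 * a * c) (x y : ℝ) :
    0 ≤ a * x ^ 2 + B * (x * y) + c * y ^ 2 := by
  have e : 4 * a * (a * x ^ 2 + B * (x * y) + c * y ^ 2) =
      (2 * a * x + B * y) ^ 2 + (4 * a * c - B ^ 2) * y ^ 2 := by ring
  have h1 : 0 ≤ 4 * a * (a * x ^ 2 + B * (x * y) + c * y ^ 2) := by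
    rw [e]
    exact add_nonneg (sq_nonneg _) (mul_nonneg (by linarith) (sq_nonneg _))
  exact nonneg_of_mul_nonneg_right h1 (by positivity)

/-- Points of a convex conic region cannot be much further away than the half-chord `μ`. -/
theorem cap_extent {μ r X h : ℝ} (ha : 0 < a) (hB : B ^ 2 ≤ 4 * a * c) (hμ : 0 < μ)
    (hμΔ : 4 * a ^ 2 * μ ^ 2 = D ^ 2 - 4 * a * F) (hF : F < 0) (hr : 0 < r) (hh : 0 < h)
    (h3 : c * r ^ 2 - E * r + F < 0)
    (hX : a * X ^ 2 + B * (X * h) + c * h ^ 2 + D * X + E * h + F ≤ 0) :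
    |X| * r ≤ 2 * μ * (h + r) := by
  have haF : 0 < a * -F := mul_pos ha (neg_pos.2 hF)
  have hDμ : |D| ≤ 2 * a * μ := by
    refine abs_le_of_sq_le_sq ?_ (by positivity)
    linarith [(by ring : (2 * a * μ) ^ 2 = 4 * a ^ 2 * μ ^ 2)]
  -- The segment from `(X, h)` to the inner point `(0, -r)` crosses height `0` at `Y`. By convexity
  -- `Y` is on the chord there, which has length `2 * μ` and also contains `0`.
  set Y := X * r / (h + r) with hY
  have hhr : 0 < h + r := by positivity
  have hYe : Y * (h + r) = X * r := by rw [hY]; field_simp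
  have hYq : a * Y ^ 2 + D * Y + F ≤ 0 := by
    have e1 : (h + r) ^ 2 * (a * Y ^ 2 + D * Y + F) =
        a * (Y * (h + r)) ^ 2 + D * (Y * (h + r)) * (h + r) + F * (h + r) ^ 2 := by ring
    rw [hYe] at e1
    have e : (h + r) ^ 2 * (a * Y ^ 2 + D * Y + F) + (h * r) * (a * X ^ 2 + B * (X * (h + r)) +
        c * (h + r) ^ 2) = (h + r) * (r * (a * X ^ 2 + B * (X * h) + c * h ^ 2 + D * X + E * h + F)
        + h * (c * r ^ 2 - E * r + F)) := by
      rw [e1]; ring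
    have hpsd := mul_nonneg (mul_pos hh hr).le (quad_nonneg_of_disc ha hB X (h + r))
    have hneg : (h + r) * (r * (a * X ^ 2 + B * (X * h) + c * h ^ 2 + D * X + E * h + F)
        + h * (c * r ^ 2 - E * r + F)) ≤ 0 :=
      mul_nonpos_of_nonneg_of_nonpos hhr.le (add_nonpos
        (mul_nonpos_of_nonneg_of_nonpos hr.le hX) (mul_nonpos_of_nonneg_of_nonpos hh.le h3.le))
    by_contra! hlt
    linarith [mul_pos (pow_pos hhr 2) hlt]
  have hYμ : |Y| ≤ 2 * μ := by
    have e1 : |2 * a * Y + D| ≤ 2 * a * μ := by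
      refine abs_le_of_sq_le_sq ?_ (by positivity)
      have e2 : (2 * a * Y + D) ^ 2 = 4 * a * (a * Y ^ 2 + D * Y + F) + (D ^ 2 - 4 * a * F) := by
        ring
      have e3 : 4 * a * (a * Y ^ 2 + D * Y + F) ≤ 0 :=
        mul_nonpos_of_nonneg_of_nonpos (by positivity) hYq
      linarith [(by ring : (2 * a * μ) ^ 2 = 4 * a ^ 2 * μ ^ 2)]
    have e2 : |2 * a * Y| ≤ 2 * a * (2 * μ) := by
      calc |2 * a * Y| = |(2 * a * Y + D) - D| := by ring_nf
        _ ≤ |2 * a * Y + D| + |D| := abs_sub _ _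
        _ ≤ 2 * a * (2 * μ) := by linarith
    rw [abs_mul, abs_of_pos (by positivity : (0 : ℝ) < 2 * a)] at e2
    exact le_of_mul_le_mul_left e2 (by positivity)
  have : |X| * r = |Y| * (h + r) := by
    have := congrArg abs hYe
    rw [abs_mul, abs_mul, abs_of_pos hr, abs_of_pos hhr] at this
    exact this.symm
  rw [this]; gcongr

/-- A conic region with a long chord at height `0` and a chord of length at most `T` at height `h₀`
has a thin cap above height `h₀`. -/
theorem cap_bound {T m r X h h₀ : ℝ} (ha : 0 < a) (hB : B ^ 2 ≤ 4 * a * c) (hm : 0 < m)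
    (hr : 0 < r) (hh₀ : 0 < h₀) (hh : h₀ < h) (hTm : T ^ 2 ≤ 2 * m ^ 2)
    (hdisc : chordDisc a B c D E F h₀ ≤ a ^ 2 * T ^ 2)
    (h1 : a * m ^ 2 + D * m + F < 0) (h2 : a * m ^ 2 - D * m + F < 0)
    (h3 : c * r ^ 2 - E * r + F < 0)
    (hX : a * X ^ 2 + B * (X * h) + c * h ^ 2 + D * X + E * h + F ≤ 0) :
    (1 - h₀ / h) * (|X| + h) ≤ T ^ 2 * (2 * h₀ + r) / (2 * m * r) + h₀ * T ^ 2 / (2 * m ^ 2) := by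
  have hh' : 0 < h := hh₀.trans hh
  have ham : 0 < a * m ^ 2 := by positivity
  have hF : a * m ^ 2 + F < 0 := by linarith
  set Δ := D ^ 2 - 4 * a * F with hΔ
  have hΔ' : chordDisc a B c D E F 0 = Δ := by simp only [hΔ, chordDisc]; ring
  have hΔm : 4 * a ^ 2 * m ^ 2 ≤ Δ := by
    have e1 : 0 < a * -(a * m ^ 2 + F) := mul_pos ha (by linarith)
    have e2 : Δ - 4 * a ^ 2 * m ^ 2 = D ^ 2 + 4 * (a * -(a * m ^ 2 + F)) := by rw [hΔ]; ring
    linarith [sq_nonneg D]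
  have hΔ0 : 0 < Δ := lt_of_lt_of_le (by positivity) hΔm
  -- Half the length of the chord at height `0`. It is at least `m` because the chord contains `±m`.
  set μ := √Δ / (2 * a) with hμ
  have hμΔ : 4 * a ^ 2 * μ ^ 2 = Δ := by
    rw [hμ, div_pow, Real.sq_sqrt hΔ0.le]; field_simp; norm_num
  have hμ0 : 0 < μ := by positivity
  have hmμ : m ≤ μ := by
    refine (pow_le_pow_iff_left₀ hm.le hμ0.le two_ne_zero).1 ?_
    have : 4 * a ^ 2 * m ^ 2 ≤ 4 * a ^ 2 * μ ^ 2 := by rw [hμΔ]; exact hΔm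
    exact le_of_mul_le_mul_left this (by positivity)
  -- The fraction of the segment from the origin to `(X, h)` that lies above height `h₀`. Concavity
  -- gives `θ * (2 * μ) ^ 2 ≤ T ^ 2`, which makes `θ` small enough to absorb the factor `μ` in the
  -- bound for `X`.
  set θ := 1 - h₀ / h with hθ
  have hθh : θ * h = h - h₀ := by rw [hθ]; field_simp
  have hθ0 : 0 ≤ θ := by
    rw [hθ, sub_nonneg, div_le_one hh']; exact hh.le
  have hdh : 0 ≤ chordDisc a B c D E F h := by
    have e1 := chordDisc_eq (a := a) (B := B) (c := c) (D := D) (E := E) (F := F) X h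
    have e2 := mul_nonpos_of_nonneg_of_nonpos (by positivity : 0 ≤ 4 * a) hX
    linarith [sq_nonneg (2 * a * X + (B * h + D))]
  have hconc := chordDisc_concave (a := a) (D := D) (E := E) (F := F) hB hh₀ hh hdh
  rw [hΔ'] at hconc
  have hθμ : θ * (4 * μ ^ 2) ≤ T ^ 2 := by
    have e1 : θ * h * Δ ≤ h * (a ^ 2 * T ^ 2) := by
      rw [hθh]; exact hconc.trans (by gcongr)
    rw [← hμΔ] at e1
    have e2 : (a ^ 2 * h) * (θ * (4 * μ ^ 2)) ≤ (a ^ 2 * h) * T ^ 2 := by linarith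
    exact le_of_mul_le_mul_left e2 (by positivity)
  have hθm : θ * (4 * m ^ 2) ≤ T ^ 2 := by
    refine le_trans ?_ hθμ
    gcongr
  have hθ2 : θ ≤ 1 / 2 := by
    have : θ * (4 * m ^ 2) ≤ 1 / 2 * (4 * m ^ 2) := by linarith
    exact le_of_mul_le_mul_right this (by positivity)
  have hh2 : h ≤ 2 * h₀ := by
    have := mul_le_mul_of_nonneg_right hθ2 hh'.le
    linarith
  have hXμ := cap_extent ha hB hμ0 hμΔ (by linarith) hr hh' h3 hX
  rw [mul_add]
  refine add_le_add ?_ ?_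
  · rw [le_div_iff₀ (by positivity)]
    calc θ * |X| * (2 * m * r) = θ * (2 * m) * (|X| * r) := by ring
      _ ≤ θ * (2 * μ) * (2 * μ * (h + r)) := by gcongr
      _ = θ * (4 * μ ^ 2) * (h + r) := by ring
      _ ≤ T ^ 2 * (2 * h₀ + r) := by gcongr
  · rw [le_div_iff₀ (by positivity)]
    calc θ * h * (2 * m ^ 2) = h * (θ * (4 * m ^ 2)) / 2 := by ring
      _ ≤ (2 * h₀) * T ^ 2 / 2 := by gcongr
      _ = h₀ * T ^ 2 := by ring

end Chord

/-! ### Five boundary points determine a bounded conic region -/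

section FivePoints

variable {k k' : Fin 6 → ℝ}

/-- A quadratic with three zeros on a line vanishes along it. The region would then be invariant in
that direction, hence unbounded. -/
theorem conic_not_three_on_line (hk : ∀ w, 0 ≤ conicQuad k w) {v p w : Plane} {L : ℝ}
    (hv : conic k v < 0) (hbdd : {p | conic k p < 0} ⊆ Metric.closedBall v L)
    (hw : w ≠ 0) {s t : ℝ} (hs : s ≠ 0) (ht : t ≠ 0) (hst : s ≠ t) (h0 : conic k p = 0)
    (h1 : conic k (p + s • w) = 0) (h2 : conic k (p + t • w) = 0) : False := by
  rw [conic_add_smul, h0, zero_add] at h1 h2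
  have e1 : conicDeriv k p w + s * conicQuad k w = 0 := by
    refine (mul_eq_zero.1 (?_ : s * _ = 0)).resolve_left hs
    linarith
  have e2 : conicDeriv k p w + t * conicQuad k w = 0 := by
    refine (mul_eq_zero.1 (?_ : t * _ = 0)).resolve_left ht
    linarith
  have e3 : conicQuad k w = 0 := by
    refine (mul_eq_zero.1 (?_ : (s - t) * _ = 0)).resolve_left (sub_ne_zero.2 hst)
    linarith
  have e4 : conicDeriv k p w = 0 := by rw [e3] at e1; linarith
  have h3 : v + ((|L| + 1) / ‖w‖) • w ∈ {p | conic k p < 0} := by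
    change conic k _ < 0
    rwa [conic_add_smul_of_quad_eq_zero hk e3 p, e4, mul_zero, add_zero]
  have h4 := hbdd h3
  rw [Metric.mem_closedBall, dist_eq_norm, add_sub_cancel_left, norm_smul, Real.norm_eq_abs,
    abs_of_pos (by positivity), div_mul_cancel₀ _ (norm_ne_zero_iff.2 hw)] at h4
  linarith [le_abs_self L]

/-- A bounded convex conic region is determined by five boundary points. -/
theorem conic_eq_of_five (hk : ∀ w, 0 ≤ conicQuad k w) {v : Plane} {L : ℝ}
    (hv : conic k v < 0) (hv' : conic k' v < 0)
    (hbdd : {p | conic k p < 0} ⊆ Metric.closedBall v L) {P : Fin 5 → Plane}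
    (hP : Function.Injective P) (h : ∀ i, conic k (P i) = 0) (h' : ∀ i, conic k' (P i) = 0) :
    {p | conic k p < 0} = {p | conic k' p < 0} := by
  have hno := fun {p w : Plane} (hw : w ≠ 0) {s t : ℝ} (hs : s ≠ 0) (ht : t ≠ 0) (hst : s ≠ t) h0 =>
    conic_not_three_on_line hk (p := p) hv hbdd hw hs ht hst h0
  set w := P 1 - P 0 with hw
  have hw0 : w ≠ 0 := sub_ne_zero.2 (hP.ne (by decide))
  set e : ℝ := conic k (P 0 + (1 / 2 : ℝ) • w) with he
  have hP1 : P 1 = P 0 + (1 : ℝ) • w := by rw [hw]; module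
  have he0 : e ≠ 0 := fun h0 => hno hw0 (s := 1) (t := 1 / 2) (by norm_num) (by norm_num)
    (by norm_num) (h 0) (hP1 ▸ h 1) h0
  -- The member `k' - l • k` of the pencil is made to vanish at the midpoint of `P 0` and `P 1`.
  -- With three zeros on that line it contains the line as a factor.
  set l : ℝ := conic k' (P 0 + (1 / 2 : ℝ) • w) / e with hl
  set k₂ := k' - l • k with hk₂
  have hk₂e : ∀ p, conic k₂ p = conic k' p - l * conic k p := fun p => by
    rw [hk₂, conic_sub, conic_smul]
  have hz : ∀ i, conic k₂ (P i) = 0 := fun i => by rw [hk₂e, h, h']; ring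
  have hzm : conic k₂ (P 0 + (1 / 2 : ℝ) • w) = 0 := by
    rw [hk₂e, ← he, hl, div_mul_cancel₀ _ he0, sub_self]
  have hz0 := hz 0
  have hz1 := hz 1
  rw [hP1, conic_add_smul, hz0] at hz1
  rw [conic_add_smul, hz0] at hzm
  have hq0 : conicQuad k₂ w = 0 := by linarith
  have hd0 : conicDeriv k₂ (P 0) w = 0 := by linarith
  obtain ⟨n, hf⟩ := IsFrame.exists_of_norm (u := ‖w‖⁻¹ • w) (by
    rw [norm_smul, norm_inv, norm_norm, inv_mul_cancel₀ (norm_ne_zero_iff.2 hw0)])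
  set u := ‖w‖⁻¹ • w with hu
  have hqu : conicQuad k₂ u = 0 := by
    have := conicQuad_comb k₂ w 0 ‖w‖⁻¹ 0
    rw [smul_zero, add_zero] at this
    rw [hu, this, hq0]; ring
  have hdu : conicDeriv k₂ (P 0) u = 0 := by rw [hu, conicDeriv_smul, hd0, mul_zero]
  set β := conicPolar k₂ u n
  set γ := conicQuad k₂ n
  set δ := conicDeriv k₂ (P 0) n
  have hform : ∀ x y : ℝ, conic k₂ (P 0 + (x • u + y • n)) = y * (β * x + γ * y + δ) := fun x y => by
    rw [conic_frame, hqu, hdu, hz0]; ring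
  set X : Fin 5 → ℝ := fun i => inner ℝ u (P i - P 0)
  set Y : Fin 5 → ℝ := fun i => inner ℝ n (P i - P 0)
  have hPe : ∀ i, P i = P 0 + (X i • u + Y i • n) := fun i => by
    rw [← hf.expand, add_sub_cancel]
  have hwu : w = ‖w‖ • u := by
    rw [hu, smul_smul, mul_inv_cancel₀ (norm_ne_zero_iff.2 hw0), one_smul]
  have hu0 : u ≠ 0 := norm_ne_zero_iff.1 (by rw [hf.norm_u]; norm_num)
  -- The other three points are off this line, so they are zeros of the second linear factor.
  have hYne : ∀ i, i ≠ 0 → i ≠ 1 → Y i ≠ 0 := by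
    intro i hi0 hi1 hY
    have e1 := hPe i
    rw [hY, zero_smul, add_zero] at e1
    have e2 : P 1 = P 0 + ‖w‖ • u := by rw [← hwu, hw]; abel
    refine hno hu0 (p := P 0) (s := ‖w‖) (t := X i) (norm_ne_zero_iff.2 hw0) ?_ ?_ (h 0) (e2 ▸ h 1)
      (e1 ▸ h i)
    · intro hX
      rw [hX, zero_smul, add_zero] at e1
      exact hi0 (hP e1)
    · intro hX
      rw [← hX, ← e2] at e1
      exact hi1 (hP e1)
  have hlin : ∀ i, i ≠ 0 → i ≠ 1 → β * X i + γ * Y i + δ = 0 := by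
    intro i hi0 hi1
    have := hz i
    rw [hPe i, hform] at this
    exact (mul_eq_zero.1 this).resolve_left (hYne i hi0 hi1)
  have l2 := hlin 2 (by decide) (by decide)
  have l3 := hlin 3 (by decide) (by decide)
  have l4 := hlin 4 (by decide) (by decide)
  -- If the second factor were not constant, its zero line would carry three boundary points.
  have hβγ : β = 0 ∧ γ = 0 := by
    by_contra hne
    have hsum : 0 < β ^ 2 + γ ^ 2 := by
      rcases not_and_or.1 hne with hb | hg
      · positivity
      · positivity
    set ω : Plane := γ • u + (-β) • n with hω
    have hω0 : ω ≠ 0 := by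
      rw [← norm_ne_zero_iff, ← pow_ne_zero_iff two_ne_zero, hω, hf.norm_sq]
      nlinarith
    have hdir : ∀ i, β * X i + γ * Y i + δ = 0 →
        P i = P 2 + ((γ * (X i - X 2) - β * (Y i - Y 2)) / (β ^ 2 + γ ^ 2)) • ω := by
      intro i hi
      have e1 : β * (X i - X 2) + γ * (Y i - Y 2) = 0 := by linarith
      obtain ⟨σ, hσ⟩ : ∃ σ, σ = (γ * (X i - X 2) - β * (Y i - Y 2)) / (β ^ 2 + γ ^ 2) := ⟨_, rfl⟩
      have e2 : X i = X 2 + σ * γ := by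
        rw [hσ]; field_simp
        linear_combination β * e1
      have e3 : Y i = Y 2 + σ * (-β) := by
        rw [hσ]; field_simp
        linear_combination γ * e1
      rw [← hσ, hPe i, hPe 2, hω, e2, e3]
      module
    have d3 := hdir 3 l3
    have d4 := hdir 4 l4
    refine hno hω0 (p := P 2) ?_ ?_ ?_ (h 2) (d3 ▸ h 3) (d4 ▸ h 4)
    · intro h0
      rw [h0, zero_smul, add_zero] at d3
      exact absurd (hP d3) (by decide)
    · intro h0
      rw [h0, zero_smul, add_zero] at d4
      exact absurd (hP d4) (by decide)
    · intro h0
      rw [h0, ← d4] at d3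
      exact absurd (hP d3) (by decide)
  have hδ : δ = 0 := by
    rw [hβγ.1, hβγ.2] at l2; linarith
  have hall : ∀ p, conic k' p = l * conic k p := by
    intro p
    have e1 := hform (inner ℝ u (p - P 0)) (inner ℝ n (p - P 0))
    rw [← hf.expand, add_sub_cancel, hβγ.1, hβγ.2, hδ, hk₂e] at e1
    linarith
  -- Both polynomials are negative at `v`, which fixes the sign.
  have hlpos : 0 < l := by
    have := hall v
    by_contra! hle
    nlinarith
  ext p
  simp only [mem_ofPred_eq, hall p]
  constructor
  · exact fun hp => mul_neg_of_pos_of_neg hlpos hp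
  · intro hp; by_contra! hle; linarith [mul_nonneg hlpos.le hle]

end FivePoints

end FlatSurface

namespace FlatSurface

/-! ### Long flat conics through a maximal strip -/

section Long

variable {X : Type*} [TopologicalSpace X] [T2Space X] {M : Type*} [MetricSpace M]
  [CompleteSpace M]
  {dev : X → Plane} {ι : X → M} {devM : M → Plane} {u n : Plane} {v : X} {S U : Set X}
  {a b T : ℝ} {k : Fin 6 → ℝ}

theorem abs_sub_le_of_sq_le {A T x y o z : ℝ} (hA : 0 < A) (hT : 0 ≤ T)
    (hx : (2 * A * (x - o) + z) ^ 2 ≤ A ^ 2 * T ^ 2)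
    (hy : (2 * A * (y - o) + z) ^ 2 ≤ A ^ 2 * T ^ 2) : |x - y| ≤ T := by
  rw [← mul_pow] at hx hy
  obtain ⟨i1, i2⟩ := abs_le.1 (abs_le_of_sq_le_sq hx (mul_nonneg hA.le hT))
  obtain ⟨i3, i4⟩ := abs_le.1 (abs_le_of_sq_le_sq hy (mul_nonneg hA.le hT))
  rw [abs_le]
  constructor
  · refine le_of_mul_le_mul_left ?_ hA
    linarith
  · refine le_of_mul_le_mul_left ?_ hA
    linarith

namespace FlatModel

theorem conic_coneOn (h : FlatModel dev ι devM) (hU : IsFlat dev U)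
    (hk : dev '' U = {p | conic k p < 0}) {ζ : M} (hζ : ζ ∈ coneOn ι U) :
    conic k (devM ζ) = 0 := by
  refine le_antisymm ?_ ?_
  · have hcl : IsClosed ((conic k) ⁻¹' Iic 0) := isClosed_Iic.preimage (continuous_conic_right k)
    have hsub : dev '' U ⊆ (conic k) ⁻¹' Iic 0 := by
      rw [hk]; exact fun p (hp : conic k p < 0) => hp.le
    exact closure_minimal hsub hcl (h.devM_mem_closure hζ.1)
  · have := h.devM_notMem hU hζ
    rw [hk] at this
    exact not_lt.1 this

/-- A flat conic that is much longer than its neighbouring maximal strip is high has all its cone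
points on one side of the strip on the border of the strip. -/
theorem coneOn_upper (h : FlatModel dev ι devM) (hS : IsPeriodicStrip dev u n v S a b T)
    {κ : ℝ} (hκ : ∀ ζ ∈ (range ι)ᶜ, ∀ w ∈ closure (ι '' S), inner ℝ n (devM w) = b →
      dist ζ w < κ → ζ ∈ closure (ι '' S))
    (hU : IsFlat dev U) (hvU : v ∈ U) (hk : dev '' U = {p | conic k p < 0})
    (hpos : ∀ w, 0 ≤ conicQuad k w) (hA : 0 < conicQuad k u) {m r : ℝ} (hm : 0 < m) (hr : 0 < r)
    (hTm : T ^ 2 ≤ 2 * m ^ 2)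
    (hmκ : T ^ 2 * (2 * (b - inner ℝ n (dev v)) + r) / (2 * m * r) +
      (b - inner ℝ n (dev v)) * T ^ 2 / (2 * m ^ 2) < κ)
    (h1 : conic k (dev v + m • u) < 0) (h2 : conic k (dev v + (-m) • u) < 0)
    (h3 : conic k (dev v + (-r) • n) < 0) :
    (∀ ζ ∈ coneOn ι U, inner ℝ n (devM ζ) ≤ b) ∧
    (∀ ζ ∈ coneOn ι U, ∀ ζ' ∈ coneOn ι U, inner ℝ n (devM ζ) = b → inner ℝ n (devM ζ') = b →
      dist (devM ζ) (devM ζ') ≤ T) ∧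
    {ζ | ζ ∈ coneOn ι U ∧ inner ℝ n (devM ζ) = b}.encard ≤ 2 := by
  have hf := hS.frame
  have hvS : v ∈ S := hS.maxStrip.mem
  have hSf : IsFlat dev S := hS.maxStrip.strip.1
  have hmeet : (U ∩ S).Nonempty := ⟨v, hvU, hvS⟩
  have hmeet' : (S ∩ U).Nonempty := ⟨v, hvS, hvU⟩
  set h₀ : ℝ := b - inner ℝ n (dev v) with hh₀
  have hh₀pos : 0 < h₀ := by
    have : dev v ∈ dev '' S := mem_image_of_mem _ hvS
    rw [hS.image_eq] at this
    exact sub_pos.2 this.2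
  set B := conicPolar k u n
  set c := conicQuad k n
  set D := conicDeriv k (dev v) u
  set E := conicDeriv k (dev v) n
  set F := conic k (dev v)
  set A := conicQuad k u
  have hexp : ∀ x y : ℝ, conic k (dev v + (x • u + y • n)) =
      A * x ^ 2 + B * (x * y) + c * y ^ 2 + D * x + E * y + F := fun x y => conic_frame k _ u n x y
  have hB : B ^ 2 ≤ 4 * A * c := conicPolar_sq_le hpos u n
  have hcoord : ∀ p : Plane, p = dev v + ((inner ℝ u p - inner ℝ u (dev v) : ℝ) • u +
      (inner ℝ n p - inner ℝ n (dev v) : ℝ) • n) := by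
    intro p
    conv_lhs => rw [hf.expand p]
    conv_rhs => rw [hf.expand (dev v)]
    rw [hf.inner_u, hf.inner_n]
    module
  -- The periodic cone points on the upper border cannot lie inside `U`, so the chord of `U` along
  -- the border has length at most `T`.
  have hdisc : chordDisc A B c D E F h₀ ≤ A ^ 2 * T ^ 2 := by
    obtain ⟨s, hs⟩ := h.exists_periodic_coneOn hS
    refine chordDisc_le (s := s - inner ℝ u (dev v)) hA hS.pos fun j => ?_
    obtain ⟨ζ, hζ, he⟩ := hs j
    have := h.devM_notMem_of_meets hSf hU hmeet' hζ
    rw [hk] at this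
    have h0 : 0 ≤ conic k (devM ζ) := not_lt.1 this
    rw [hcoord (devM ζ), hexp, he, hf.inner_u, hf.inner_n] at h0
    convert h0 using 4 <;> ring
  have h1' : A * m ^ 2 + D * m + F < 0 := by
    have := hexp m 0; rw [zero_smul, add_zero] at this; rw [this] at h1; linarith
  have h2' : A * m ^ 2 - D * m + F < 0 := by
    have := hexp (-m) 0; rw [zero_smul, add_zero] at this; rw [this] at h2; nlinarith
  have h3' : c * r ^ 2 - E * r + F < 0 := by
    have := hexp 0 (-r); rw [zero_smul, zero_add] at this; rw [this] at h3; nlinarith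
  -- A cone point at height `b` is an end of that chord, so its position is determined by a square
  -- root of the discriminant.
  have hkey : ∀ ζ ∈ coneOn ι U, inner ℝ n (devM ζ) = b →
      (2 * A * (inner ℝ u (devM ζ) - inner ℝ u (dev v)) + (B * h₀ + D)) ^ 2 =
        chordDisc A B c D E F h₀ := by
    intro ζ hζ hb
    have h0 := h.conic_coneOn hU hk hζ
    rw [hcoord (devM ζ), hexp, hb, ← hh₀] at h0
    have := chordDisc_eq (a := A) (B := B) (c := c) (D := D) (E := E) (F := F)
      (inner ℝ u (devM ζ) - inner ℝ u (dev v)) h₀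
    rw [h0, mul_zero] at this
    linarith
  refine ⟨?_, ?_, ?_⟩
  · intro ζ hζ
    by_contra! hlt
    set x := (inner ℝ u (devM ζ) - inner ℝ u (dev v) : ℝ) with hx
    set y := (inner ℝ n (devM ζ) - inner ℝ n (dev v) : ℝ) with hy
    have hylt : h₀ < y := by rw [hh₀, hy]; linarith
    have hypos : 0 < y := hh₀pos.trans hylt
    have hX : A * x ^ 2 + B * (x * y) + c * y ^ 2 + D * x + E * y + F ≤ 0 := by
      have h0 := h.conic_coneOn hU hk hζ
      rw [hcoord (devM ζ), hexp] at h0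
      exact h0.le
    have hcap := cap_bound hA hB hm hr hh₀pos hylt hTm hdisc h1' h2' h3' hX
    -- The segment from `v` to a cone point above the border crosses it inside `U`. By `cap_bound`
    -- the crossing is within `κ` of the cone point, which would therefore lie in the closure of
    -- `S`.
    have hw : AffineMap.lineMap (dev v) (devM ζ) (h₀ / y) ∈ dev '' U :=
      lineMap_mem_of_closure (hU.isOpen_image h.loc) hU.convex (mem_image_of_mem _ hvU)
        (h.devM_mem_closure hζ.1) (by positivity) ((div_lt_one hypos).2 hylt)
    obtain ⟨z, hzU, hz⟩ := hw
    have hzn : inner ℝ n (dev z) = b := by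
      rw [hz, AffineMap.lineMap_apply, vsub_eq_sub, vadd_eq_add, inner_add_right,
        inner_smul_right, inner_sub_right, ← hy, div_mul_cancel₀ _ hypos.ne']
      rw [hh₀]; ring
    have hzc : ι z ∈ closure (ι '' U) := subset_closure (mem_image_of_mem _ hzU)
    have hab := hS.lt
    have hzS : ι z ∈ closure (ι '' S) := h.mem_closure_of_meets hU hSf hmeet hzc (by
      rw [h.dev_eq, hS.closure_eq, hzn]; exact ⟨hab.le, le_rfl⟩)
    have hd : dist ζ (ι z) ≤ (1 - h₀ / y) * (|x| + y) := by
      rw [h.dist_eq_of_closure hU hζ.1 hzc, h.dev_eq, hz, dist_right_lineMap]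
      have hle : 0 ≤ 1 - h₀ / y := sub_nonneg.2 ((div_lt_one hypos).2 hylt).le
      rw [Real.norm_of_nonneg hle]
      refine mul_le_mul_of_nonneg_left ?_ hle
      have := hf.dist_le (dev v) (devM ζ)
      rw [abs_sub_comm, abs_sub_comm (inner ℝ n (dev v)), ← hx, ← hy, abs_of_pos hypos] at this
      exact this
    have hmem := hκ ζ hζ.2 (ι z) hzS (by rw [h.dev_eq, hzn]) (hd.trans_lt (hcap.trans_lt hmκ))
    exact absurd (hS.closure_eq.1 (h.devM_mem_closure hmem)).2 (not_le.2 hlt)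
  · intro ζ hζ ζ' hζ' hb hb'
    have e1 := hkey ζ hζ hb
    have e2 := hkey ζ' hζ' hb'
    have hd := hf.dist_le (devM ζ) (devM ζ')
    rw [hb, hb', sub_self, abs_zero, add_zero] at hd
    refine hd.trans ?_
    exact abs_sub_le_of_sq_le hA hS.pos.le (e1.trans_le hdisc) (e2.trans_le hdisc)
  · set d := chordDisc A B c D E F h₀
    refine (encard_le_encard_of_injOn (t := {√d, -√d}) (f := fun ζ =>
      2 * A * (inner ℝ u (devM ζ) - inner ℝ u (dev v)) + (B * h₀ + D)) ?_ ?_).trans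
      ((encard_insert_le _ _).trans (by rw [encard_singleton]; norm_num))
    · rintro ζ ⟨hζ, hb⟩
      have e := hkey ζ hζ hb
      have hd0 : 0 ≤ d := e ▸ sq_nonneg _
      rw [← Real.sq_sqrt hd0] at e
      exact sq_eq_sq_iff_eq_or_eq_neg.1 e
    · rintro ζ ⟨hζ, hb⟩ ζ' ⟨hζ', hb'⟩ he
      refine h.eq_of_closure hU hζ.1 hζ'.1 (hf.ext_iff.2 ⟨?_, hb.trans hb'.symm⟩)
      have he' : 2 * A * (inner ℝ u (devM ζ) - inner ℝ u (dev v)) =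
          2 * A * (inner ℝ u (devM ζ') - inner ℝ u (dev v)) := add_right_cancel he
      have := mul_left_cancel₀ (by positivity) he'
      linarith

/-- A cone point strictly between the borders would develop into the image of `S`, which `U` meets.
-/
theorem coneOn_height (h : FlatModel dev ι devM) (hS : IsPeriodicStrip dev u n v S a b T)
    (hU : IsFlat dev U) (hvU : v ∈ U) {ζ : M} (hζ : ζ ∈ coneOn ι U)
    (ha : a ≤ inner ℝ n (devM ζ)) (hb : inner ℝ n (devM ζ) ≤ b) :
    inner ℝ n (devM ζ) = a ∨ inner ℝ n (devM ζ) = b := by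
  by_contra! hne
  refine h.devM_notMem_of_meets hU hS.maxStrip.strip.1 ⟨v, hvU, hS.maxStrip.mem⟩ hζ ?_
  rw [hS.image_eq]
  exact ⟨lt_of_le_of_ne ha hne.1.symm, lt_of_le_of_ne hb hne.2⟩

/-- Cone points of `U` are on the borders of `S` and not all on one of them. The smaller strip `U`
therefore reaches both borders and fills `S`. -/
theorem eq_strip (h : FlatModel dev ι devM) (hS : IsPeriodicStrip dev u n v S a b T)
    (hU : IsStrip dev u U) (hvU : v ∈ U)
    (hnc : ∀ c, ∃ ζ ∈ coneOn ι U, inner ℝ n (devM ζ) ≠ c) : U = S := by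
  have hUS : U ⊆ S := hS.maxStrip.max U hU hvU
  refine hUS.antisymm fun x hx => ?_
  have hcl : ∀ ζ ∈ coneOn ι U, inner ℝ n (devM ζ) = a ∨ inner ℝ n (devM ζ) = b := by
    intro ζ hζ
    have := hS.closure_eq.1 (h.devM_mem_closure (closure_mono (image_mono hUS) hζ.1))
    exact h.coneOn_height hS hU.1 hvU hζ this.1 this.2
  have hxh : dev x ∈ dev '' S := mem_image_of_mem _ hx
  rw [hS.image_eq] at hxh
  have hcont : Continuous fun p : Plane => (inner ℝ n p : ℝ) := by fun_prop
  obtain ⟨ζ, hζ, hne⟩ := hnc b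
  obtain ⟨ζ', hζ', hne'⟩ := hnc a
  have ea := (hcl ζ hζ).resolve_right hne
  have eb := (hcl ζ' hζ').resolve_left hne'
  obtain ⟨p, hp, hpU⟩ := mem_closure_iff.1 (h.devM_mem_closure hζ.1) _
    (isOpen_Iio.preimage hcont) (show inner ℝ n (devM ζ) ∈ Iio (inner ℝ n (dev x) : ℝ) by
      rw [ea]; exact hxh.1)
  obtain ⟨q, hq, hqU⟩ := mem_closure_iff.1 (h.devM_mem_closure hζ'.1) _
    (isOpen_Ioi.preimage hcont) (show inner ℝ n (devM ζ') ∈ Ioi (inner ℝ n (dev x) : ℝ) by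
      rw [eb]; exact hxh.2)
  have : Nonempty X := ⟨v⟩
  have hw := mem_of_height_mem_uIcc hS.frame hU.1.convex hU.2 hpU hqU (w := dev x)
    (by rw [mem_uIcc]; exact Or.inl ⟨le_of_lt hp, le_of_lt hq⟩)
  exact hS.maxStrip.strip.1.mem_of_meets h.loc hU.1 ⟨v, hS.maxStrip.mem, hvU⟩ hx hw

/-- The dichotomy behind both finiteness results: far along the subsequence, a conic whose cone
points do not all lie on one line is the maximal strip itself or a long ellipse. The cone points of
the ellipse sit on the borders of `S`, at most two on each and at most `T` apart. -/
theorem exists_long_limit (h : FlatModel dev ι devM) {V : Set X} (hvV : v ∈ V) {r : ℝ}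
    (hr : 0 < r) (hV : dev '' V = Metric.ball (dev v) r) {U : ℕ → Set X} {κ : ℕ → Fin 6 → ℝ}
    (hU : ∀ j, IsFlat dev (U j)) (hVU : ∀ j, V ⊆ U j)
    (hκ : ∀ j, dev '' U j = {p | conic (κ j) p < 0})
    (hunb : ∀ L, ∀ᶠ j in atTop, ¬ dev '' U j ⊆ Metric.closedBall (dev v) L) :
    ∃ u n S a b T, IsPeriodicStrip dev u n v S a b T ∧ ∃ φ : ℕ → ℕ, StrictMono φ ∧
      ∀ᶠ j in atTop, (∀ w ≠ 0, ∀ c : ℝ, ∃ ζ ∈ coneOn ι (U (φ j)), inner ℝ w (devM ζ) ≠ c) →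
        U (φ j) = S ∨
        (∀ ζ ∈ coneOn ι (U (φ j)), inner ℝ n (devM ζ) = a ∨ inner ℝ n (devM ζ) = b) ∧
        (∀ ζ ∈ coneOn ι (U (φ j)), ∀ ζ' ∈ coneOn ι (U (φ j)),
          inner ℝ n (devM ζ) = (inner ℝ n (devM ζ') : ℝ) → dist (devM ζ) (devM ζ') ≤ T) ∧
        (coneOn ι (U (φ j))).encard ≤ 4 := by
  have : Nonempty X := ⟨v⟩
  obtain ⟨R, hR0, hR⟩ := h.exists_radius
  have hR' : ∀ j, ∀ c, ¬ Metric.closedBall c R ⊆ {p | conic (κ j) p < 0} := fun j c => by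
    rw [← hκ j]; exact hR _ (hU j) c
  have hconv : ∀ j, Convex ℝ {p | conic (κ j) p < 0} := fun j => by
    rw [← hκ j]; exact (hU j).convex
  obtain ⟨u, n, hf, φ, hφ, hlim⟩ := exists_strip_limit (v := dev v) hr hconv hR'
    (fun j => by rw [← hκ j, ← hV]; exact image_mono (hVU j))
    (fun L => by filter_upwards [hunb L] with j hj; rwa [← hκ j])
  have hvU : ∀ j, v ∈ U j := fun j => hVU j hvV
  set C : Set Plane := {p | |inner ℝ n (p - dev v)| < r} with hC
  have hCeq : C = (fun p : Plane => (inner ℝ n (p - dev v) : ℝ)) ⁻¹' Ioo (-r) r := by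
    ext p; rw [hC, mem_ofPred_eq, abs_lt]; rfl
  have hCo : IsOpen C := by
    rw [hCeq]; exact isOpen_Ioo.preimage (by fun_prop)
  have hCc : Convex ℝ C := by
    have : C = (innerₗ Plane n) ⁻¹' Ioo (inner ℝ n (dev v) - r) (inner ℝ n (dev v) + r) := by
      ext p
      simp only [hCeq, mem_preimage, inner_sub_right, mem_Ioo, innerₗ_apply_apply]
      constructor <;> rintro ⟨h1, h2⟩ <;> constructor <;> linarith
    rw [this]
    exact (convex_Ioo _ _).is_linear_preimage (innerₗ Plane n).isLinear
  -- The limit strip is realised in the surface by gluing the parts of the conics that lie over it.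
  -- They all contain `v`, and each point of `C` is eventually covered.
  set W : ℕ → Set X := fun j => U (φ j) ∩ dev ⁻¹' C
  have hvW : ∀ j, v ∈ W j := fun j => ⟨hvU _, by
    change |inner ℝ n (dev v - dev v)| < r; simpa using hr⟩
  have himg : dev '' ⋃ j, W j = C := by
    ext p
    constructor
    · rintro ⟨x, hx, rfl⟩
      obtain ⟨j, hj⟩ := mem_iUnion.1 hx
      exact hj.2
    · intro hp
      obtain ⟨j, hj⟩ := (hlim p hp).exists
      have : p ∈ dev '' U (φ j) := by rw [hκ]; exact hj
      obtain ⟨x, hx, rfl⟩ := this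
      exact ⟨x, mem_iUnion.2 ⟨j, hx, hp⟩, rfl⟩
  have hS₀ : IsStrip dev u (⋃ j, W j) := by
    refine ⟨isFlat_iUnion h.loc (fun j => (hU _).inter_preimage h.loc hCo hCc)
      (fun i j _ => ⟨v, hvW i, hvW j⟩) (by rw [himg]; exact hCc), ?_⟩
    rw [himg]
    intro p hp t
    change |_| < r
    rw [add_sub_right_comm, inner_add_right, inner_smul_right, hf.nu, mul_zero, add_zero]
    exact hp
  obtain ⟨S, a, b, T, hS⟩ := h.exists_isPeriodicStrip hf hS₀ (mem_iUnion.2 ⟨0, hvW 0⟩)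
  obtain ⟨κ₁, hκ₁, hiso₁⟩ := h.exists_border_isolation hS
  obtain ⟨κ₂, hκ₂, hiso₂⟩ := h.exists_border_isolation hS.neg
  refine ⟨u, n, S, a, b, T, hS, φ, hφ, ?_⟩
  have hlim0 : ∀ (h₀ r : ℝ), Tendsto (fun m : ℝ => T ^ 2 * (2 * h₀ + r) / (2 * m * r) +
      h₀ * T ^ 2 / (2 * m ^ 2)) atTop (𝓝 0) := by
    intro h₀ r
    have t1 : Tendsto (fun m : ℝ => m⁻¹) atTop (𝓝 0) := tendsto_inv_atTop_zero
    have t2 := ((t1.const_mul (T ^ 2 * (2 * h₀ + r) / (2 * r))).add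
      ((t1.pow 2).const_mul (h₀ * T ^ 2 / 2)))
    simp only [mul_zero, ne_eq, OfNat.ofNat_ne_zero, not_false_eq_true, zero_pow, add_zero] at t2
    refine t2.congr fun m => ?_
    rw [mul_right_comm 2 m r, ← div_div _ (2 * r) m, ← div_div _ 2 (m ^ 2), div_eq_mul_inv _ m,
      div_eq_mul_inv _ (m ^ 2), inv_pow]
  -- The half-length `m` brings the bound of `cap_bound` below the isolation constants of both
  -- borders. The condition `m ≥ T + 1` yields `T ^ 2 ≤ 2 * m ^ 2`.
  obtain ⟨m, hm1, hm2, hmT⟩ := (((hlim0 (b - inner ℝ n (dev v)) (r / 2)).eventually_lt_const hκ₁).and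
    (((hlim0 (-a - inner ℝ (-n) (dev v)) (r / 2)).eventually_lt_const hκ₂).and
      (eventually_ge_atTop (T + 1)))).exists
  have hT := hS.pos
  have hmpos : 0 < m := by linarith
  have hTm : T ^ 2 ≤ 2 * m ^ 2 := by nlinarith
  have hr2 : |r / 2| < r := by rw [abs_of_pos (by positivity)]; linarith
  have hlimu : ∀ t : ℝ, ∀ᶠ j in atTop, conic (κ (φ j)) (dev v + t • u) < 0 := fun t =>
    hlim (dev v + t • u) (by
      rw [add_sub_cancel_left, inner_smul_right, hf.nu, mul_zero, abs_zero]; exact hr)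
  have hlimn : ∀ t : ℝ, |t| < r → ∀ᶠ j in atTop, conic (κ (φ j)) (dev v + t • n) < 0 :=
    fun t ht =>
    hlim (dev v + t • n) (by rw [add_sub_cancel_left, inner_smul_right, hf.nn, mul_one]; exact ht)
  filter_upwards [hlimu m, hlimu (-m), hlimn (-(r / 2)) (by rwa [abs_neg]), hlimn (r / 2) hr2]
    with j j1 j2 j3 j4 hnc
  have hpos := conicQuad_nonneg (hconv (φ j)) (hR' (φ j))
  -- A null direction `u` makes the conic a strip, hence equal to `S`. Otherwise the cap estimate
  -- applies at the upper border and, with `-n`, at the lower one.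
  rcases (hpos u).eq_or_lt with hA | hA
  · left
    refine h.eq_strip hS ⟨hU _, fun p hp t => ?_⟩ (hvU _) fun c =>
      hnc n (by intro h0; have := hf.nn; simp [h0] at this) c
    rw [hκ] at hp ⊢
    change conic _ _ < 0
    rw [conic_add_smul_eq hpos (hR' _) hA.symm]
    exact hp
  · right
    obtain ⟨p1, p2, p3⟩ := h.coneOn_upper hS hiso₁ (hU _) (hvU _) (hκ _) hpos hA hmpos
      (half_pos hr) hTm hm1 j1 j2 j3
    obtain ⟨q1, q2, q3⟩ := h.coneOn_upper hS.neg hiso₂ (hU _) (hvU _) (hκ _) hpos hA hmpos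
      (half_pos hr) hTm hm2 j1 j2 (by rwa [smul_neg, neg_smul, neg_neg])
    simp only [inner_neg_left, neg_le_neg_iff, neg_inj] at q1 q2 q3
    have hh : ∀ ζ ∈ coneOn ι (U (φ j)), inner ℝ n (devM ζ) = a ∨ inner ℝ n (devM ζ) = b :=
      fun ζ hζ => h.coneOn_height hS (hU _) (hvU _) hζ (q1 ζ hζ) (p1 ζ hζ)
    refine ⟨hh, fun ζ hζ ζ' hζ' he => ?_, ?_⟩
    · rcases hh ζ hζ with e | e
      · exact q2 ζ hζ ζ' hζ' e (he ▸ e)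
      · exact p2 ζ hζ ζ' hζ' e (he ▸ e)
    · have hsub : coneOn ι (U (φ j)) ⊆ {ζ | ζ ∈ coneOn ι (U (φ j)) ∧ inner ℝ n (devM ζ) = a} ∪
          {ζ | ζ ∈ coneOn ι (U (φ j)) ∧ inner ℝ n (devM ζ) = b} := fun ζ hζ =>
        (hh ζ hζ).imp (fun e => ⟨hζ, e⟩) fun e => ⟨hζ, e⟩
      refine (encard_le_encard hsub).trans ((encard_union_le _ _).trans ?_)
      exact (add_le_add q3 p3).trans (by norm_num)

end FlatModel

end Long

end FlatSurface

namespace FlatSurface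

/-! ### Finiteness of rigid flat conics and of sets of cone points -/

section Finiteness

variable {X : Type*} [TopologicalSpace X] [T2Space X] {M : Type*} [MetricSpace M]
  [CompleteSpace M]
  {dev : X → Plane} {ι : X → M} {devM : M → Plane} {v : X} {V U U' : Set X}

theorem IsFlat.eq_of_image_eq (hl : IsLocalHomeomorph dev) (hU : IsFlat dev U)
    (hU' : IsFlat dev U') (hv : v ∈ U) (hv' : v ∈ U') (he : dev '' U = dev '' U') : U = U' := by
  have : Nonempty X := ⟨v⟩
  exact Subset.antisymm
    (fun x hx => hU.mem_of_meets hl hU' ⟨v, hv, hv'⟩ hx (he ▸ mem_image_of_mem _ hx))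
    (fun x hx => hU'.mem_of_meets hl hU ⟨v, hv', hv⟩ hx (he ▸ mem_image_of_mem _ hx))

theorem exists_injective_of_le_encard {α : Type*} {s : Set α} {m : ℕ} (hs : (m : ℕ∞) ≤ s.encard) :
    ∃ f : Fin m → α, Function.Injective f ∧ ∀ i, f i ∈ s := by
  obtain ⟨t, hts, ht⟩ := exists_subset_encard_eq hs
  have hfin : t.Finite := finite_of_encard_eq_coe ht
  have : Finite t := hfin
  have hc : Nat.card t = m := by
    rw [Nat.card_coe_set_eq, ncard_def, ht]; rfl
  exact ⟨fun i => ((Finite.equivFinOfCardEq hc).symm i : t),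
    Subtype.val_injective.comp (Equiv.injective _), fun i => hts (Subtype.mem _)⟩

theorem eventually_notMem_of_finite {α : Type*} {f : ℕ → α} (hf : Function.Injective f)
    {s : Set α} (hs : s.Finite) : ∀ᶠ j in atTop, f j ∉ s := by
  rw [← Nat.cofinite_eq_atTop]
  exact hf.tendsto_cofinite.eventually hs.compl_mem_cofinite

namespace FlatModel

theorem dist_devM_le (h : FlatModel dev ι devM) {L : ℝ}
    (hb : dev '' U ⊆ Metric.closedBall (dev v) L) {ζ : M} (hζ : ζ ∈ coneOn ι U) :
    dist (devM ζ) (dev v) ≤ L :=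
  closure_minimal hb Metric.isClosed_closedBall (h.devM_mem_closure hζ.1)

/-- Only finitely many rigid flat conics contain a given ball. -/
theorem finite_rigid (h : FlatModel dev ι devM) (hvV : v ∈ V) {r : ℝ}
    (hr : 0 < r) (hV : dev '' V = Metric.ball (dev v) r) :
    {U | IsFlat dev U ∧ V ⊆ U ∧ (∃ k, dev '' U = {p | conic k p < 0}) ∧
      5 ≤ (coneOn ι U).encard ∧
      ∀ w ≠ 0, ∀ c : ℝ, ∃ ζ ∈ coneOn ι U, inner ℝ w (devM ζ) ≠ c}.Finite := by
  set 𝒰 := {U | IsFlat dev U ∧ V ⊆ U ∧ (∃ k, dev '' U = {p | conic k p < 0}) ∧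
      5 ≤ (coneOn ι U).encard ∧
      ∀ w ≠ 0, ∀ c : ℝ, ∃ ζ ∈ coneOn ι U, inner ℝ w (devM ζ) ≠ c} with h𝒰
  obtain ⟨R, hR0, hR⟩ := h.exists_radius
  -- A bounded conic with at least five cone points is determined by its set of cone points, a
  -- subset of the finite visible set.
  have hbdd : ∀ L, {U | U ∈ 𝒰 ∧ dev '' U ⊆ Metric.closedBall (dev v) L}.Finite := by
    intro L
    refine Finite.of_injOn (f := coneOn ι) ?_ ?_ (h.finite_visible hvV hr hV L).powerset
    · rintro U ⟨hU, hb⟩ ζ hζ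
      exact ⟨⟨U, hU.1, hU.2.1, hζ⟩, h.dist_devM_le hb hζ⟩
    · rintro U ⟨⟨hU, hVU, ⟨k, hk⟩, h5, -⟩, hb⟩ U' ⟨⟨hU', hVU', ⟨k', hk'⟩, -, -⟩, -⟩ he
      obtain ⟨P, hP, hPm⟩ := exists_injective_of_le_encard (m := 5) h5
      have hpos : ∀ w, 0 ≤ conicQuad k w := conicQuad_nonneg (R := R) (hk ▸ hU.convex)
        fun c => hk ▸ hR U hU c
      refine hU.eq_of_image_eq h.loc hU' (hVU hvV) (hVU' hvV) ?_
      rw [hk, hk']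
      have hv1 : dev v ∈ dev '' U := mem_image_of_mem _ (hVU hvV)
      have hv2 : dev v ∈ dev '' U' := mem_image_of_mem _ (hVU' hvV)
      rw [hk] at hv1 hb
      rw [hk'] at hv2
      refine conic_eq_of_five hpos hv1 hv2 hb (P := devM ∘ P) ?_
        (fun i => h.conic_coneOn hU hk (hPm i)) fun i => h.conic_coneOn hU' hk' (he ▸ hPm i)
      exact fun i j hij => hP (h.eq_of_closure hU (hPm i).1 (hPm j).1 hij)
  by_contra hinf
  have hinj := (Set.Infinite.natEmbedding 𝒰 hinf).injective
  set W : ℕ → Set X := fun j => (Set.Infinite.natEmbedding 𝒰 hinf j : Set X) with hW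
  have hWinj : Function.Injective W := Subtype.val_injective.comp hinj
  have hWm : ∀ j, W j ∈ 𝒰 := fun j => Subtype.mem _
  choose κ hκ using fun j => (hWm j).2.2.1
  obtain ⟨u, n, S, a, b, T, hS, φ, hφ, hev⟩ := h.exists_long_limit hvV hr hV
    (fun j => (hWm j).1) (fun j => (hWm j).2.1) hκ fun L =>
      (eventually_notMem_of_finite hWinj (hbdd L)).mono fun j hj hb => hj ⟨hWm j, hb⟩
  have hne := eventually_notMem_of_finite (hWinj.comp hφ.injective) (finite_singleton S)
  obtain ⟨j, hj, hjne⟩ := (hev.and hne).exists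
  rcases hj (hWm _).2.2.2.2 with e | e
  · exact hjne e
  · exact absurd ((hWm (φ j)).2.2.2.1.trans e.2.2) (by norm_num)

/-- The flat conics that contain a given ball and have given cone points, not all on a line, on the
boundary, have finitely many sets of cone points. -/
theorem finite_coneOn (h : FlatModel dev ι devM) (hvV : v ∈ V) {r : ℝ}
    (hr : 0 < r) (hV : dev '' V = Metric.ball (dev v) r) {Z : Set M}
    (hZ : ∀ w ≠ 0, ∀ c : ℝ, ∃ ζ ∈ Z, inner ℝ w (devM ζ) ≠ c) :
    (coneOn ι '' {U | IsFlat dev U ∧ V ⊆ U ∧ (∃ k, dev '' U = {p | conic k p < 0}) ∧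
      Z ⊆ coneOn ι U}).Finite := by
  set 𝒰 := {U | IsFlat dev U ∧ V ⊆ U ∧ (∃ k, dev '' U = {p | conic k p < 0}) ∧
      Z ⊆ coneOn ι U} with h𝒰
  by_contra hinf
  have hinj := (Set.Infinite.natEmbedding _ hinf).injective
  choose W hWm hWe using fun j => (Set.Infinite.natEmbedding _ hinf j).2
  have hCinj : Function.Injective fun j => coneOn ι (W j) := by
    intro i j hij
    simp only [hWe] at hij
    exact hinj (Subtype.ext hij)
  -- The sets of cone points are pairwise distinct, and only finitely many are made of visible
  -- points within `L`.
  have hfin : ∀ L, ∀ᶠ j in atTop, ¬ ∀ ζ ∈ coneOn ι (W j), dist (devM ζ) (dev v) ≤ L := fun L =>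
    (eventually_notMem_of_finite hCinj (h.finite_visible hvV hr hV L).powerset).mono
      fun j hj hb => hj fun ζ hζ => ⟨⟨W j, (hWm j).1, (hWm j).2.1, hζ⟩, hb ζ hζ⟩
  choose κ hκ using fun j => (hWm j).2.2.1
  obtain ⟨u, n, S, a, b, T, hS, φ, hφ, hev⟩ := h.exists_long_limit hvV hr hV
    (fun j => (hWm j).1) (fun j => (hWm j).2.1) hκ fun L =>
      (hfin L).mono fun j hj hb => hj fun ζ hζ => h.dist_devM_le hb hζ
  have hne := eventually_notMem_of_finite (hCinj.comp hφ.injective) (finite_singleton (coneOn ι S))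
  have hev' := (hev.and hne).mono fun j hj =>
    (hj.1 fun w hw c => (hZ w hw c).imp fun ζ hζ => ⟨(hWm _).2.2.2 hζ.1, hζ.2⟩).resolve_left
      fun e => hj.2 (congrArg (coneOn ι) e)
  have hn0 : n ≠ 0 := by intro h0; have := hS.frame.nn; simp [h0] at this
  -- One point of `Z` off the upper border and one off the lower: in a long conic they lie on the
  -- lower and upper border respectively. Every other cone point is within `T` of one of them, which
  -- gives the bound `L`.
  obtain ⟨ζ₁, hζ₁, hne₁⟩ := hZ n hn0 b
  obtain ⟨ζ₂, hζ₂, hne₂⟩ := hZ n hn0 a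
  set L := T + dist (devM ζ₁) (dev v) + dist (devM ζ₂) (dev v) with hL
  obtain ⟨j, ⟨hj1, hj2, -⟩, hj⟩ := (hev'.and (hφ.tendsto_atTop.eventually (hfin L))).exists
  refine hj fun ζ hζ => ?_
  have m1 := (hWm (φ j)).2.2.2 hζ₁
  have m2 := (hWm (φ j)).2.2.2 hζ₂
  have e1 := (hj1 ζ₁ m1).resolve_right hne₁
  have e2 := (hj1 ζ₂ m2).resolve_left hne₂
  have d1 : 0 ≤ dist (devM ζ₁) (dev v) := dist_nonneg
  have d2 : 0 ≤ dist (devM ζ₂) (dev v) := dist_nonneg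
  rcases hj1 ζ hζ with e | e
  · have := hj2 ζ hζ ζ₁ m1 (e.trans e1.symm)
    linarith [dist_triangle (devM ζ) (devM ζ₁) (dev v)]
  · have := hj2 ζ hζ ζ₂ m2 (e.trans e2.symm)
    linarith [dist_triangle (devM ζ) (devM ζ₂) (dev v)]

end FlatModel

end Finiteness

end FlatSurface

namespace FlatSurface

/-! ### Separation by chords in a simply connected surface -/

section Separation

/-- Between two different odd values the intermediate value theorem would produce an even one. -/
theorem IsPreconnected.eq_of_odd {α : Type*} [TopologicalSpace α] {s : Set α}
    (hs : IsPreconnected s) {F : α → ℝ} (hF : ContinuousOn F s)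
    (hodd : ∀ x ∈ s, ∃ k : ℤ, F x = 2 * k + 1) {x y : α} (hx : x ∈ s) (hy : y ∈ s) :
    F x = F y := by
  wlog hle : F x < F y generalizing x y
  · rcases (not_lt.1 hle).eq_or_lt with h | h
    · exact h.symm
    · exact (this hy hx h).symm
  obtain ⟨k, hk⟩ := hodd x hx
  obtain ⟨l, hl⟩ := hodd y hy
  have hkl : k < l := by
    have : (k : ℝ) < l := by linarith
    exact_mod_cast this
  have hkl' : (k : ℝ) + 1 ≤ l := by exact_mod_cast hkl
  obtain ⟨z, hz, hzF⟩ := hs.intermediate_value hx hy hF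
    (show (2 * k + 2 : ℝ) ∈ Icc (F x) (F y) from ⟨by linarith, by linarith⟩)
  obtain ⟨m, hm⟩ := hodd z hz
  have : 2 * k + 2 = 2 * m + 1 := by exact_mod_cast hzF.symm.trans hm
  omega

/-- The determinant of two plane vectors. -/
def cross (p q : Plane) : ℝ := p 0 * q 1 - p 1 * q 0

theorem cross_expand {e f : Plane} (h : cross e f ≠ 0) (p : Plane) :
    p = (cross p f / cross e f) • e + (cross e p / cross e f) • f := by
  ext i
  fin_cases i
  · simp only [Fin.zero_eta, PiLp.add_apply, PiLp.smul_apply, smul_eq_mul]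
    field_simp
    unfold cross; ring
  · simp only [Fin.mk_one, PiLp.add_apply, PiLp.smul_apply, smul_eq_mul]
    field_simp
    unfold cross; ring

theorem cross_comb_left (e f : Plane) (x y : ℝ) : cross (x • e + y • f) f = x * cross e f := by
  simp only [cross, PiLp.add_apply, PiLp.smul_apply, smul_eq_mul]; ring

theorem cross_comb_right (e f : Plane) (x y : ℝ) : cross e (x • e + y • f) = y * cross e f := by
  simp only [cross, PiLp.add_apply, PiLp.smul_apply, smul_eq_mul]; ring

variable {X : Type*} [TopologicalSpace X] [T2Space X] {M : Type*} [MetricSpace M]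
  [CompleteSpace M]
  {dev : X → Plane} {ι : X → M} {devM : M → Plane} {U U₀ : Set X}

theorem IsFlat.isPreconnected (hl : IsLocalHomeomorph dev) (hU : IsFlat dev U) :
    IsPreconnected U := by
  rcases U.eq_empty_or_nonempty with rfl | ⟨x, hx⟩
  · exact isPreconnected_empty
  have : Nonempty X := ⟨x⟩
  have h1 := hU.convex.isPreconnected.image _
    (continuousOn_invFunOn_of_isLocalHomeomorph hl hU.isOpen hU.injOn)
  rwa [hU.injOn.invFunOn_image Subset.rfl] at h1

/-- A point of the closure of an open convex set, on the line of an open chord, is on the chord or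
an end of it. -/
theorem eq_or_of_mem_chord_line {D : Set Plane} (hD : IsOpen D) (hc : Convex ℝ D) {q e : Plane}
    (h0 : q ∉ D) (h1 : q + e ∉ D) (hch : ∀ t ∈ Ioo (0 : ℝ) 1, q + t • e ∈ D) {s : ℝ}
    (hs : q + s • e ∈ closure D) : q + s • e ∈ D ∨ q + s • e = q ∨ q + s • e = q + e := by
  have hhalf := hch (1 / 2) (by norm_num)
  rcases lt_trichotomy s 0 with hs0 | rfl | hs0
  · exfalso
    refine h0 ?_
    have hlt : 1 - 2 * s > 1 := by linarith
    have := FlatModel.lineMap_mem_of_closure hD hc hhalf hs (t := 1 / (1 - 2 * s))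
      (by positivity) ((div_lt_one (by linarith)).2 hlt)
    convert this using 1
    rw [AffineMap.lineMap_apply, vsub_eq_sub, vadd_eq_add, add_sub_add_left_eq_sub, ← sub_smul,
      smul_smul, add_left_comm, ← add_smul]
    have : 1 / (1 - 2 * s) * (s - 1 / 2) + 1 / 2 = 0 := by
      field_simp; ring
    rw [this, zero_smul, add_zero]
  · exact Or.inr (Or.inl (by simp))
  rcases lt_trichotomy s 1 with hs1 | rfl | hs1
  · exact Or.inl (hch s ⟨hs0, hs1⟩)
  · exact Or.inr (Or.inr (by simp))
  · exfalso
    refine h1 ?_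
    have hlt : 2 * s - 1 > 1 := by linarith
    have := FlatModel.lineMap_mem_of_closure hD hc hhalf hs (t := 1 / (2 * s - 1))
      (by positivity) ((div_lt_one (by linarith)).2 hlt)
    convert this using 1
    rw [AffineMap.lineMap_apply, vsub_eq_sub, vadd_eq_add, add_sub_add_left_eq_sub, ← sub_smul,
      smul_smul, add_left_comm, ← add_smul]
    have : 1 / (2 * s - 1) * (s - 1 / 2) + 1 / 2 = 1 := by
      field_simp; ring
    rw [this, one_smul]

namespace FlatModel

/-- A function that detects on which side of a chord of a flat set a path passes. -/
theorem exists_side_function [SimplyConnectedSpace X] [LocallyPathConnectedSpace X]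
    (h : FlatModel dev ι devM) (hU : IsFlat dev U) (hne : U.Nonempty)
    {t : Plane → ℝ} (ht : Continuous t)
    (hz : ∀ x, ι x ∈ closure (ι '' U) → dev x ∉ dev '' U → t (dev x) ≠ 0)
    (hD : (dev '' U)ᶜ.Nonempty) :
    ∃ F : X → ℝ, Continuous F ∧ (∀ x ∈ U, F x ≤ 1 ∧ (0 < F x ↔ 0 < t (dev x))) ∧
      ∀ x, x ∉ U → ∃ k : ℤ, F x = 2 * k + 1 := by
  classical
  set D := dev '' U with hDdef
  have hDo : IsOpen D := hU.isOpen_image h.loc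
  have hdevc : Continuous dev := h.loc.continuous
  set ρ : X → ℝ := fun x => Metric.infDist (dev x) Dᶜ with hρ
  have hρc : Continuous ρ := (Metric.continuous_infDist_pt _).comp hdevc
  have hρpos : ∀ x ∈ U, 0 < ρ x := fun x hx =>
    (hDo.isClosed_compl.notMem_iff_infDist_pos hD).1 (fun hn => hn (mem_image_of_mem _ hx))
  -- Near the part of the boundary of `U` that lies in `X`, the distance `ρ` to the complement tends
  -- to `0` while `t` does not. There `θ` is `1` or `-1`, according to the side of the chord.
  set θ : X → ℝ := fun x => max (-1) (min 1 (t (dev x) / ρ x)) with hθ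
  have hθc : ContinuousOn θ U := by
    refine ContinuousOn.sup continuousOn_const (ContinuousOn.inf continuousOn_const ?_)
    exact (ht.comp hdevc).continuousOn.div hρc.continuousOn fun x hx => (hρpos x hx).ne'
  -- Modulo `2` the two boundary values coincide, so `θ` extends continuously by the constant `1`.
  -- Simple connectedness then lifts the extension to a real function.
  set f : X → AddCircle (2 : ℝ) := fun x => if x ∈ U then (θ x : AddCircle (2 : ℝ)) else
    ((1 : ℝ) : AddCircle (2 : ℝ)) with hf
  have hneg : ((-1 : ℝ) : AddCircle (2 : ℝ)) = ((1 : ℝ) : AddCircle (2 : ℝ)) := by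
    have := AddCircle.coe_add_period (2 : ℝ) (-1)
    rw [← this]; norm_num
  have hfc : Continuous f := by
    rw [continuous_iff_continuousAt]
    intro x
    by_cases hx : x ∈ U
    · have hn := hU.isOpen.mem_nhds hx
      have : ContinuousAt (fun x => (θ x : AddCircle (2 : ℝ))) x :=
        (AddCircle.continuous_mk' (2 : ℝ)).continuousAt.comp (hθc.continuousAt hn)
      refine this.congr ?_
      filter_upwards [hn] with y hy
      rw [hf]; simp only [if_pos hy]
    · have key : ∀ᶠ y in 𝓝 x, f y = ((1 : ℝ) : AddCircle (2 : ℝ)) := by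
        by_cases hxc : x ∈ closure U
        · have hιx : ι x ∈ closure (ι '' U) := map_mem_closure h.continuous hxc
            (fun y hy => mem_image_of_mem _ hy)
          have hxD : dev x ∉ D := fun hd => by
            obtain ⟨y, hy, hyx⟩ := h.mem_image_of_closure hU hιx (by rw [h.dev_eq]; exact hd)
            exact hx (h.injective hyx ▸ hy)
          have ht0 := hz x hιx hxD
          have hρ0 : ρ x = 0 := Metric.infDist_zero_of_mem hxD
          have hev : ∀ᶠ y in 𝓝 x, ρ y < |t (dev y)| :=
            hρc.continuousAt.eventually_lt (ht.comp hdevc).abs.continuousAt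
              (by rw [hρ0]; exact abs_pos.2 ht0)
          filter_upwards [hev] with y hy
          simp only [hf]
          split_ifs with hyU
          · have hp := hρpos y hyU
            rcases lt_abs.1 hy with h1 | h1
            · have : θ y = 1 := by
                have : 1 ≤ t (dev y) / ρ y := (one_le_div hp).2 h1.le
                simp only [hθ, min_eq_left this]; norm_num
              rw [this]
            · have : θ y = -1 := by
                have : t (dev y) / ρ y ≤ -1 := (div_le_iff₀ hp).2 (by linarith)
                simp only [hθ]
                exact max_eq_left ((min_le_right _ _).trans this)
              rw [this, hneg]
          · rfl
        · filter_upwards [isClosed_closure.isOpen_compl.mem_nhds hxc] with y hy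
          simp only [hf, if_neg (fun hyU => hy (subset_closure hyU))]
      exact continuousAt_const.congr (key.mono fun y hy => hy.symm)
  obtain ⟨x₀, hx₀⟩ := hne
  obtain ⟨F, ⟨hF0, hF⟩, -⟩ := (AddCircle.isCoveringMap_coe (2 : ℝ)).existsUnique_continuousMap_lifts
    ⟨f, hfc⟩ x₀ (θ x₀) (by simp only [hf, ContinuousMap.coe_mk, if_pos hx₀])
  have hFf : ∀ x, ((F x : ℝ) : AddCircle (2 : ℝ)) = f x := fun x => congrFun hF x
  have hint : ∀ x y : ℝ, (x : AddCircle (2 : ℝ)) = y → ∃ k : ℤ, x - y = 2 * k := by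
    intro x y hxy
    have h0 : ((x - y : ℝ) : AddCircle (2 : ℝ)) = 0 := by
      rw [AddCircle.coe_sub, hxy, sub_self]
    obtain ⟨k, hk⟩ := (AddCircle.coe_eq_zero_iff (2 : ℝ)).1 h0
    exact ⟨k, by rw [← hk, zsmul_eq_mul, mul_comm]⟩
  have hFU : ∀ x ∈ U, F x = θ x := by
    intro x hx
    -- On `U` the lift differs from `θ` by even integers. Adding `1` makes the difference
    -- odd-valued, hence constant.
    have := IsPreconnected.eq_of_odd (hU.isPreconnected h.loc) (F := fun x => F x - θ x + 1)
      ((F.continuous.continuousOn.sub hθc).add continuousOn_const) (fun y hy => by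
        obtain ⟨k, hk⟩ := hint (F y) (θ y) (by rw [hFf]; simp only [hf, if_pos hy])
        exact ⟨k, by rw [hk]⟩) hx hx₀
    simp only [hF0] at this
    linarith
  refine ⟨F, F.continuous, fun x hx => ?_, fun x hx => ?_⟩
  · rw [hFU x hx]
    refine ⟨max_le (by norm_num) (min_le_left _ _), ?_⟩
    simp only [hθ, lt_max_iff, lt_min_iff, div_pos_iff_of_pos_right (hρpos x hx)]
    norm_num
  · obtain ⟨k, hk⟩ := hint (F x) 1 (by rw [hFf]; simp only [hf, if_neg hx])
    exact ⟨k, by linarith⟩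

/-- Along a path with `t ∘ dev` positive, `F` is in `(0, 1]` inside `U` and odd outside, so it never
takes the values `0` and `2`. The only odd value between them is `1`. -/
theorem side_function_eq_one {F : X → ℝ} (hF : Continuous F) {t : Plane → ℝ}
    (h1 : ∀ x ∈ U, F x ≤ 1 ∧ (0 < F x ↔ 0 < t (dev x)))
    (h2 : ∀ x, x ∉ U → ∃ k : ℤ, F x = 2 * k + 1) {x y : X} (hx : x ∈ U) (hy : y ∉ U)
    (hj : JoinedIn {z | 0 < t (dev z)} x y) : F y = 1 := by
  have hpos : 0 < F x := (h1 x hx).2.2 hj.mem.1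
  obtain ⟨γ, hγ⟩ := hj
  have hconn : IsPreconnected (range fun s => F (γ s)) :=
    isPreconnected_range (hF.comp γ.continuous)
  have hord := hconn.ordConnected
  have hxm : F x ∈ range fun s => F (γ s) := ⟨0, by simp⟩
  have hym : F y ∈ range fun s => F (γ s) := ⟨1, by simp⟩
  have hno : ∀ s, F (γ s) ≠ 0 ∧ F (γ s) ≠ 2 := by
    intro s
    by_cases hs : γ s ∈ U
    · have := (h1 _ hs).2.2 (hγ s)
      exact ⟨this.ne', by linarith [(h1 _ hs).1]⟩
    · obtain ⟨k, hk⟩ := h2 _ hs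
      rw [hk]
      constructor
      · intro h0
        have : 2 * k + 1 = 0 := by exact_mod_cast h0
        omega
      · intro h0
        have : 2 * k + 1 = 2 := by exact_mod_cast h0
        omega
  obtain ⟨k, hk⟩ := h2 y hy
  have hk0 : k = 0 := by
    by_contra hne
    rcases lt_or_gt_of_ne hne with hlt | hgt
    · have : (k : ℝ) ≤ -1 := by exact_mod_cast Int.le_sub_one_of_lt hlt
      obtain ⟨s, hs⟩ := hord.out hym hxm (show (0 : ℝ) ∈ Icc _ _ from ⟨by linarith, hpos.le⟩)
      exact (hno s).1 hs
    · have : (1 : ℝ) ≤ k := by exact_mod_cast hgt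
      obtain ⟨s, hs⟩ := hord.out hxm hym (show (2 : ℝ) ∈ Icc _ _ from
        ⟨by linarith [(h1 x hx).1], by linarith⟩)
      exact (hno s).2 hs
  rw [hk, hk0]; norm_num

theorem exists_joined_near (h : FlatModel dev ι devM) {ζ : M} (hζ : ζ ∈ closure (ι '' U₀))
    (hζ' : ζ ∈ closure (ι '' U)) {ε : ℝ} (hε : 0 < ε) :
    ∃ x ∈ U₀, ∃ y ∈ U, JoinedIn {z | dist (ι z) ζ < ε} x y := by
  obtain ⟨_, ⟨x, hx, rfl⟩, hxd⟩ := Metric.mem_closure_iff.1 hζ (ε / 4) (by positivity)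
  obtain ⟨_, ⟨y, hy, rfl⟩, hyd⟩ := Metric.mem_closure_iff.1 hζ' (ε / 4) (by positivity)
  refine ⟨x, hx, y, hy, (h.joined x y (ε / 2) ?_).mono fun z hz => ?_⟩
  · linarith [dist_triangle_left (ι x) (ι y) ζ]
  · change dist (ι x) (ι z) < ε / 2 at hz
    change dist (ι z) ζ < ε
    linarith [dist_triangle_left (ι z) ζ (ι x), dist_comm ζ (ι x)]

/-- In a simply connected surface, a flat set whose closure contains three cone points of a flat set
meets that set, if two chords between these points are inside. -/
theorem meets_of_three [SimplyConnectedSpace X] [LocallyPathConnectedSpace X]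
    (h : FlatModel dev ι devM) (hU₀ : IsFlat dev U₀) (hU : IsFlat dev U) {ζ ζ₁ ζ₂ : M}
    (hζ : ζ ∈ coneOn ι U₀) (hζ₁ : ζ₁ ∈ coneOn ι U₀) (hζ₂ : ζ₂ ∈ coneOn ι U₀)
    (hc : cross (devM ζ₁ - devM ζ) (devM ζ₂ - devM ζ) ≠ 0)
    (hch₁ : ∀ t ∈ Ioo (0 : ℝ) 1, devM ζ + t • (devM ζ₁ - devM ζ) ∈ dev '' U₀)
    (hch₂ : ∀ t ∈ Ioo (0 : ℝ) 1, devM ζ + t • (devM ζ₂ - devM ζ) ∈ dev '' U₀)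
    (h0 : ζ ∈ closure (ι '' U)) (h1 : ζ₁ ∈ closure (ι '' U)) (h2 : ζ₂ ∈ closure (ι '' U)) :
    (U ∩ U₀).Nonempty := by
  by_contra hemp
  have hdisj : ∀ y ∈ U, y ∉ U₀ := fun y hy hy' => hemp ⟨y, hy, hy'⟩
  set q := devM ζ with hq
  set e := devM ζ₁ - q with he
  set f := devM ζ₂ - q with hf
  have he' : devM ζ₁ = q + e := by rw [he]; abel
  have hf' : devM ζ₂ = q + f := by rw [hf]; abel
  set α : Plane → ℝ := fun p => cross (p - q) f / cross e f with hα
  set β : Plane → ℝ := fun p => cross e (p - q) / cross e f with hβ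
  have hαc : Continuous α := by unfold cross at hα; rw [hα]; fun_prop
  have hβc : Continuous β := by unfold cross at hβ; rw [hβ]; fun_prop
  have hexp : ∀ p, p = q + (α p • e + β p • f) := fun p => by
    have := cross_expand hc (p - q)
    rw [← this]; abel
  have hDo : IsOpen (dev '' U₀) := hU₀.isOpen_image h.loc
  have hq0 : q ∉ dev '' U₀ := h.devM_notMem hU₀ hζ
  have hne : U₀.Nonempty := by
    obtain ⟨x, hx, -⟩ := hch₁ (1 / 2) (by norm_num)
    exact ⟨x, hx⟩
  have hcompl : (dev '' U₀)ᶜ.Nonempty := ⟨q, hq0⟩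
  -- A boundary point of `U₀` in the surface cannot develop to the line of an inner chord: the open
  -- chord is in the image, its ends belong to cone points, and the rest of the line is outside the
  -- closure.
  have hzero : ∀ e' : Plane, ∀ ζ' ∈ coneOn ι U₀, devM ζ' = q + e' →
      (∀ t ∈ Ioo (0 : ℝ) 1, q + t • e' ∈ dev '' U₀) → ∀ x, ι x ∈ closure (ι '' U₀) →
      dev x ∉ dev '' U₀ → ∀ s : ℝ, dev x = q + s • e' → False := by
    intro e' ζ' hζ' hqe hch x hx hxD s hs
    have hcl : q + s • e' ∈ closure (dev '' U₀) := by
      rw [← hs, ← h.dev_eq]; exact h.devM_mem_closure hx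
    rcases eq_or_of_mem_chord_line hDo hU₀.convex hq0 (hqe ▸ h.devM_notMem hU₀ hζ') hch hcl
      with h3 | h3 | h3
    · exact hxD (hs ▸ h3)
    · have := h.eq_of_closure hU₀ hx hζ.1 (by rw [h.dev_eq, hs, h3])
      exact hζ.2 ⟨x, this⟩
    · have := h.eq_of_closure hU₀ hx hζ'.1 (by rw [h.dev_eq, hs, h3, hqe])
      exact hζ'.2 ⟨x, this⟩
  obtain ⟨F, hF, hF1, hF2⟩ := h.exists_side_function hU₀ hne hβc (fun x hx hxD hb =>
    hzero e ζ₁ hζ₁ he' hch₁ x hx hxD (α (dev x)) (by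
      conv_lhs => rw [hexp (dev x), hb, zero_smul, add_zero])) hcompl
  obtain ⟨G, hG, hG1, hG2⟩ := h.exists_side_function hU₀ hne hαc (fun x hx hxD hb =>
    hzero f ζ₂ hζ₂ hf' hch₂ x hx hxD (β (dev x)) (by
      conv_lhs => rw [hexp (dev x), hb, zero_smul, zero_add])) hcompl
  have hβ2 : 0 < β (devM ζ₂) := by
    have : β (devM ζ₂) = 1 := div_self hc
    rw [this]; exact one_pos
  have hα1 : 0 < α (devM ζ₁) := by
    have : α (devM ζ₁) = 1 := div_self hc
    rw [this]; exact one_pos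
  have hnear : ∀ {t : Plane → ℝ}, Continuous t → ∀ ζ' : M, 0 < t (devM ζ') → ∃ ε > 0,
      {z | dist (ι z) ζ' < ε} ⊆ {z | 0 < t (dev z)} := by
    intro t ht ζ' h0
    obtain ⟨ε, hε, hsub⟩ := Metric.mem_nhds_iff.1
      ((ht.comp h.continuous_devM).continuousAt.preimage_mem_nhds (Ioi_mem_nhds h0))
    refine ⟨ε, hε, fun z hz => ?_⟩
    have : 0 < t (devM (ι z)) := hsub hz
    rwa [h.dev_eq] at this
  have hUpre := hU.isPreconnected h.loc
  -- Near `ζ₂` the coordinate `β` is positive, so `F = 1` at some point of `U`. As `U` is connected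
  -- and assumed disjoint from `U₀`, `F` is constant on it. The vertex `ζ₁` does the same for `G`.
  have hFU : ∀ y ∈ U, F y = 1 := by
    obtain ⟨ε, hε, hsub⟩ := hnear hβc ζ₂ hβ2
    obtain ⟨x, hx, y, hy, hj⟩ := h.exists_joined_near hζ₂.1 h2 hε
    have := side_function_eq_one hF hF1 hF2 hx (hdisj y hy) (hj.mono hsub)
    intro z hz
    rw [← this]
    exact IsPreconnected.eq_of_odd hUpre hF.continuousOn (fun w hw => hF2 w (hdisj w hw)) hz hy
  have hGU : ∀ y ∈ U, G y = 1 := by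
    obtain ⟨ε, hε, hsub⟩ := hnear hαc ζ₁ hα1
    obtain ⟨x, hx, y, hy, hj⟩ := h.exists_joined_near hζ₁.1 h1 hε
    have := side_function_eq_one hG hG1 hG2 hx (hdisj y hy) (hj.mono hsub)
    intro z hz
    rw [← this]
    exact IsPreconnected.eq_of_odd hUpre hG.continuousOn (fun w hw => hG2 w (hdisj w hw)) hz hy
  have hαβ : 0 < (fun p => 1 - (α p + β p)) (devM ζ) := by
    have h3 : α q = 0 := by simp [hα, cross]
    have h4 : β q = 0 := by simp [hβ, cross]
    change 0 < 1 - (α q + β q)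
    rw [h3, h4]; norm_num
  obtain ⟨ε, hε, hsub⟩ := hnear (continuous_const.sub (hαc.add hβc)) ζ hαβ
  obtain ⟨x, hx, y, hy, ⟨γ, hγ⟩⟩ := h.exists_joined_near hζ.1 h0 hε
  -- Near the vertex `ζ`, where `α + β < 1`, follow a path from `U` to `U₀` up to the point `b`
  -- where it first reaches the closure of `U₀`. Until then both side functions keep the value `1`.
  set A : Set unitInterval := {s | γ (unitInterval.symm s) ∈ U₀} with hA
  have hγc : Continuous fun s => γ (unitInterval.symm s) :=
    γ.continuous.comp unitInterval.continuous_symm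
  have hAo : IsOpen A := hU₀.isOpen.preimage hγc
  have h1A : (1 : unitInterval) ∈ A := by simpa [hA] using hx
  have h0A : (0 : unitInterval) ∉ A := by simpa [hA] using hdisj y hy
  set s₀ := sInf A with hs₀
  have hs₀cl : s₀ ∈ closure A := sInf_mem_closure ⟨1, h1A⟩
  have hbefore : ∀ s, s < s₀ → s ∉ A := fun s hs hsA => not_le.2 hs (sInf_le hsA)
  have hs₀A : s₀ ∉ A := by
    intro hmem
    have hpos : 0 < s₀ := lt_of_le_of_ne bot_le (by rintro h3; exact h0A (h3 ▸ hmem))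
    obtain ⟨l, hl, hlsub⟩ := (mem_nhdsLE_iff_exists_Ioc_subset' hpos).1
      (mem_nhdsWithin_of_mem_nhds (hAo.mem_nhds hmem))
    obtain ⟨s, hs1, hs2⟩ := exists_between (mem_Iio.1 hl)
    exact hbefore s hs2 (hlsub ⟨hs1, hs2.le⟩)
  set b := γ (unitInterval.symm s₀) with hb
  have hoff : ∀ s ∈ Icc 0 s₀, γ (unitInterval.symm s) ∉ U₀ := fun s hs =>
    hs.2.lt_or_eq.elim (hbefore s) fun h3 => h3 ▸ hs₀A
  have hy0 : γ (unitInterval.symm 0) = y := by simp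
  have hFb : F b = 1 := by
    rw [← hFU y hy, ← hy0]
    exact IsPreconnected.eq_of_odd isPreconnected_Icc (hF.comp hγc).continuousOn
      (fun s hs => hF2 _ (hoff s hs)) (right_mem_Icc.2 bot_le) (left_mem_Icc.2 bot_le)
  have hGb : G b = 1 := by
    rw [← hGU y hy, ← hy0]
    exact IsPreconnected.eq_of_odd isPreconnected_Icc (hG.comp hγc).continuousOn
      (fun s hs => hG2 _ (hoff s hs)) (right_mem_Icc.2 bot_le) (left_mem_Icc.2 bot_le)
  have hbU : b ∉ U₀ := hs₀A
  have hbcl : b ∈ closure U₀ := map_mem_closure (f := fun s => γ (unitInterval.symm s)) hγc hs₀cl fun s hs => hs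
  -- A side function equal to `1` at `b` is positive nearby, so `b` is a limit of points of `U₀`
  -- with `t` positive.
  have hcl : ∀ {H : X → ℝ} {t : Plane → ℝ}, Continuous H → Continuous t →
      (∀ x ∈ U₀, H x ≤ 1 ∧ (0 < H x ↔ 0 < t (dev x))) → H b = 1 → 0 ≤ t (dev b) := by
    intro H t hH ht hHt hHb
    have hbcl' : b ∈ closure ({z | 0 < H z} ∩ U₀) :=
      (isOpen_Ioi (a := (0 : ℝ)).preimage hH).inter_closure
        ⟨by change (0 : ℝ) < H b; rw [hHb]; exact one_pos, hbcl⟩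
    have := map_mem_closure (t := Ioi (0 : ℝ)) (ht.comp h.loc.continuous) hbcl' fun z hz =>
      (hHt z hz.2).2.1 hz.1
    rwa [closure_Ioi] at this
  have hα0 := hcl hG hαc hG1 hGb
  have hβ0 := hcl hF hβc hF1 hFb
  have hsum : 0 < 1 - (α (dev b) + β (dev b)) := hsub (hγ _)
  have hιb : ι b ∈ closure (ι '' U₀) := map_mem_closure h.continuous hbcl
    (fun y hy => mem_image_of_mem _ hy)
  have hbD : dev b ∉ dev '' U₀ := fun hd => by
    obtain ⟨z, hz, hzb⟩ := h.mem_image_of_closure hU₀ hιb (by rw [h.dev_eq]; exact hd)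
    exact hbU (h.injective hzb ▸ hz)
  set a' := α (dev b)
  set b' := β (dev b)
  have hexpb : dev b = q + (a' • e + b' • f) := hexp (dev b)
  rcases hα0.eq_or_lt with ha | ha
  · exact hzero f ζ₂ hζ₂ hf' hch₂ b hιb hbD b' (by
      conv_lhs => rw [hexpb, ← ha, zero_smul, zero_add])
  rcases hβ0.eq_or_lt with hb | hb
  · exact hzero e ζ₁ hζ₁ he' hch₁ b hιb hbD a' (by
      conv_lhs => rw [hexpb, ← hb, zero_smul, add_zero])
  have hpos : 0 < a' + b' := add_pos ha hb
  -- Now `dev b` is strictly inside the triangle. It lies between the points of the two chords at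
  -- parameter `a' + b'`, hence in the convex image, although `b` is not in `U₀`.
  have hm1 := hch₁ (a' + b') ⟨hpos, by linarith⟩
  have hm2 := hch₂ (a' + b') ⟨hpos, by linarith⟩
  refine hbD ?_
  have := hU₀.convex hm1 hm2 (a := a' / (a' + b')) (b := b' / (a' + b')) (by positivity)
    (by positivity) (by rw [← add_div, div_self hpos.ne'])
  convert this using 1
  rw [hexpb, smul_add, smul_add, smul_smul, smul_smul, div_mul_cancel₀ _ hpos.ne',
    div_mul_cancel₀ _ hpos.ne', add_add_add_comm, ← add_smul, ← add_div, div_self hpos.ne',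
    one_smul]

end FlatModel

end Separation

end FlatSurface

namespace FlatSurface

/-! ### Triangles of cone points and closed cells -/

section Cells

theorem exists_smul_of_cross_eq_zero {e f : Plane} (he : e ≠ 0) (h : cross e f = 0) :
    ∃ s : ℝ, f = s • e := by
  unfold cross at h
  by_cases h0 : e 0 = 0
  · have h1 : e 1 ≠ 0 := fun h1 => he (by ext i; fin_cases i <;> simp [h0, h1])
    refine ⟨f 1 / e 1, ?_⟩
    have hf0 : f 0 = 0 := by
      rw [h0, zero_mul, zero_sub, neg_eq_zero] at h
      exact (mul_eq_zero.1 h).resolve_left h1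
    ext i
    fin_cases i
    · simp [h0, hf0]
    · simp [h1]
  · refine ⟨f 0 / e 0, ?_⟩
    ext i
    fin_cases i
    · simp [h0]
    · simp only [Fin.mk_one, PiLp.smul_apply, smul_eq_mul]
      field_simp
      linarith

/-- The closure of `D` contains the triangle, and an open convex set is the interior of its closure.
-/
theorem ball_subset_of_closure_triangle {D : Set Plane} (hD : IsOpen D) (hc : Convex ℝ D)
    {q e f : Plane} {c : Plane} {r : ℝ}
    (hT : Metric.ball c r ⊆ convexHull ℝ {q, q + e, q + f}) (hq : q ∈ closure D)
    (he : q + e ∈ closure D) (hf : q + f ∈ closure D) (hne : D.Nonempty) :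
    Metric.ball c r ⊆ D := by
  have h1 : convexHull ℝ {q, q + e, q + f} ⊆ closure D :=
    convexHull_min (by rintro _ (rfl | rfl | rfl) <;> assumption) hc.closure
  have h2 := interior_maximal (hT.trans h1) Metric.isOpen_ball
  rwa [hc.interior_closure_eq_interior_of_nonempty_interior (by rwa [hD.interior_eq]),
    hD.interior_eq] at h2

theorem exists_ball_subset_triangle {e f : Plane} (h : cross e f ≠ 0) (q : Plane) :
    ∃ c, ∃ r > 0, Metric.ball c r ⊆ convexHull ℝ {q, q + e, q + f} := by
  set α : Plane → ℝ := fun p => cross (p - q) f / cross e f with hα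
  set β : Plane → ℝ := fun p => cross e (p - q) / cross e f with hβ
  have hαc : Continuous α := by unfold cross at hα; rw [hα]; fun_prop
  have hβc : Continuous β := by unfold cross at hβ; rw [hβ]; fun_prop
  set c : Plane := q + ((1 / 3 : ℝ) • e + (1 / 3 : ℝ) • f) with hc
  have h1 : α c = 1 / 3 := by
    simp only [hα, hc, add_sub_cancel_left, cross_comb_left, mul_div_cancel_right₀ _ h]
  have h2 : β c = 1 / 3 := by
    simp only [hβ, hc, add_sub_cancel_left, cross_comb_right, mul_div_cancel_right₀ _ h]
  have hev : ∀ᶠ p in 𝓝 c, 0 < α p ∧ 0 < β p ∧ α p + β p < 1 := by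
    refine (hαc.continuousAt.eventually (lt_mem_nhds ?_)).and
      ((hβc.continuousAt.eventually (lt_mem_nhds ?_)).and
      ((hαc.add hβc).continuousAt.eventually (gt_mem_nhds ?_)))
    · rw [h1]; norm_num
    · rw [h2]; norm_num
    · change α c + β c < 1
      rw [h1, h2]; norm_num
  obtain ⟨r, hr, hsub⟩ := Metric.eventually_nhds_iff_ball.1 hev
  refine ⟨c, r, hr, fun p hp => ?_⟩
  obtain ⟨p1, p2, p3⟩ := hsub p hp
  have hexp : p = q + (α p • e + β p • f) := by
    have := cross_expand h (p - q)
    rw [← this]; abel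
  have hconv := convex_convexHull ℝ ({q, q + e, q + f} : Set Plane)
  have m0 : q ∈ convexHull ℝ ({q, q + e, q + f} : Set Plane) := subset_convexHull _ _ (by simp)
  have m1 : q + e ∈ convexHull ℝ ({q, q + e, q + f} : Set Plane) :=
    subset_convexHull _ _ (by simp)
  have m2 : q + f ∈ convexHull ℝ ({q, q + e, q + f} : Set Plane) :=
    subset_convexHull _ _ (by simp)
  have := hconv.sum_mem (t := Finset.univ) (w := ![1 - (α p + β p), α p, β p])
    (z := ![q, q + e, q + f]) (by
      intro i _; fin_cases i
      · change 0 ≤ 1 - (α p + β p); linarith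
      · exact p1.le
      · exact p2.le)
    (by simp [Fin.sum_univ_three]; ring)
    (by intro i _; fin_cases i <;> assumption)
  rw [Fin.sum_univ_three] at this
  convert this using 1
  conv_lhs => rw [hexp]
  simp only [Matrix.cons_val_zero, Matrix.cons_val_one, Matrix.cons_val]
  module

variable {X : Type*} [TopologicalSpace X] [T2Space X] {M : Type*} [MetricSpace M]
  [CompleteSpace M]
  {dev : X → Plane} {ι : X → M} {devM : M → Plane} {U U₀ : Set X} {k : Fin 6 → ℝ} {u n : Plane}
  {a b : ℝ}

namespace FlatModel

/-- Three cone points of `U` that span a triangle, with two sides inside `U`. -/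
def IsInnerTriple (dev : X → Plane) (ι : X → M) (devM : M → Plane) (U : Set X)
    (ζ ζ₁ ζ₂ : M) : Prop :=
  ζ ∈ coneOn ι U ∧ ζ₁ ∈ coneOn ι U ∧ ζ₂ ∈ coneOn ι U ∧
    cross (devM ζ₁ - devM ζ) (devM ζ₂ - devM ζ) ≠ 0 ∧
    (∀ t ∈ Ioo (0 : ℝ) 1, devM ζ + t • (devM ζ₁ - devM ζ) ∈ dev '' U) ∧
    (∀ t ∈ Ioo (0 : ℝ) 1, devM ζ + t • (devM ζ₂ - devM ζ) ∈ dev '' U)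

/-- Along a chord between two zeros the polynomial is `(t ^ 2 - t)` times a positive number:
negative inside the chord, with no third zero on its line. Any three cone points of an ellipse
therefore work. -/
theorem isInnerTriple_of_posDef (h : FlatModel dev ι devM) (hU : IsFlat dev U)
    (hk : dev '' U = {p | conic k p < 0}) (hpos : ∀ w ≠ 0, 0 < conicQuad k w) {ζ ζ₁ ζ₂ : M}
    (h0 : ζ ∈ coneOn ι U) (h1 : ζ₁ ∈ coneOn ι U) (h2 : ζ₂ ∈ coneOn ι U)
    (h01 : ζ ≠ ζ₁) (h02 : ζ ≠ ζ₂) (h12 : ζ₁ ≠ ζ₂) : IsInnerTriple dev ι devM U ζ ζ₁ ζ₂ := by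
  have hinj : ∀ {x y : M}, x ∈ coneOn ι U → y ∈ coneOn ι U → x ≠ y → devM y - devM x ≠ 0 :=
    fun hx hy hne he => hne (h.eq_of_closure hU hx.1 hy.1 (sub_eq_zero.1 he).symm)
  have hform : ∀ x ∈ coneOn ι U, ∀ y ∈ coneOn ι U, ∀ t : ℝ,
      conic k (devM x + t • (devM y - devM x)) =
        (t ^ 2 - t) * conicQuad k (devM y - devM x) := by
    intro x hx y hy t
    have e1 := conic_add_smul k (devM x) (devM y - devM x) 1
    rw [one_smul, add_sub_cancel, h.conic_coneOn hU hk hx, h.conic_coneOn hU hk hy] at e1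
    rw [conic_add_smul, h.conic_coneOn hU hk hx]
    linear_combination (-t) * e1
  have hch : ∀ {y : M}, y ∈ coneOn ι U → ζ ≠ y → ∀ t ∈ Ioo (0 : ℝ) 1,
      devM ζ + t • (devM y - devM ζ) ∈ dev '' U := by
    intro y hy hne t ht
    rw [hk]
    change conic k _ < 0
    rw [hform ζ h0 y hy]
    exact mul_neg_of_neg_of_pos (by nlinarith [ht.1, ht.2]) (hpos _ (hinj h0 hy hne))
  refine ⟨h0, h1, h2, fun hcr => ?_, hch h1 h01, hch h2 h02⟩
  obtain ⟨s, hs⟩ := exists_smul_of_cross_eq_zero (hinj h0 h1 h01) hcr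
  have e := hform ζ h0 ζ₁ h1 s
  rw [← hs, add_sub_cancel, h.conic_coneOn hU hk h2] at e
  have e2 : s ^ 2 - s = 0 :=
    (mul_eq_zero.1 e.symm).resolve_right (hpos _ (hinj h0 h1 h01)).ne'
  have e3 : s * (s - 1) = 0 := by linarith
  rcases mul_eq_zero.1 e3 with e4 | e4
  · rw [e4, zero_smul] at hs
    exact hinj h0 h2 h02 hs
  · rw [sub_eq_zero.1 e4, one_smul, sub_left_inj] at hs
    exact h12 (h.eq_of_closure hU h1.1 h2.1 hs.symm)

/-- Segments between opposite borders run inside the strip, so the apex `ζ` is taken on one border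
and the other two points on the opposite one. -/
theorem isInnerTriple_of_strip (h : FlatModel dev ι devM) (hU : IsFlat dev U)
    (hD : dev '' U = {p | a < inner ℝ n p ∧ inner ℝ n p < b}) {ζ ζ₁ ζ₂ : M}
    (h0 : ζ ∈ coneOn ι U) (h1 : ζ₁ ∈ coneOn ι U) (h2 : ζ₂ ∈ coneOn ι U) (h12 : ζ₁ ≠ ζ₂)
    {c c' : ℝ} (hcc : a < b ∧ (c = a ∧ c' = b ∨ c = b ∧ c' = a)) (hζ : inner ℝ n (devM ζ) = c)
    (hζ₁ : inner ℝ n (devM ζ₁) = c') (hζ₂ : inner ℝ n (devM ζ₂) = c') :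
    IsInnerTriple dev ι devM U ζ ζ₁ ζ₂ := by
  have hch : ∀ {y : M}, inner ℝ n (devM y) = c' → ∀ t ∈ Ioo (0 : ℝ) 1,
      devM ζ + t • (devM y - devM ζ) ∈ dev '' U := by
    intro y hy t ht
    rw [hD]
    change a < inner ℝ n _ ∧ inner ℝ n _ < b
    rw [inner_add_right, inner_smul_right, inner_sub_right, hy, hζ]
    obtain ⟨hab, ⟨rfl, rfl⟩ | ⟨rfl, rfl⟩⟩ := hcc <;> constructor <;> nlinarith [ht.1, ht.2]
  have hcc' : c' - c ≠ 0 := by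
    obtain ⟨hab, ⟨rfl, rfl⟩ | ⟨rfl, rfl⟩⟩ := hcc
    · exact sub_ne_zero.2 hab.ne'
    · exact sub_ne_zero.2 hab.ne
  refine ⟨h0, h1, h2, fun hcr => ?_, hch hζ₁, hch hζ₂⟩
  have hne : devM ζ₁ - devM ζ ≠ 0 := fun h3 => hcc' (by
    rw [← hζ₁, ← hζ, ← inner_sub_right, h3, inner_zero_right])
  obtain ⟨s, hs⟩ := exists_smul_of_cross_eq_zero hne hcr
  have e := congrArg (inner ℝ n) hs
  rw [inner_smul_right, inner_sub_right, inner_sub_right, hζ₁, hζ₂, hζ] at e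
  have : s = 1 := mul_right_cancel₀ hcc' (by rw [← e, one_mul])
  rw [this, one_smul, sub_left_inj] at hs
  exact h12 (h.eq_of_closure hU h1.1 h2.1 hs.symm)

/-- On the frontier the height takes only the values `a` and `b`, so it is constant on components.
The component of any point over the line of height `c` contains a cone point by `hcomp`. In a strip
this condition prevents all cone points from lying on a single line. -/
theorem exists_coneOn_height (h : FlatModel dev ι devM) (hf : IsFrame u n) (hU : IsFlat dev U)
    (hD : dev '' U = {p | a < inner ℝ n p ∧ inner ℝ n p < b}) (hab : a < b)
    (hcomp : ∀ z ∈ frontier (ι '' U),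
      (coneOn ι U ∩ connectedComponentIn (frontier (ι '' U)) z).Nonempty) {c : ℝ}
    (hc : c = a ∨ c = b) : ∃ ζ ∈ coneOn ι U, inner ℝ n (devM ζ) = c := by
  have hcont : Continuous fun m : M => (inner ℝ n (devM m) : ℝ) :=
    continuous_const.inner h.continuous_devM
  have hclD : ∀ p : Plane, p ∈ closure (dev '' U) ↔ inner ℝ n p ∈ Icc a b := by
    intro p
    constructor
    · intro hp
      exact closure_minimal (t := (fun p : Plane => (inner ℝ n p : ℝ)) ⁻¹' Icc a b)
        (by rw [hD]; exact fun q hq => ⟨hq.1.le, hq.2.le⟩)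
        (isClosed_Icc.preimage (by fun_prop)) hp
    · intro hp
      have hcont : Continuous fun y : ℝ => (inner ℝ u p : ℝ) • u + y • n := by fun_prop
      rw [← closure_Ioo hab.ne] at hp
      have h2 := map_mem_closure (t := dev '' U) hcont hp fun y hy => by
        rw [hD]
        change a < inner ℝ n _ ∧ inner ℝ n _ < b
        rw [hf.inner_n]; exact hy
      rwa [← hf.expand p] at h2
  have hfr : ∀ m ∈ frontier (ι '' U), inner ℝ n (devM m) = a ∨ inner ℝ n (devM m) = b := by
    intro m hm
    rw [(h.isOpenMap U hU.isOpen).frontier_eq] at hm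
    have h1 := (hclD _).1 (h.devM_mem_closure hm.1)
    by_contra! hne
    refine hm.2 (h.mem_image_of_closure hU hm.1 ?_)
    rw [hD]
    exact ⟨lt_of_le_of_ne h1.1 hne.1.symm, lt_of_le_of_ne h1.2 hne.2⟩
  have hcI : inner ℝ n (c • n) ∈ Icc a b := by
    rw [inner_smul_right, hf.nn, mul_one]
    rcases hc with rfl | rfl
    · exact left_mem_Icc.2 hab.le
    · exact right_mem_Icc.2 hab.le
  obtain ⟨m, hm, hmd⟩ := h.exists_mem_closure hU ((hclD _).2 hcI)
  have hmc : inner ℝ n (devM m) = c := by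
    rw [hmd, inner_smul_right, hf.nn, mul_one]
  have hmf : m ∈ frontier (ι '' U) := by
    rw [(h.isOpenMap U hU.isOpen).frontier_eq]
    refine ⟨hm, fun hmU => ?_⟩
    obtain ⟨x, hx, rfl⟩ := hmU
    have : dev x ∈ dev '' U := mem_image_of_mem _ hx
    rw [hD, ← h.dev_eq] at this
    have h3 : a < inner ℝ n (devM (ι x)) ∧ inner ℝ n (devM (ι x)) < b := this
    rw [hmc] at h3
    rcases hc with rfl | rfl
    · exact lt_irrefl _ h3.1
    · exact lt_irrefl _ h3.2
  obtain ⟨ζ, hζ, hζc⟩ := hcomp m hmf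
  refine ⟨ζ, hζ, ?_⟩
  have hpre := (isPreconnected_connectedComponentIn (F := frontier (ι '' U)) (x := m)).image _
    hcont.continuousOn
  have hsub : (fun m : M => (inner ℝ n (devM m) : ℝ)) ''
      connectedComponentIn (frontier (ι '' U)) m ⊆ {a, b} := by
    rintro _ ⟨z, hz, rfl⟩
    exact hfr z (connectedComponentIn_subset _ _ hz)
  have hss := (toFinite {a, b}).countable.isTotallyDisconnected _ hsub hpre
  exact (hss ⟨ζ, hζc, rfl⟩ ⟨m, mem_connectedComponentIn hmf, rfl⟩).trans hmc

theorem exists_isInnerTriple (h : FlatModel dev ι devM) (hU : IsFlat dev U)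
    (hk : dev '' U = {p | conic k p < 0}) (h3 : 3 ≤ (coneOn ι U).encard)
    (hcomp : ∀ z ∈ frontier (ι '' U),
      (coneOn ι U ∩ connectedComponentIn (frontier (ι '' U)) z).Nonempty) :
    ∃ ζ ζ₁ ζ₂, IsInnerTriple dev ι devM U ζ ζ₁ ζ₂ := by
  obtain ⟨P, hP, hPm⟩ := exists_injective_of_le_encard (m := 3) h3
  obtain ⟨R, hR0, hR⟩ := h.exists_radius
  have hnn := conicQuad_nonneg (R := R) (hk ▸ hU.convex) fun c => hk ▸ hR U hU c
  by_cases hpos : ∀ w ≠ 0, 0 < conicQuad k w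
  · exact ⟨P 0, P 1, P 2, h.isInnerTriple_of_posDef hU hk hpos (hPm 0) (hPm 1) (hPm 2)
      (hP.ne (by decide)) (hP.ne (by decide)) (hP.ne (by decide))⟩
  push Not at hpos
  obtain ⟨w, hw0, hw⟩ := hpos
  have hw' : conicQuad k w = 0 := le_antisymm hw (hnn w)
  have hnorm : ‖(‖w‖⁻¹) • w‖ = 1 := by
    rw [norm_smul, norm_inv, norm_norm, inv_mul_cancel₀ (norm_ne_zero_iff.2 hw0)]
  set u := (‖w‖⁻¹) • w with hu
  have hQu : conicQuad k u = 0 := by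
    have := conicQuad_comb k w 0 ‖w‖⁻¹ 0
    rw [smul_zero, add_zero, hw'] at this
    rw [hu, this]; ring
  obtain ⟨n, hf⟩ := IsFrame.exists_of_norm hnorm
  have hS : IsStrip dev u U := ⟨hU, fun p hp t => by
    rw [hk] at hp ⊢
    change conic _ _ < 0
    rw [conic_add_smul_eq hnn (fun c => hk ▸ hR U hU c) hQu]
    exact hp⟩
  obtain ⟨_, ⟨v, hv, rfl⟩⟩ : (ι '' U).Nonempty := closure_nonempty_iff.1 ⟨P 0, (hPm 0).1⟩
  obtain ⟨a, b, ha, hb, hD⟩ := h.exists_heights hf hS hv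
  have hab := ha.trans hb
  obtain ⟨ζa, hζa, hea⟩ := h.exists_coneOn_height hf hU hD hab hcomp (Or.inl rfl)
  obtain ⟨ζb, hζb, heb⟩ := h.exists_coneOn_height hf hU hD hab hcomp (Or.inr rfl)
  have hcone : ∀ ζ ∈ coneOn ι U, inner ℝ n (devM ζ) = a ∨ inner ℝ n (devM ζ) = b := by
    intro ζ hζ
    have h1 : inner ℝ n (devM ζ) ∈ Icc a b :=
      closure_minimal (t := (fun p : Plane => (inner ℝ n p : ℝ)) ⁻¹' Icc a b)
        (by rw [hD]; exact fun q hq => ⟨hq.1.le, hq.2.le⟩)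
        (isClosed_Icc.preimage (by fun_prop)) (h.devM_mem_closure hζ.1)
    by_contra! hne
    refine h.devM_notMem hU hζ ?_
    rw [hD]
    exact ⟨lt_of_le_of_ne h1.1 hne.1.symm, lt_of_le_of_ne h1.2 hne.2⟩
  obtain ⟨ζ, hζ, hza, hzb⟩ : ∃ ζ ∈ coneOn ι U, ζ ≠ ζa ∧ ζ ≠ ζb := by
    by_contra! hall
    have hsub : coneOn ι U ⊆ {ζa, ζb} := fun ζ hζ => by
      by_cases hz : ζ = ζa
      · exact Or.inl hz
      · exact Or.inr (hall ζ hζ hz)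
    have h2 : ({ζa, ζb} : Set M).encard ≤ 2 :=
      (encard_insert_le _ _).trans (by rw [encard_singleton]; norm_num)
    exact absurd (h3.trans ((encard_le_encard hsub).trans h2)) (by norm_num)
  rcases hcone ζ hζ with e | e
  · exact ⟨ζb, ζa, ζ, h.isInnerTriple_of_strip hU hD hζb hζa hζ hza.symm
      ⟨hab, Or.inr ⟨rfl, rfl⟩⟩ heb hea e⟩
  · exact ⟨ζa, ζb, ζ, h.isInnerTriple_of_strip hU hD hζa hζb hζ hzb.symm
      ⟨hab, Or.inl ⟨rfl, rfl⟩⟩ hea heb e⟩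

/-- Finiteness of the sets of cone points of the flat conics in a closed cell. -/
theorem finite_coneOn_of_cell [SimplyConnectedSpace X] [LocallyPathConnectedSpace X]
    (h : FlatModel dev ι devM) (hU₀ : IsFlat dev U₀) (hk : dev '' U₀ = {p | conic k p < 0})
    (h3 : 3 ≤ (coneOn ι U₀).encard)
    (hcomp : ∀ z ∈ frontier (ι '' U₀),
      (coneOn ι U₀ ∩ connectedComponentIn (frontier (ι '' U₀)) z).Nonempty) :
    (coneOn ι '' {U | IsFlat dev U ∧ (∃ k, dev '' U = {p | conic k p < 0}) ∧
      coneOn ι U₀ ⊆ coneOn ι U}).Finite := by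
  obtain ⟨ζ, ζ₁, ζ₂, h0, h1, h2, hcr, hch₁, hch₂⟩ := h.exists_isInnerTriple hU₀ hk h3 hcomp
  set q := devM ζ with hq
  obtain ⟨c, r, hr, hball⟩ := exists_ball_subset_triangle hcr q
  have hsub : ∀ U, IsFlat dev U → coneOn ι U₀ ⊆ coneOn ι U → Metric.ball c r ⊆ dev '' U := by
    intro U hU hUU
    refine ball_subset_of_closure_triangle (hU.isOpen_image h.loc) hU.convex hball
      (h.devM_mem_closure (hUU h0).1) ?_ ?_ ?_
    · rw [add_sub_cancel]; exact h.devM_mem_closure (hUU h1).1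
    · rw [add_sub_cancel]; exact h.devM_mem_closure (hUU h2).1
    · exact closure_nonempty_iff.1 ⟨_, h.devM_mem_closure (hUU h0).1⟩
  have hsub₀ := hsub U₀ hU₀ Subset.rfl
  obtain ⟨v, hv, hvc⟩ := hsub₀ (Metric.mem_ball_self hr)
  have : Nonempty X := ⟨v⟩
  subst hvc
  set V := U₀ ∩ dev ⁻¹' Metric.ball (dev v) r with hVdef
  have hV : dev '' V = Metric.ball (dev v) r := by
    rw [hVdef, image_inter_preimage]
    exact inter_eq_right.2 hsub₀
  -- A linear form constant on the three vertices vanishes on the two independent sides, so it is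
  -- zero.
  have hnc : ∀ w ≠ 0, ∀ c : ℝ, ∃ ζ ∈ coneOn ι U₀, inner ℝ w (devM ζ) ≠ c := by
    intro w hw c
    by_contra! hall
    have e1 : inner ℝ w (devM ζ₁ - q) = 0 := by
      rw [inner_sub_right, hall _ h1, hall _ h0, sub_self]
    have e2 : inner ℝ w (devM ζ₂ - q) = 0 := by
      rw [inner_sub_right, hall _ h2, hall _ h0, sub_self]
    have e3 : inner ℝ w w = (0 : ℝ) := by
      have e4 := congrArg (inner ℝ w) (cross_expand hcr w)
      rw [inner_add_right, inner_smul_right, inner_smul_right, e1, e2] at e4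
      rw [e4]; ring
    exact hw (inner_self_eq_zero.1 e3)
  refine (h.finite_coneOn (V := V) ⟨hv, Metric.mem_ball_self hr⟩ hr hV hnc).subset ?_
  refine image_mono ?_
  rintro U ⟨hU, hkU, hUU⟩
  refine ⟨hU, fun x hx => ?_, hkU, hUU⟩
  -- The developments of `U` and `U₀` both contain the disc. That the two sets meet ensures that
  -- they contain the same disc of the surface over it.
  have hmeet := h.meets_of_three hU₀ hU h0 h1 h2 hcr hch₁ hch₂ (hUU h0).1 (hUU h1).1 (hUU h2).1
  rw [inter_comm] at hmeet
  exact hU₀.mem_of_meets h.loc hU hmeet hx.1 (hsub U hU hUU hx.2)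

end FlatModel

end Cells

end FlatSurface

namespace FlatSurface

/-! ### Covering transformations, lifting of distances and completeness -/

section Coverings

variable {X Y Z : Type*} [TopologicalSpace X] [TopologicalSpace Y] [TopologicalSpace Z]

theorem t2Space_of_isCoveringMap [T2Space Y] {f : X → Y} (hf : IsCoveringMap f) : T2Space X := by
  refine ⟨fun x y hxy => ?_⟩
  by_cases h : f x = f y
  · exact hf.isSeparatedMap x y h hxy
  · obtain ⟨u, v, hu, hv, hxu, hyv, huv⟩ := t2_separation h
    exact ⟨f ⁻¹' u, f ⁻¹' v, hu.preimage hf.continuous, hv.preimage hf.continuous, hxu, hyv,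
      huv.preimage f⟩

/-- With the identity as second covering, `exists_deck` also covers the transformations of `p`
alone. -/
theorem isCoveringMap_id : IsCoveringMap fun x : X => x := fun x =>
  IsEvenlyCovered.to_isEvenlyCovered_preimage (I := Unit)
    ⟨inferInstance, univ, mem_univ x, isOpen_univ, isOpen_univ,
      (Homeomorph.prodPUnit (univ : Set X)).symm, fun _ => rfl⟩

theorem exists_lift_of_isCoveringMap_comp [SimplyConnectedSpace X] [LocallyPathConnectedSpace X]
    {p : X → Y} {π : Y → Z} (hp : IsCoveringMap p) (hπ : IsCoveringMap π) {x x' : X}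
    (h : π (p x) = π (p x')) :
    ∃ g : X → X, Continuous g ∧ (∀ z, π (p (g z)) = π (p z)) ∧ g x = x' := by
  obtain ⟨f, ⟨hf0, hf⟩, -⟩ := hπ.existsUnique_continuousMap_lifts
    ⟨fun z => π (p z), hπ.continuous.comp hp.continuous⟩ x (p x') h.symm
  obtain ⟨g, ⟨hg0, hg⟩, -⟩ := hp.existsUnique_continuousMap_lifts f x x' hf0.symm
  refine ⟨g, g.continuous, fun z => ?_, hg0⟩
  have h1 : p (g z) = f z := congrFun hg z
  rw [h1]
  exact congrFun hf z

theorem eq_id_of_isCoveringMap_comp [PreconnectedSpace X]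
    {p : X → Y} {π : Y → Z} (hp : IsCoveringMap p) (hπ : IsCoveringMap π) {g : X → X}
    (hg : Continuous g) (h : ∀ z, π (p (g z)) = π (p z)) {x : X} (hx : g x = x) : g = id := by
  have h1 : p ∘ g = p ∘ id := hπ.eq_of_comp_eq (hp.continuous.comp hg)
    (hp.continuous.comp continuous_id) (funext h) x (congrArg p hx)
  exact hp.eq_of_comp_eq hg continuous_id h1 x hx

/-- Covering transformations of a composition of two coverings, on a simply connected space, act
transitively on the fibres. -/
theorem exists_deck [SimplyConnectedSpace X] [LocallyPathConnectedSpace X]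
    {p : X → Y} {π : Y → Z} (hp : IsCoveringMap p) (hπ : IsCoveringMap π) {x x' : X}
    (h : π (p x) = π (p x')) :
    ∃ g : X ≃ₜ X, (∀ z, π (p (g z)) = π (p z)) ∧ g x = x' := by
  obtain ⟨g, hg, hgp, hgx⟩ := exists_lift_of_isCoveringMap_comp hp hπ h
  obtain ⟨g', hg', hgp', hgx'⟩ := exists_lift_of_isCoveringMap_comp hp hπ h.symm
  have e1 : g' ∘ g = id := eq_id_of_isCoveringMap_comp hp hπ (hg'.comp hg)
    (fun z => (hgp' _).trans (hgp z)) (x := x) (by rw [Function.comp_apply, hgx, hgx'])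
  have e2 : g ∘ g' = id := eq_id_of_isCoveringMap_comp hp hπ (hg.comp hg')
    (fun z => (hgp _).trans (hgp' z)) (x := x') (by rw [Function.comp_apply, hgx', hgx])
  exact ⟨⟨⟨g, g', congrFun e1, congrFun e2⟩, hg, hg'⟩, hgp, hgx⟩

variable [ChartedSpace Plane X] [ChartedSpace Plane Y] [ChartedSpace Plane Z]

theorem isTranslationMap_of_comp_eq {f : X → Y} (hf : IsTranslationMap f) {g : X → X}
    (hg : Continuous g) (h : ∀ z, f (g z) = f z) : IsTranslationMap g := by
  refine ⟨hg, fun e he e' he' x hx hx' => ?_⟩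
  obtain ⟨v, hv⟩ := hf.2 e he (chartAt Plane (f x)) (chart_mem_atlas _ _) x hx
    (mem_chart_source _ _)
  obtain ⟨w, hw⟩ := hf.2 e' he' (chartAt Plane (f x)) (chart_mem_atlas _ _) (g x) hx'
    (by rw [h]; exact mem_chart_source _ _)
  refine ⟨v - w, ?_⟩
  filter_upwards [hv, hg.continuousAt.eventually hw] with z h1 h2
  rw [h, h1] at h2
  rw [← add_sub_assoc, h2, add_sub_cancel_right]

theorem exists_eq_add_of_isTranslationMap [PreconnectedSpace X] {f g : X → Plane}
    (hf : IsTranslationMap f) (hg : IsTranslationMap g) : ∃ τ, ∀ x, f x = g x + τ := by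
  have hloc : IsLocallyConstant fun x => f x - g x := by
    rw [IsLocallyConstant.iff_eventually_eq]
    intro x
    obtain ⟨v, hv⟩ := hf.eventually_eq (chart_mem_atlas Plane x) (mem_chart_source _ _)
    obtain ⟨w, hw⟩ := hg.eventually_eq (chart_mem_atlas Plane x) (mem_chart_source _ _)
    filter_upwards [hv, hw] with z h1 h2
    rw [h1, h2, hv.self_of_nhds, hw.self_of_nhds]
    abel
  rcases isEmpty_or_nonempty X with he | ⟨⟨x₀⟩⟩
  · exact ⟨0, fun x => he.elim x⟩
  · refine ⟨f x₀ - g x₀, fun x => ?_⟩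
    rw [← hloc.apply_eq_of_preconnectedSpace x x₀]; abel

theorem isTranslationAut_of_comp_eq [PreconnectedSpace X] {dev : X → Plane}
    (hdev : IsTranslationMap dev) {f : X → Y} (hf : IsTranslationMap f) {g : X ≃ₜ X}
    (h : ∀ z, f (g z) = f z) : IsTranslationAut dev g :=
  exists_eq_add_of_isTranslationMap
    (hdev.comp (isTranslationMap_of_comp_eq hf g.continuous h)) hdev

theorem IsDevelopedCurve.congr {γ γ' : ℝ → X} {c : ℝ → Plane} {a b : ℝ}
    (h : IsDevelopedCurve γ c a b) (he : EqOn γ' γ (Icc a b)) : IsDevelopedCurve γ' c a b := by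
  refine ⟨h.le, h.continuousOn.congr he, fun t ht e hat hs => ?_⟩
  rw [he ht] at hs
  obtain ⟨v, hv⟩ := h.development t ht e hat hs
  refine ⟨v, ?_⟩
  filter_upwards [hv, self_mem_nhdsWithin] with u hu hm
  rw [he hm, hu]

/-- Flat distances lift to coverings. -/
theorem exists_lift_flatEDist_lt {f : X → Y} (hf : IsCoveringMap f) (hft : IsTranslationMap f)
    {x : X} {y : Y} {r : ENNReal} (h : flatEDist (f x) y < r) :
    ∃ x', f x' = y ∧ flatEDist x x' < r := by
  obtain ⟨γ, c, a, b, hγ, ha, hb, hr⟩ := exists_developedCurve_of_lt h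
  -- The curve is extended constantly to all of `ℝ`, a simply connected domain to which the lifting
  -- theorem applies.
  have hc : Continuous (IccExtend hγ.le ((Icc a b).domRestrict γ)) :=
    hγ.continuousOn.domRestrict.Icc_extend'
  have heq : EqOn (IccExtend hγ.le ((Icc a b).domRestrict γ)) γ (Icc a b) := fun t ht => by
    rw [IccExtend_of_mem _ _ ht]; rfl
  obtain ⟨Γ, ⟨hΓ0, hΓ⟩, -⟩ := hf.existsUnique_continuousMap_lifts
    ⟨IccExtend hγ.le ((Icc a b).domRestrict γ), hc⟩ a x (by
      change f x = IccExtend hγ.le ((Icc a b).domRestrict γ) a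
      rw [heq (left_mem_Icc.2 hγ.le), ha])
  have hΓf : ∀ t, f (Γ t) = IccExtend hγ.le ((Icc a b).domRestrict γ) t := fun t => congrFun hΓ t
  have hdevc : IsDevelopedCurve Γ c a b := IsDevelopedCurve.of_map hft Γ.continuous.continuousOn
    (hγ.congr fun t ht => (hΓf t).trans (heq ht))
  refine ⟨Γ b, ?_, (FlatSurface.flatEDist_le hdevc hΓ0 rfl).trans_lt hr⟩
  rw [hΓf, heq (right_mem_Icc.2 hγ.le), hb]

/-- If a covering is complete, so is the base; the completeness is expressed by the frontier. -/
theorem surfaceFrontier_nonempty_of_lift {f : X → Y} (hf : IsTranslationMap f)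
    (hlift : ∀ (x : X) (y : Y) (r : ENNReal), flatEDist (f x) y < r →
      ∃ x', f x' = y ∧ flatEDist x x' < r) (hsurj : Function.Surjective f)
    (hY : (surfaceFrontier Y).Nonempty) : (surfaceFrontier X).Nonempty := by
  by_contra hX
  have hall : ∀ m : FlatCompletion X, m ∈ range (toCompletion (X := X)) := fun m => by
    by_contra hm
    exact hX ⟨m, hm⟩
  have hcomplete : CompleteSpace (FlatMetric Y) := by
    refine EMetric.complete_of_convergent_controlled_sequences (fun n => 1 / 2 ^ n)
      (fun n => ENNReal.div_pos one_ne_zero (by simp)) fun u hu => ?_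
    obtain ⟨x₀, hx₀⟩ := hsurj (u 0)
    -- A sequence with steps below `2⁻ⁿ` lifts point by point to one with the same step bounds. The
    -- lift is Cauchy, so it converges in the complete cover, and its limit projects to a limit
    -- downstairs.
    have step : ∀ (n : ℕ) (s : {x : X // f x = u n}), ∃ s' : {x : X // f x = u (n + 1)},
        flatEDist s.1 s'.1 < 1 / 2 ^ n := by
      rintro n ⟨x, hx⟩
      obtain ⟨x', h1, h2⟩ := hlift x (u (n + 1)) (1 / 2 ^ n) (by
        rw [hx]; exact hu n n (n + 1) le_rfl n.le_succ)
      exact ⟨⟨x', h1⟩, h2⟩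
    choose next hnext using step
    set s : ∀ n, {x : X // f x = u n} := fun n => Nat.rec ⟨x₀, hx₀⟩ (fun n t => next n t) n with hs
    have hsn : ∀ n, flatEDist (s n).1 (s (n + 1)).1 < 1 / 2 ^ n := fun n => hnext n (s n)
    let σ : ℕ → FlatMetric X := fun n => (s n).1
    have hcau : CauchySeq σ :=
      cauchySeq_of_edist_le_geometric_two 1 ENNReal.one_ne_top fun n => (hsn n).le
    have hcau' := hcau.map (UniformSpace.Completion.uniformContinuous_coe (FlatMetric X))
    obtain ⟨m, hm⟩ := cauchySeq_tendsto_of_complete hcau'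
    obtain ⟨x, rfl⟩ := hall m
    let x' : FlatMetric X := x
    have hx : Tendsto σ atTop (𝓝 x') :=
      ((UniformSpace.Completion.isUniformInducing_coe (FlatMetric X)).isInducing.tendsto_nhds_iff).2
        hm
    let y' : FlatMetric Y := f x
    have hy : Tendsto u atTop (𝓝 y') := by
      rw [tendsto_iff_edist_tendsto_0] at hx ⊢
      refine tendsto_of_tendsto_of_tendsto_of_le_of_le tendsto_const_nhds hx
        (fun n => zero_le) fun n => ?_
      have h1 := hf.flatEDist_le (s n).1 x
      rw [(s n).2] at h1
      exact h1
    exact ⟨y', hy⟩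
  obtain ⟨m, hm⟩ := hY
  apply hm
  have hcl : IsClosed (range (UniformSpace.Completion.coe' (α := FlatMetric Y))) :=
    ((UniformSpace.Completion.isUniformInducing_coe (FlatMetric Y)).isComplete_range).isClosed
  have hd := (UniformSpace.Completion.denseRange_coe (α := FlatMetric Y)) m
  rwa [hcl.closure_eq] at hd

end Coverings

end FlatSurface

namespace FlatSurface

/-! ### Subconics are flat, and the completion is a flat model -/

section Instantiation

theorem surjective_of_isCoveringMap {X Y : Type*} [TopologicalSpace X] [TopologicalSpace Y]
    [PreconnectedSpace Y] [Nonempty X] {f : X → Y} (hf : IsCoveringMap f) :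
    Function.Surjective f := by
  have hopen : IsOpen (range f) := hf.isLocalHomeomorph.isOpenMap.isOpen_range
  have hclosed : IsClosed (range f) := by
    rw [← isOpen_compl_iff, isOpen_iff_mem_nhds]
    intro x hx
    obtain ⟨-, U, hxU, hU, -, H, -⟩ := hf x
    filter_upwards [hU.mem_nhds hxU] with y hy hyr
    obtain ⟨e, rfl⟩ := hyr
    exact hx ⟨(H ⟨e, hy⟩).2.1, (H ⟨e, hy⟩).2.2⟩
  exact range_eq_univ.1 (IsClopen.eq_univ ⟨hclosed, hopen⟩ (range_nonempty f))

variable {X Y : Type*} [TopologicalSpace X] [ChartedSpace Plane X]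
  [TopologicalSpace Y] [ChartedSpace Plane Y] {dev : X → Plane}

theorem JoinedByGeodesicIn.exists_dev_eq {A : Set X} {x x' : X} (hdev : IsTranslationMap dev)
    (h : JoinedByGeodesicIn A x x') : ∃ (γ : ℝ → X) (w : Plane), ContinuousOn γ (Icc 0 1) ∧
      γ 0 = x ∧ γ 1 = x' ∧ MapsTo γ (Icc 0 1) A ∧
      ∀ t ∈ Icc (0 : ℝ) 1, dev (γ t) = dev x + t • w := by
  obtain ⟨γ, w, hγ, h0, h1, hm, hloc⟩ := h
  have hdc : IsDevelopedCurve γ (fun t : ℝ => t • w) 0 1 := by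
    refine ⟨zero_le_one, hγ, fun t ht e he hs => ⟨t • w - e (γ t), ?_⟩⟩
    filter_upwards [hloc t ht e he hs] with u hu
    rw [hu, sub_smul]; abel
  obtain ⟨k, hk⟩ := hdc.exists_eq_add hdev
  refine ⟨γ, w, hγ, h0, h1, hm, fun t ht => ?_⟩
  have e0 := hk 0 (left_mem_Icc.2 zero_le_one)
  have et := hk t ht
  rw [h0, zero_smul] at e0
  rw [et, add_left_comm, ← e0, add_zero]

/-- Geodesics in `U` develop to straight segments, so the image is convex. Injectivity and openness
follow by comparing `U` with a small flat ball. -/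
theorem IsLiftedSubconic.isFlat [T2Space X] (hdev : IsTranslationMap dev) {U : Set X}
    (hU : IsLiftedSubconic dev U) : IsFlat dev U := by
  obtain ⟨hc, q, hq⟩ := hU
  obtain ⟨k, hk⟩ := exists_conic q
  have hl := hdev.isLocalHomeomorph
  have hDo : IsOpen (dev '' U) := by
    rw [hq, hk]; exact isOpen_Iio.preimage (continuous_conic_right k)
  -- The geodesic in `U` from `x` to `y` develops to a segment in the convex image of `B`, so it
  -- cannot leave `B`.
  have hstay : ∀ {B : Set X} {x y : X}, IsFlat dev B → x ∈ B → dev y ∈ dev '' B → x ∈ U → y ∈ U →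
      y ∈ B := by
    intro B x y hB hxB hyB hx hy
    have : Nonempty X := ⟨x⟩
    obtain ⟨γ, w, hγ, h0, h1, -, hd⟩ := (hc x hx y hy).exists_dev_eq hdev
    have hw : dev y = dev x + w := by
      rw [← h1, hd 1 (right_mem_Icc.2 zero_le_one), one_smul]
    have := mapsTo_of_mapsTo_dev hl hB.isOpen hB.injOn isPreconnected_Icc hγ
      (left_mem_Icc.2 zero_le_one) (h0 ▸ hxB) fun t ht => by
        have hseg := hB.convex.lineMap_mem (mem_image_of_mem _ hxB) hyB ht
        rw [hd t ht]
        rwa [AffineMap.lineMap_apply, hw, vsub_eq_sub, add_sub_cancel_left, vadd_eq_add,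
          add_comm] at hseg
    rw [← h1]
    exact this (right_mem_Icc.2 zero_le_one)
  refine ⟨?_, ?_, ?_⟩
  · rw [isOpen_iff_mem_nhds]
    intro x hx
    obtain ⟨r, hr, B, hBU, hB, hxB, -⟩ := exists_flat_ball_subset hl
      ((hDo.preimage hl.continuous).mem_nhds (mem_image_of_mem dev hx))
    filter_upwards [hB.isOpen.mem_nhds hxB] with y hy
    obtain ⟨y', hy', he⟩ := hBU hy
    have := hstay hB hxB (he ▸ mem_image_of_mem _ hy) hx hy'
    rwa [← hB.injOn this hy he]
  · intro x hx y hy he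
    obtain ⟨r, hr, B, hB, hxB, -⟩ := exists_flat_ball hl x
    have := hstay hB hxB (he ▸ mem_image_of_mem _ hxB) hx hy
    exact hB.injOn hxB this he
  · rintro _ ⟨x, hx, rfl⟩ _ ⟨y, hy, rfl⟩ s t hs ht hst
    obtain ⟨γ, w, hγ, h0, h1, hm, hd⟩ := (hc x hx y hy).exists_dev_eq hdev
    have hw : dev y = dev x + w := by
      rw [← h1, hd 1 (right_mem_Icc.2 zero_le_one), one_smul]
    have htI : t ∈ Icc (0 : ℝ) 1 := ⟨ht, by linarith⟩
    refine ⟨γ t, hm htI, ?_⟩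
    rw [hd t htI, hw, smul_add, ← add_assoc, ← add_smul, hst, one_smul]

section Metric

variable [PathConnectedSpace X]

/-- The flat metric, which is finite on a path connected surface with a developing map. -/
@[reducible] noncomputable def flatPseudoMetric (hdev : IsTranslationMap dev) :
    PseudoMetricSpace (FlatMetric X) :=
  PseudoEMetricSpace.toPseudoMetricSpace (flatEDist_ne_top (X := X) hdev)

/-- The metric of the completion. -/
@[reducible] noncomputable def flatCompletionMetric (hdev : IsTranslationMap dev) :
    MetricSpace (FlatCompletion X) :=
  letI := flatPseudoMetric hdev
  inferInstanceAs (MetricSpace (UniformSpace.Completion (FlatMetric X)))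

theorem dist_toCompletion (hdev : IsTranslationMap dev) (x y : X) :
    letI := flatCompletionMetric hdev
    dist (toCompletion x) (toCompletion y) = (flatEDist x y).toReal := by
  let := flatPseudoMetric hdev
  exact UniformSpace.Completion.dist_eq (α := FlatMetric X) x y

theorem dist_toCompletion_lt (hdev : IsTranslationMap dev) {x y : X} {r : ℝ} :
    letI := flatCompletionMetric hdev
    dist (toCompletion x) (toCompletion y) < r ↔ flatEDist x y < ENNReal.ofReal r := by
  rw [dist_toCompletion hdev]
  exact (ENNReal.lt_ofReal_iff_toReal_lt (flatEDist_ne_top hdev x y)).symm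

theorem lipschitzWith_dev (hdev : IsTranslationMap dev) :
    letI := flatPseudoMetric hdev
    LipschitzWith 1 (fun x : FlatMetric X => dev x) := by
  intro x y
  rw [ENNReal.coe_one, one_mul]
  exact edist_dev_le hdev x y

theorem exists_completion_isometry (hdev : IsTranslationMap dev) {g : X ≃ₜ X}
    (hg : IsTranslationAut dev g) :
    letI := flatCompletionMetric hdev
    ∃ G : FlatCompletion X ≃ᵢ FlatCompletion X, ∀ x, G (toCompletion x) = toCompletion (g x) := by
  let := flatPseudoMetric hdev
  let f : FlatMetric X → FlatMetric X := fun x => g x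
  let f' : FlatMetric X → FlatMetric X := fun x => g.symm x
  have hf : Isometry f := fun x y => hg.flatEDist_eq hdev x y
  have hf' : Isometry f' := fun x y => hg.symm.flatEDist_eq hdev x y
  have hc : f ∘ f' = id := funext fun x => g.apply_symm_apply x
  refine ⟨IsometryEquiv.mk' (UniformSpace.Completion.map f) (UniformSpace.Completion.map f')
    (fun x => ?_) hf.completion_map, fun x => ?_⟩
  · rw [← Function.comp_apply (f := UniformSpace.Completion.map f),
      UniformSpace.Completion.map_comp hf.uniformContinuous hf'.uniformContinuous, hc,
      UniformSpace.Completion.map_id, id]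
  · exact UniformSpace.Completion.map_coe hf.uniformContinuous (x : FlatMetric X)

/-- The completion of a surface that covers a precompact surface, with transitive covering
transformations, is a flat model. -/
theorem flatModel_completion (hdev : IsTranslationMap dev) {f : X → Y} (hf : IsTranslationMap f)
    (hlift : ∀ (x : X) (y : Y) (r : ENNReal), flatEDist (f x) y < r →
      ∃ x', f x' = y ∧ flatEDist x x' < r)
    (hdeck : ∀ x x', f x = f x' → ∃ g : X ≃ₜ X, (∀ z, f (g z) = f z) ∧ g x = x')
    (hY : IsPrecompact Y) (hdisc : DiscreteTopology (surfaceFrontier X))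
    (hne : (surfaceFrontier X).Nonempty) :
    letI := flatCompletionMetric hdev
    FlatModel dev (toCompletion (X := X)) (devExtension dev) := by
  let := flatPseudoMetric hdev
  let := flatCompletionMetric hdev
  have : Nonempty X := PathConnectedSpace.nonempty
  refine ⟨hdev.isLocalHomeomorph, UniformSpace.Completion.denseRange_coe (α := FlatMetric X),
    (lipschitzWith_dev hdev).completion_extension, fun x => ?_, fun U hU x hx y hy => ?_,
    fun x y r hr => ?_, fun g hg => exists_completion_isometry hdev hg, hdisc, hne,
    fun ε hε => ?_⟩
  · exact UniformSpace.Completion.extension_coe (lipschitzWith_dev hdev).uniformContinuous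
      (x : FlatMetric X)
  · rw [dist_toCompletion hdev, ← ENNReal.toReal_ofReal dist_nonneg, ← edist_dist]
    exact ENNReal.toReal_mono (edist_ne_top _ _) (hU.flatEDist_le hdev hx hy)
  · refine (joinedIn_of_flatEDist_lt hdev ((dist_toCompletion_lt hdev).1 hr)).mono fun z hz => ?_
    exact (dist_toCompletion_lt hdev).2 hz
  · obtain ⟨t, ht, hcov⟩ := EMetric.totallyBounded_iff.1 hY (ENNReal.ofReal ε)
      (ENNReal.ofReal_pos.2 hε)
    classical
    -- One point over each centre of a finite net of `Y`. Lifting short distances and applying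
    -- covering transformations brings every point near a translate of one of them.
    let σ : Y → X := Function.invFun f
    refine ⟨σ '' t, ht.image σ, fun x => ?_⟩
    obtain ⟨y, hy, hxy⟩ := mem_iUnion₂.1 (hcov (mem_univ (f x : FlatMetric Y)))
    obtain ⟨x', hx', hd⟩ := hlift x y _ hxy
    have hσ : f (σ y) = y := Function.invFun_eq ⟨x', hx'⟩
    obtain ⟨g, hg, hgx⟩ := hdeck (σ y) x' (hσ.trans hx'.symm)
    exact ⟨σ y, mem_image_of_mem _ hy, g, isTranslationAut_of_comp_eq hdev hf hg, by
      rw [hgx]; exact (dist_toCompletion_lt hdev).2 hd⟩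

end Metric

/-- On a line the differences span at most one dimension. Maximal span would then require `2 ≤ 1`,
or at most two points where there are at least five. -/
theorem HasMaximalSpan.exists_inner_ne {A : Set Plane} (hA : HasMaximalSpan A)
    (h5 : 5 ≤ A.encard) {w : Plane} (hw : w ≠ 0) (c : ℝ) : ∃ p ∈ A, inner ℝ w p ≠ c := by
  by_contra! hall
  obtain ⟨B, hB, h⟩ := hA
  set S := Submodule.span ℝ {v : Plane | ∃ b ∈ B, ∃ b' ∈ B, v = b - b'} with hS
  have hle : S ≤ (Submodule.span ℝ {w})ᗮ := by
    rw [hS, Submodule.span_le]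
    rintro _ ⟨b, hb, b', hb', rfl⟩
    rw [SetLike.mem_coe, Submodule.mem_orthogonal_singleton_iff_inner_right, inner_sub_right,
      hall b (hB hb), hall b' (hB hb'), sub_self]
  have h1 : Module.finrank ℝ S ≤ 1 := by
    have e1 := Submodule.finrank_mono hle
    have e2 := Submodule.finrank_add_finrank_orthogonal (Submodule.span ℝ {w})
    rw [finrank_span_singleton hw, finrank_euclideanSpace_fin] at e2
    omega
  have h2 : (Module.finrank ℝ S : ℕ∞) ≤ 1 := by exact_mod_cast h1
  rcases h with h | h
  · exact absurd (h.trans h2) (by norm_num)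
  · have h3 := h5.trans ((tsub_le_iff_right.1 h).trans (add_le_add_left h2 1))
    exact absurd h3 (by norm_num)

theorem exists_conic_translate (k : Fin 6 → ℝ) (τ : Plane) :
    ∃ k', (fun p => p + τ) '' {p | conic k p < 0} = {p | conic k' p < 0} := by
  refine ⟨![k 0, k 1, k 2, k 3 - 2 * k 0 * τ 0 - k 1 * τ 1, k 4 - 2 * k 2 * τ 1 - k 1 * τ 0,
    conic k (-τ)], ?_⟩
  have h : ∀ p, conic ![k 0, k 1, k 2, k 3 - 2 * k 0 * τ 0 - k 1 * τ 1,
      k 4 - 2 * k 2 * τ 1 - k 1 * τ 0, conic k (-τ)] p = conic k (p - τ) := by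
    intro p
    simp only [conic, Matrix.cons_val, PiLp.sub_apply, PiLp.neg_apply]
    ring
  ext p
  simp only [mem_image, mem_ofPred_eq, h]
  constructor
  · rintro ⟨p', hp', rfl⟩
    rwa [add_sub_cancel_right]
  · intro hp
    exact ⟨p - τ, hp, sub_add_cancel p τ⟩

end Instantiation

end FlatSurface

namespace FlatSurface

/-! ### Translates of rigid flat conics and of their orbits -/

section Rigid

variable {X : Type*} [TopologicalSpace X] [T2Space X] {M : Type*} [MetricSpace M]
  {dev : X → Plane} {ι : X → M} {devM : M → Plane} {U : Set X}

/-- Flat conics with at least five cone points, not all on a line. -/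
structure IsRigidFlat (dev : X → Plane) (ι : X → M) (devM : M → Plane) (U : Set X) : Prop where
  flat : IsFlat dev U
  conic : ∃ k, dev '' U = {p | conic k p < 0}
  card : 5 ≤ (coneOn ι U).encard
  span : ∀ w ≠ 0, ∀ c : ℝ, ∃ ζ ∈ coneOn ι U, inner ℝ w (devM ζ) ≠ c

theorem FlatModel.isRigidFlat_translate (h : FlatModel dev ι devM)
    {g : X ≃ₜ X} (hg : IsTranslationAut dev g) (hU : IsRigidFlat dev ι devM U) :
    IsRigidFlat dev ι devM (g '' U) := by
  obtain ⟨G, hG⟩ := h.ext g hg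
  have hcone : ∀ m ∈ coneOn ι U, G m ∈ coneOn ι (g '' U) := fun m hm =>
    (h.ext_mem_coneOn hG rfl).2 hm
  have hflat := hU.flat.translate hg
  obtain ⟨τ, hτ⟩ := hg
  obtain ⟨k, hk⟩ := hU.conic
  refine ⟨hflat, ?_, ?_, fun w hw c => ?_⟩
  · obtain ⟨k', hk'⟩ := exists_conic_translate k τ
    exact ⟨k', by rw [dev_image_translate hτ, hk, hk']⟩
  · refine hU.card.trans ?_
    rw [← G.injective.encard_image]
    exact encard_le_encard (image_subset_iff.2 hcone)
  · obtain ⟨ζ, hζ, hne⟩ := hU.span w hw (c - inner ℝ w τ)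
    refine ⟨G ζ, hcone ζ hζ, fun he => hne ?_⟩
    rw [h.devM_ext hτ hG, inner_add_right] at he
    linarith

end Rigid

theorem deckOrbit_image {X X' : Type*} [TopologicalSpace X'] {p : X' → X} {U : Set X'}
    {g : X' ≃ₜ X'} (hg : ∀ x, p (g x) = p x) : deckOrbit p (g '' U) = deckOrbit p U := by
  ext W
  constructor
  · rintro ⟨k, hk, rfl⟩
    exact ⟨g.trans k, fun x => (hk _).trans (hg x), by rw [← image_comp]; rfl⟩
  · rintro ⟨k, hk, rfl⟩
    refine ⟨g.symm.trans k, fun x => ?_, ?_⟩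
    · rw [Homeomorph.trans_apply, hk, ← hg, g.apply_symm_apply]
    · rw [← image_comp]
      refine image_congr fun x _ => ?_
      simp

end FlatSurface
-- Proof of the proposition
theorem mainTheorem7
    {X X' Y : Type*}
    -- the surface `X`, its universal cover `X'`, and the precompact surface `Y` covered by `X`
    [TopologicalSpace X] [T2Space X] [ConnectedSpace X]
    [ChartedSpace Plane X] [HasGroupoid X translationGroupoid]
    [TopologicalSpace X'] [SimplyConnectedSpace X']
    [ChartedSpace Plane X'] [HasGroupoid X' translationGroupoid]
    [TopologicalSpace Y] [T2Space Y] [ConnectedSpace Y]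
    [ChartedSpace Plane Y] [HasGroupoid Y translationGroupoid]
    (hYpre : IsPrecompact Y) (hYne : (surfaceFrontier Y).Nonempty)
    -- frontiers are discrete
    (hYdisc : DiscreteTopology (surfaceFrontier Y))
    (hXdisc : DiscreteTopology (surfaceFrontier X))
    (hX'disc : DiscreteTopology (surfaceFrontier X'))
    -- the coverings `X → Y` and `X' → X`, and a developing map of `X'`
    (π : X → Y) (hπ : IsCoveringMap π) (hπt : IsTranslationMap π)
    (p : X' → X) (hp : IsCoveringMap p) (hpt : IsTranslationMap p)
    (dev : X' → Plane) (hdev : IsTranslationMap dev) :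
    -- finiteness in `X`
    (∀ V : Set X, IsOpen V → V.Nonempty →
      {𝒰 : Set (Set X') | IsRigidSubconic p dev 𝒰 ∧ SubconicContains p 𝒰 V}.Finite) ∧
    -- finiteness in the universal cover
    (∀ V : Set X', IsOpen V → V.Nonempty →
      {U : Set X' | IsLiftedRigid dev U ∧ V ⊆ U}.Finite) ∧
    -- closure finiteness: each closed cell meets only finitely many cells
    (∀ Z ⊆ surfaceFrontier X', 3 ≤ Z.encard → (openCell dev Z).Nonempty →
      {C : Set (Set X') | C ∈ cells dev ∧ (C ∩ closedCell dev Z).Nonempty}.Finite) := by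
  have : LocallyPathConnectedSpace X' := ChartedSpace.locallyPathConnectedSpace Plane X'
  have : T2Space X' := t2Space_of_isCoveringMap hp
  have : Nonempty X' := PathConnectedSpace.nonempty
  have hsurjp : Function.Surjective p := surjective_of_isCoveringMap hp
  have : Nonempty X := this.map p
  have hf : IsTranslationMap (π ∘ p) := hπt.comp hpt
  have hlift : ∀ (x : X') (y : Y) (r : ENNReal), flatEDist ((π ∘ p) x) y < r →
      ∃ x', (π ∘ p) x' = y ∧ flatEDist x x' < r := by
    intro x y r hr
    obtain ⟨z, rfl, hz⟩ := exists_lift_flatEDist_lt hπ hπt hr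
    obtain ⟨x', rfl, hx'⟩ := exists_lift_flatEDist_lt hp hpt hz
    exact ⟨x', rfl, hx'⟩
  let := flatCompletionMetric hdev
  have : CompleteSpace (FlatCompletion X') :=
    inferInstanceAs (CompleteSpace (UniformSpace.Completion (FlatMetric X')))
  have hM : FlatModel dev (toCompletion (X := X')) (devExtension dev) :=
    flatModel_completion hdev hf hlift (fun x x' h => exists_deck hp hπ h) hYpre hX'disc
      (surfaceFrontier_nonempty_of_lift hf hlift
        ((surjective_of_isCoveringMap hπ).comp hsurjp) hYne)
  have hcone : ∀ U, IsLiftedSubconic dev U → conePointsOn U = coneOn toCompletion U :=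
    fun U hU => hM.frontier_inter (hU.isFlat hdev).isOpen
  have hconic : ∀ U, IsLiftedSubconic dev U → ∃ k, dev '' U = {p | conic k p < 0} := by
    rintro U ⟨-, q, hq⟩
    obtain ⟨k, hk⟩ := exists_conic q
    exact ⟨k, hq.trans hk⟩
  have hrigid : ∀ U, IsLiftedRigid dev U → IsRigidFlat dev toCompletion (devExtension dev) U := by
    rintro U ⟨hU, h5, hspan⟩
    rw [hcone U hU] at h5 hspan
    have hinj : InjOn (devExtension dev) (coneOn toCompletion U) := fun x hx y hy he =>
      hM.eq_of_closure (hU.isFlat hdev) hx.1 hy.1 he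
    refine ⟨hU.isFlat hdev, hconic U hU, h5, fun w hw c => ?_⟩
    obtain ⟨_, ⟨ζ, hζ, rfl⟩, hne⟩ := hspan.exists_inner_ne
      (by rw [hinj.encard_image]; exact h5) hw c
    exact ⟨ζ, hζ, hne⟩
  have hfin : ∀ (V : Set X') (v : X') (r : ℝ), v ∈ V → 0 < r → dev '' V = Metric.ball (dev v) r →
      {U | IsRigidFlat dev toCompletion (devExtension dev) U ∧ V ⊆ U}.Finite :=
    fun V v r hv hr hV => (hM.finite_rigid hv hr hV).subset fun U hU =>
      ⟨hU.1.flat, hU.2, hU.1.conic, hU.1.card, hU.1.span⟩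
  refine ⟨fun V hV hVne => ?_, fun V hV hVne => ?_, fun Z hZ h3 hne => ?_⟩
  · obtain ⟨x₀, hx₀⟩ := hVne
    obtain ⟨y₀, rfl⟩ := hsurjp x₀
    obtain ⟨r, hr, B, hBV, hB, hyB, hBr⟩ := exists_flat_ball_subset hM.loc
      ((hV.preimage hp.continuous).mem_nhds hx₀)
    -- Each orbit in question is shown to have a representative that contains the fixed flat ball
    -- `B` upstairs.
    refine ((hfin B y₀ r hyB hr hBr).image (deckOrbit p)).subset ?_
    rintro _ ⟨⟨U, hU, rfl⟩, _, ⟨g, hg, rfl⟩, s, hs, hsp, hsU⟩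
    -- A covering transformation of `p` moves the value of the section over `p y₀` to `y₀`. By
    -- uniqueness of lifts the translated section then inverts `p` on `B`, so the translated
    -- subconic contains `B`.
    obtain ⟨g', hg', hgy⟩ := exists_deck (π := fun x : X => x) hp
      isCoveringMap_id (x := s ⟨p y₀, hx₀⟩) (x' := y₀) (hsp _)
    have hgg : ∀ x, p ((g.trans g') x) = p x := fun x => (hg' _).trans (hg x)
    refine ⟨(g.trans g') '' U, ⟨hM.isRigidFlat_translate
      (isTranslationAut_of_comp_eq hdev hpt hgg) (hrigid U hU), fun y hy => ?_⟩,
      deckOrbit_image hgg⟩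
    have hcomp : EqOn (fun z : B => (z : X')) (fun z : B => g' (s ⟨p z, hBV z.2⟩)) univ := by
      have := isPreconnected_iff_preconnectedSpace.1 (hB.isPreconnected hM.loc)
      refine hp.eqOn_of_comp_eqOn isPreconnected_univ ?_ ?_ ?_ (mem_univ (⟨y₀, hyB⟩ : B)) hgy.symm
      · exact continuous_subtype_val.continuousOn
      · exact (g'.continuous.comp (hs.comp
          ((hp.continuous.comp continuous_subtype_val).subtype_mk _))).continuousOn
      · intro z _
        exact ((hg' (s ⟨p z, hBV z.2⟩)).trans (hsp ⟨p z, hBV z.2⟩)).symm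
    have hy' : y = g' (s ⟨p y, hBV hy⟩) := hcomp (mem_univ (⟨y, hy⟩ : B))
    obtain ⟨z, hz, hzs⟩ := hsU ⟨p y, hBV hy⟩
    exact ⟨z, hz, by rw [Homeomorph.trans_apply, hzs, ← hy']⟩
  · obtain ⟨x₀, hx₀⟩ := hVne
    obtain ⟨r, hr, B, hBV, hB, hyB, hBr⟩ := exists_flat_ball_subset hM.loc (hV.mem_nhds hx₀)
    exact (hfin B x₀ r hyB hr hBr).subset fun U hU => ⟨hrigid U hU.1, hBV.trans hU.2⟩
  · obtain ⟨U₀, hU₀, hUZ, hcomp⟩ := hne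
    have hZe : coneOn toCompletion U₀ = Z := (hcone U₀ hU₀).symm.trans hUZ
    obtain ⟨k, hk⟩ := hconic U₀ hU₀
    have hfinite := hM.finite_coneOn_of_cell (hU₀.isFlat hdev) hk (by rw [hZe]; exact h3)
      (by rw [hZe]; exact hcomp)
    -- A cell is determined by the set of cone points of any member, and members of the closed cell
    -- have only finitely many such sets.
    refine (hfinite.image (openCell dev)).subset ?_
    rintro _ ⟨⟨-, Z', -, -, rfl⟩, U, ⟨hU, hUZ', -⟩, -, hZU⟩
    refine ⟨Z', ⟨U, ⟨hU.isFlat hdev, hconic U hU, ?_⟩, ?_⟩, rfl⟩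
    · rw [hZe, ← hcone U hU]; exact hZU
    · rw [← hcone U hU]; exact hUZ'
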